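/- Let $k$ be a field and let $d,n\ge 1$ be integers. Let $(\ell_i)_{i\in\mathbb Z}$ be an $n$-periodic sequence of integers with $1\le \ell_i\le \ell_{i-1}+1$ (a Kupisch series of type $\widetilde{\mathbb A}_{n-1}$). For $m\geq 1$ let $os^{m}_{\ell}$ be the set of integer sequences $x_1<\dots<x_{m}$ with $x_{m}-x_1+1\le \ell_{x_{m}}+m-1$, write $x\preccurlyeq y$ if $x_1\le y_1<x_2\le y_2<\dots<x_m\le y_m$, and let $\ell[1]_i=\ell_{i+1}$. The $d$-Nakayama category $\mathcal A^{(d)}_{\ell}$ is the $k$-linear category given by the quiver with vertices $os^d_{\ell[1]}$ and arrows $a_i(x):x\to x+e_i$, with relations $a_i(x+e_j)a_j(x)=a_j(x+e_i)a_i(x)$, where an arrow is read as $0$ if one of its ends is not a vertex; for $d=1$ the relations are instead that every path ending at $y$ with at least $\ell_{y+1}$ arrows is zero. The $d$-Nakayama algebra $A=A^{(d)}_{\ell}$ is its orbit category under the group generated by the translation by $(n,\dots,n)$; $k$-linear categories with finitely many objects are identified with algebras, and modules are right modules. For $x\in os^{d+1}_{\ell}$ let $\widehat M(x)$ be the interval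 module over $\mathcal A^{(d)}_{\ell}$ with value $k$ at the $z$ with $(x_1,\dots,x_d)\preccurlyeq z\preccurlyeq(x_2-1,\dots,x_{d+1}-1)$ and $0$ elsewhere, and let $M(x)$ be its push-down to $A$. Let $\sigma(x)=x-(n,\dots,n)$. For $c\in\mathbb Z$ let $f^c_{yx}:M(x)\to M(y)$ be the push-down of the canonical map $\widehat M(x)\to\widehat M(\sigma^c(y))$ (the identity of $k$ wherever both modules are $k$) if $x\preccurlyeq\sigma^c(y)$, and $f^c_{yx}=0$ otherwise. Let $\mathcal M^{(d)}_{\ell}=\mathrm{add}\{M(x)\mid x\in os^{d+1}_{\ell}\}$ and let $\mathcal P_{\ell}\subseteq \mathcal M^{(d)}_{\ell}$ be its subcategory of projective objects, $\mathcal P_\ell=\mathrm{add}\{M(x)\mid x_{d+1}-x_1+1=\ell_{x_{d+1}}+d\}$. Let $f(i)=i-\ell_i-d+1$, let $\overline f:\{1,\dots,n\}\to\{1,\dots,n\}$ be the map with $\overline f(i)\equiv f(i)\pmod n$, let $J$ be the set of periodic points of $\overline f$, let $I=J+n\mathbb Z$ and $n'=|J|$. Let $\mathcal W=\mathrm{add}\{M(x)\mid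 x\in os_I^{d+1}\}$, where $os_I^{d+1}=\{x\in os^{d+1}_{\ell}\mid x_i\in I\text{ for all } i\}$, and $\mathcal P_I=\mathcal W\cap\mathcal P_\ell$. Then there is an order-preserving bijection $\mathbb Z\to I$, and for every such bijection $\iota$ the number $\ell'=|[f(\iota(j)),\iota(j)]\cap I|-d$ does not depend on $j\in\mathbb Z$. Assume $\ell'\ge 2$ and let $A'=A^{(d)}_{n',\ell'}$ be the $d$-Nakayama algebra with constant Kupisch series $(\ell',\dots,\ell')$ of period $n'$, and $\mathcal M^{(d)}_{n',\ell'}$ its category $\mathrm{add}\{M(x)\mid x\in os^{d+1}_{\ell'}\}$. Then: (a) $x\mapsto\iota(x)=(\iota(x_1),\dots,\iota(x_{d+1}))$ is a bijection $os^{d+1}_{\ell'}\to os^{d+1}_I$ which preserves and reflects $\preccurlyeq$, and it induces a $k$-linear equivalence $\iota^*:\mathcal M^{(d)}_{n',\ell'}\to\mathcal W$ with $M(x)\mapsto M(\iota(x))$ and $f^c_{yx}\mapsto f^c_{\iota(y)\iota(x)}$; moreover an object $X$ of $\mathcal M^{(d)}_{n',\ell'}$ is projective (lies in $\mathcal P_{\ell'}$)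 if and only if $\iota^*X$ is (lies in $\mathcal P_\ell$). (b) $\mathcal P_I$ has a basic additive generator, that is, an object $P$ which is a finite direct sum of pairwise non-isomorphic indecomposable objects and satisfies $\mathcal P_I=\mathrm{add}\,P$. For every such $P$ the algebra $B=\mathrm{End}_A(P)$ is isomorphic to an idempotent subalgebra $eAe$ of $A$ with $e=e^2\in A$, it is isomorphic to $A'$ as a $k$-algebra, and it is self-injective. -/

import Mathlib

open CategoryTheory CategoryTheory.Limits
noncomputable section
namespace HigherNakayama
universe u

section BoundQuiver
variable (k : Type u) [Field k] {V : Type} [Quiver.{0} V]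

abbrev PathSpan (a b : V) : Type u := Quiver.Path a b →₀ k

variable {k}
def pathComp {a b c : V} : PathSpan k a b →ₗ[k] PathSpan k b c →ₗ[k] PathSpan k a c :=
  Finsupp.lsum k fun p =>
    LinearMap.toSpanSingleton k _ (Finsupp.lmapDomain k k fun q : Quiver.Path b c => p.comp q)

theorem pathComp_single {a b c : V} (p : Quiver.Path a b) (q : Quiver.Path b c) (r s : k) :
    pathComp (Finsupp.single p r) (Finsupp.single q s) = Finsupp.single (p.comp q) (r * s) := by
  simp [pathComp, Finsupp.mapDomain_single]

theorem pathComp_assoc {a b c e : V} (f : PathSpan k a b) (g : PathSpan k b c)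
    (h : PathSpan k c e) : pathComp (pathComp f g) h = pathComp f (pathComp g h) := by
  induction f using Finsupp.induction_linear with
  | zero => simp
  | add f₁ f₂ h₁ h₂ => simp only [map_add, LinearMap.add_apply, h₁, h₂]
  | single p r =>
    induction g using Finsupp.induction_linear with
    | zero => simp
    | add f₁ f₂ h₁ h₂ => simp only [map_add, LinearMap.add_apply, h₁, h₂]
    | single q s =>
      induction h using Finsupp.induction_linear with
      | zero => simp
      | add f₁ f₂ h₁ h₂ => simp only [map_add, h₁, h₂]
      | single t v => simp only [pathComp_single, Quiver.Path.comp_assoc, mul_assoc]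

theorem pathComp_nil_left {a b : V} (f : PathSpan k a b) :
    pathComp (Finsupp.single Quiver.Path.nil 1) f = f := by
  induction f using Finsupp.induction_linear with
  | zero => simp
  | add f₁ f₂ h₁ h₂ => simp only [map_add, h₁, h₂]
  | single p r => simp [pathComp_single]

theorem pathComp_nil_right {a b : V} (f : PathSpan k a b) :
    pathComp f (Finsupp.single Quiver.Path.nil 1) = f := by
  induction f using Finsupp.induction_linear with
  | zero => simp
  | add f₁ f₂ h₁ h₂ => simp only [map_add, LinearMap.add_apply, h₁, h₂]
  | single p r => simp [pathComp_single]

/-- The two-sided ideal of the path category generated by the relations `R`. -/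
def relIdeal (R : ∀ a b : V, PathSpan k a b → Prop) (a b : V) : Submodule k (PathSpan k a b) :=
  Submodule.span k {f | ∃ (a' b' : V) (p : Quiver.Path a a') (r : PathSpan k a' b')
    (q : Quiver.Path b' b), R a' b' r ∧
      f = pathComp (Finsupp.single p 1) (pathComp r (Finsupp.single q 1))}

theorem relIdeal_comp_right (R : ∀ a b : V, PathSpan k a b → Prop) {a b c : V}
    {f : PathSpan k a b} (hf : f ∈ relIdeal R a b) (g : PathSpan k b c) :
    pathComp f g ∈ relIdeal R a c := by
  induction g using Finsupp.induction_linear with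
  | zero => simp
  | add f₁ f₂ h₁ h₂ => rw [map_add]; exact add_mem h₁ h₂
  | single t s =>
    rw [← mul_one s, ← smul_eq_mul, ← Finsupp.smul_single, map_smul]
    apply Submodule.smul_mem
    induction hf using Submodule.span_induction with
    | zero => simp
    | add _ _ _ _ h₁ h₂ => rw [map_add, LinearMap.add_apply]; exact add_mem h₁ h₂
    | smul r _ _ h => rw [map_smul, LinearMap.smul_apply]; exact Submodule.smul_mem _ _ h
    | mem f hf =>
      obtain ⟨a', b', p, r, q, hr, rfl⟩ := hf
      refine Submodule.subset_span ⟨a', b', p, r, q.comp t, hr, ?_⟩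
      simp only [pathComp_assoc, pathComp_single, mul_one]

theorem relIdeal_comp_left (R : ∀ a b : V, PathSpan k a b → Prop) {a b c : V}
    (g : PathSpan k a b) {f : PathSpan k b c} (hf : f ∈ relIdeal R b c) :
    pathComp g f ∈ relIdeal R a c := by
  induction g using Finsupp.induction_linear with
  | zero => simp
  | add f₁ f₂ h₁ h₂ => rw [map_add, LinearMap.add_apply]; exact add_mem h₁ h₂
  | single t s =>
    rw [← mul_one s, ← smul_eq_mul, ← Finsupp.smul_single, map_smul, LinearMap.smul_apply]
    apply Submodule.smul_mem
    induction hf using Submodule.span_induction with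
    | zero => simp
    | add _ _ _ _ h₁ h₂ => rw [map_add]; exact add_mem h₁ h₂
    | smul r _ _ h => rw [map_smul]; exact Submodule.smul_mem _ _ h
    | mem f hf =>
      obtain ⟨a', b', p, r, q, hr, rfl⟩ := hf
      refine Submodule.subset_span ⟨a', b', t.comp p, r, q, hr, ?_⟩
      rw [← pathComp_assoc, pathComp_single, mul_one]

/-- The objects of the `k`-linear category `kQ / ⟨R⟩` given by a quiver with relations. -/
structure BoundQuiver (R : ∀ a b : V, PathSpan k a b → Prop) : Type where
  vertex : V

namespace BoundQuiver
variable {R : ∀ a b : V, PathSpan k a b → Prop}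

abbrev Hom (X Y : BoundQuiver R) : Type u :=
  PathSpan k X.vertex Y.vertex ⧸ relIdeal R X.vertex Y.vertex

def comp {X Y Z : BoundQuiver R} : Hom X Y →ₗ[k] Hom Y Z →ₗ[k] Hom X Z :=
  ((relIdeal R Y.vertex Z.vertex).liftQ
    ((relIdeal R X.vertex Y.vertex).liftQ
      (pathComp.compr₂ (relIdeal R X.vertex Z.vertex).mkQ) (fun f hf => by
        refine LinearMap.ext fun g => ?_
        simpa using relIdeal_comp_right R hf g)).flip (fun g hg => by
      refine LinearMap.ext fun f => ?_
      obtain ⟨f, rfl⟩ := Submodule.mkQ_surjective _ f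
      exact (Submodule.Quotient.mk_eq_zero _).2 (relIdeal_comp_left R f hg))).flip

instance : Category.{u} (BoundQuiver R) where
  Hom X Y := Hom X Y
  id X := Submodule.Quotient.mk (Finsupp.single Quiver.Path.nil 1)
  comp f g := comp f g
  id_comp f := by
    obtain ⟨f, rfl⟩ := Submodule.mkQ_surjective _ f
    exact congrArg _ (pathComp_nil_left f)
  comp_id f := by
    obtain ⟨f, rfl⟩ := Submodule.mkQ_surjective _ f
    exact congrArg _ (pathComp_nil_right f)
  assoc f g h := by
    obtain ⟨f, rfl⟩ := Submodule.mkQ_surjective _ f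
    obtain ⟨g, rfl⟩ := Submodule.mkQ_surjective _ g
    obtain ⟨h, rfl⟩ := Submodule.mkQ_surjective _ h
    exact congrArg _ (pathComp_assoc f g h)

instance instAddCommGroupHom (X Y : BoundQuiver R) : AddCommGroup (X ⟶ Y) :=
  inferInstanceAs (AddCommGroup (Hom X Y))

instance instModuleHom (X Y : BoundQuiver R) : Module k (X ⟶ Y) :=
  inferInstanceAs (Module k (Hom X Y))

instance : Preadditive (BoundQuiver R) where
  homGroup X Y := instAddCommGroupHom X Y
  add_comp X Y Z f f' g := LinearMap.map_add₂ (comp (X := X) (Y := Y) (Z := Z)) f f' g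
  comp_add X Y Z f g g' := map_add (comp (X := X) (Y := Y) (Z := Z) f) g g'

instance : Linear k (BoundQuiver R) where
  homModule X Y := instModuleHom X Y
  smul_comp X Y Z r f g := LinearMap.map_smul₂ (comp (X := X) (Y := Y) (Z := Z)) r f g
  comp_smul X Y Z f r g := map_smul (comp (X := X) (Y := Y) (Z := Z) f) r g

/-- The morphism represented by a linear combination of paths. -/
def ofPaths (X Y : BoundQuiver R) : PathSpan k X.vertex Y.vertex →ₗ[k] (X ⟶ Y) :=
  (relIdeal R X.vertex Y.vertex).mkQ

theorem ofPaths_surjective (X Y : BoundQuiver R) : Function.Surjective (ofPaths X Y) :=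
  Submodule.mkQ_surjective _

theorem ofPaths_comp {X Y Z : BoundQuiver R} (f : PathSpan k X.vertex Y.vertex)
    (g : PathSpan k Y.vertex Z.vertex) : ofPaths X Y f ≫ ofPaths Y Z g = ofPaths X Z (pathComp f g) := rfl

theorem id_eq (X : BoundQuiver R) : 𝟙 X = ofPaths X X (Finsupp.single Quiver.Path.nil 1) := rfl

end BoundQuiver
end BoundQuiver
namespace BoundQuiver
variable {k : Type u} [Field k] {V : Type} [Quiver.{0} V] {R : ∀ a b : V, PathSpan k a b → Prop}

def pathMap (φ : V ⥤q V) (a b : V) : PathSpan k a b →ₗ[k] PathSpan k (φ.obj a) (φ.obj b) :=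
  Finsupp.lmapDomain k k fun p => φ.mapPath p

theorem pathMap_single (φ : V ⥤q V) {a b : V} (p : Quiver.Path a b) (r : k) :
    pathMap φ a b (Finsupp.single p r) = Finsupp.single (φ.mapPath p) r := by
  simp [pathMap, Finsupp.mapDomain_single]

theorem pathMap_pathComp (φ : V ⥤q V) {a b c : V} (f : PathSpan k a b) (g : PathSpan k b c) :
    pathMap φ a c (pathComp f g) = pathComp (pathMap φ a b f) (pathMap φ b c g) := by
  induction f using Finsupp.induction_linear with
  | zero => simp
  | add f₁ f₂ h₁ h₂ => simp only [map_add, LinearMap.add_apply, h₁, h₂]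
  | single p r =>
    induction g using Finsupp.induction_linear with
    | zero => simp
    | add f₁ f₂ h₁ h₂ => simp only [map_add, h₁, h₂]
    | single q s => simp only [pathComp_single, pathMap_single, Prefunctor.mapPath_comp]

theorem pathMap_mem (φ : V ⥤q V)
    (hφ : ∀ a b (r : PathSpan k a b), R a b r → R (φ.obj a) (φ.obj b) (pathMap φ a b r)) (a b : V) :
    relIdeal R a b ≤ (relIdeal R (φ.obj a) (φ.obj b)).comap (pathMap φ a b) := by
  refine Submodule.span_le.2 ?_
  rintro _ ⟨a', b', p, r, q, hr, rfl⟩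
  refine Submodule.subset_span ⟨φ.obj a', φ.obj b', φ.mapPath p, pathMap φ a' b' r,
    φ.mapPath q, hφ _ _ _ hr, ?_⟩
  rw [pathMap_pathComp, pathMap_pathComp, pathMap_single, pathMap_single]

def mapHom (φ : V ⥤q V)
    (hφ : ∀ a b (r : PathSpan k a b), R a b r → R (φ.obj a) (φ.obj b) (pathMap φ a b r))
    (X Y : BoundQuiver R) :
    (X ⟶ Y) →ₗ[k] ((⟨φ.obj X.vertex⟩ : BoundQuiver R) ⟶ ⟨φ.obj Y.vertex⟩) :=
  Submodule.mapQ _ _ (pathMap φ X.vertex Y.vertex) (pathMap_mem φ hφ _ _)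

/-- The functor induced by a morphism of quivers which preserves the relations. -/
def mapFunctor (φ : V ⥤q V)
    (hφ : ∀ a b (r : PathSpan k a b), R a b r → R (φ.obj a) (φ.obj b) (pathMap φ a b r)) :
    BoundQuiver R ⥤ BoundQuiver R where
  obj X := ⟨φ.obj X.vertex⟩
  map {X Y} f := mapHom φ hφ X Y f
  map_id X := by
    change ofPaths ⟨φ.obj X.vertex⟩ ⟨φ.obj X.vertex⟩ (pathMap φ _ _ (Finsupp.single _ 1)) = _
    rw [pathMap_single]; rfl
  map_comp {X Y Z} f g := by
    obtain ⟨f, rfl⟩ := ofPaths_surjective X Y f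
    obtain ⟨g, rfl⟩ := ofPaths_surjective Y Z g
    change ofPaths ⟨φ.obj X.vertex⟩ ⟨φ.obj Z.vertex⟩ (pathMap φ _ _ (pathComp f g)) = _
    rw [pathMap_pathComp]; rfl

theorem mapFunctor_map_ofPaths (φ : V ⥤q V)
    (hφ : ∀ a b (r : PathSpan k a b), R a b r → R (φ.obj a) (φ.obj b) (pathMap φ a b r))
    (X Y : BoundQuiver R) (f : PathSpan k X.vertex Y.vertex) :
    (mapFunctor φ hφ).map (ofPaths X Y f) =
      ofPaths ⟨φ.obj X.vertex⟩ ⟨φ.obj Y.vertex⟩ (pathMap φ _ _ f) := rfl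

instance (φ : V ⥤q V)
    (hφ : ∀ a b (r : PathSpan k a b), R a b r → R (φ.obj a) (φ.obj b) (pathMap φ a b r)) :
    (mapFunctor φ hφ).Additive where
  map_add {X Y} f g :=
    map_add (mapHom φ hφ X Y) f g

instance (φ : V ⥤q V)
    (hφ : ∀ a b (r : PathSpan k a b), R a b r → R (φ.obj a) (φ.obj b) (pathMap φ a b r)) :
    (mapFunctor φ hφ).Linear k where
  map_smul {X Y} f r :=
    map_smul (mapHom φ hφ X Y) r f

theorem mapFunctor_id
    (h : ∀ a b (r : PathSpan k a b), R a b r →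
      R ((𝟭q V).obj a) ((𝟭q V).obj b) (pathMap (𝟭q V) a b r)) :
    mapFunctor (𝟭q V) h = 𝟭 (BoundQuiver R) := by
  refine CategoryTheory.Functor.ext (fun X => rfl) fun X Y f => ?_
  obtain ⟨f, rfl⟩ := ofPaths_surjective X Y f
  have hf : pathMap (𝟭q V) _ _ f = f := by
    induction f using Finsupp.induction_linear with
    | zero => exact map_zero _
    | add f₁ f₂ h₁ h₂ => exact (map_add _ _ _).trans (congrArg₂ _ h₁ h₂)
    | single p r => rw [pathMap_single, Prefunctor.mapPath_id]; rfl
  rw [mapFunctor_map_ofPaths, hf]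
  exact ((Category.id_comp _).trans (Category.comp_id _)).symm

theorem mapFunctor_comp (φ ψ : V ⥤q V)
    (hφ : ∀ a b (r : PathSpan k a b), R a b r → R (φ.obj a) (φ.obj b) (pathMap φ a b r))
    (hψ : ∀ a b (r : PathSpan k a b), R a b r → R (ψ.obj a) (ψ.obj b) (pathMap ψ a b r))
    (h : ∀ a b (r : PathSpan k a b), R a b r →
      R ((φ ⋙q ψ).obj a) ((φ ⋙q ψ).obj b) (pathMap (φ ⋙q ψ) a b r)) :
    mapFunctor (φ ⋙q ψ) h = mapFunctor φ hφ ⋙ mapFunctor ψ hψ := by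
  refine CategoryTheory.Functor.ext (fun X => rfl) fun X Y f => ?_
  obtain ⟨f, rfl⟩ := ofPaths_surjective X Y f
  have hf : pathMap (φ ⋙q ψ) _ _ f = pathMap ψ _ _ (pathMap φ _ _ f) := by
    induction f using Finsupp.induction_linear with
    | zero =>
      exact (map_zero (pathMap (φ ⋙q ψ) X.vertex Y.vertex)).trans (by simp only [map_zero]; rfl)
    | add f₁ f₂ h₁ h₂ =>
      refine (map_add _ _ _).trans ((congrArg₂ _ h₁ h₂).trans ?_)
      rw [map_add, map_add]; rfl
    | single p r =>
      rw [pathMap_single, pathMap_single, pathMap_single, Prefunctor.mapPath_comp_apply]; rfl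
  rw [mapFunctor_map_ofPaths, hf]
  exact ((Category.id_comp _).trans (Category.comp_id _)).symm

end BoundQuiver
section Orbit
variable (k : Type u) [Field k]

/-- An action of the infinite cyclic group `ℤ` by `k`-linear automorphisms on a `k`-linear
category. -/
structure IntAction (C : Type) [Category.{u} C] [Preadditive C] [Linear k C] where
  T : ℤ → C ⥤ C
  additive : ∀ c, (T c).Additive
  linear : ∀ c, (T c).Linear k
  zero : T 0 = 𝟭 C
  add : ∀ a b, T (a + b) = T a ⋙ T b

attribute [instance] IntAction.additive IntAction.linear

variable {k} {C : Type} [Category.{u} C] [Preadditive C] [Linear k C]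

namespace IntAction
variable (A : IntAction k C)

theorem obj_zero (X : C) : (A.T 0).obj X = X := by rw [A.zero]; rfl

theorem obj_add (a b : ℤ) (X : C) : (A.T (a + b)).obj X = (A.T b).obj ((A.T a).obj X) := by
  rw [A.add]; rfl

def orbitSetoid : Setoid C where
  r X Y := ∃ c, (A.T c).obj X = Y
  iseqv :=
    { refl := fun X => ⟨0, A.obj_zero X⟩
      symm := by
        rintro X Y ⟨c, rfl⟩
        exact ⟨-c, by rw [← A.obj_add, add_neg_cancel, A.obj_zero]⟩
      trans := by
        rintro X Y Z ⟨c, rfl⟩ ⟨e, rfl⟩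
        exact ⟨c + e, A.obj_add c e X⟩ }

/-- The objects of the orbit category are the orbits of objects. -/
structure OrbitCat : Type where
  orbit : Quotient A.orbitSetoid

variable {A}

/-- The objects lying in a given orbit. -/
abbrev Fiber (a : OrbitCat A) : Type := {X : C // Quotient.mk A.orbitSetoid X = a.orbit}

namespace Fiber

def shift {a : OrbitCat A} (c : ℤ) (X : Fiber a) : Fiber a :=
  ⟨(A.T c).obj X.1, by
    exact (Quotient.sound (s := A.orbitSetoid) ⟨c, rfl⟩).symm.trans X.2⟩

@[simp] theorem shift_val {a : OrbitCat A} (c : ℤ) (X : Fiber a) :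
    (X.shift c).1 = (A.T c).obj X.1 := rfl

theorem shift_shift {a : OrbitCat A} (c e : ℤ) (X : Fiber a) :
    (X.shift c).shift e = X.shift (c + e) :=
  Subtype.ext (A.obj_add c e X.1).symm

theorem shift_zero {a : OrbitCat A} (X : Fiber a) : X.shift 0 = X :=
  Subtype.ext (A.obj_zero X.1)

def shiftEquiv (a : OrbitCat A) (c : ℤ) : Fiber a ≃ Fiber a where
  toFun X := X.shift c
  invFun X := X.shift (-c)
  left_inv X := by simp only [shift_shift, add_neg_cancel, shift_zero]
  right_inv X := by simp only [shift_shift, neg_add_cancel, shift_zero]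

end Fiber

namespace OrbitCat

/-- The morphisms `a ⟶ b` in the orbit category: families of morphisms `X ⟶ Y`, for `X` in the
orbit `a` and `Y` in the orbit `b`, which are invariant under the action and have finite rows and
columns. -/
def homSubmodule (a b : OrbitCat A) :
    Submodule k (∀ (X : Fiber a) (Y : Fiber b), X.1 ⟶ Y.1) where
  carrier := {f | (∀ c X Y, f (X.shift c) (Y.shift c) = (A.T c).map (f X Y)) ∧
    (∀ X, {Y | f X Y ≠ 0}.Finite) ∧ ∀ Y, {X | f X Y ≠ 0}.Finite}
  add_mem' := by
    rintro f g ⟨hf, hf₁, hf₂⟩ ⟨hg, hg₁, hg₂⟩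
    refine ⟨fun c X Y => ?_, fun X => ((hf₁ X).union (hg₁ X)).subset fun Y hY => ?_,
      fun Y => ((hf₂ Y).union (hg₂ Y)).subset fun X hX => ?_⟩
    · simp only [Pi.add_apply, hf, hg, Functor.map_add]
      rfl
    · by_contra h
      simp only [Set.mem_union, Set.mem_ofPred_eq, not_or, not_not] at h
      exact hY (by simp [h.1, h.2])
    · by_contra h
      simp only [Set.mem_union, Set.mem_ofPred_eq, not_or, not_not] at h
      exact hX (by simp [h.1, h.2])
  zero_mem' := by
    refine ⟨fun c X Y => ?_, fun X => ?_, fun Y => ?_⟩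
    · exact ((A.T c).map_zero _ _).symm
    · simp
    · simp
  smul_mem' := by
    rintro r f ⟨hf, hf₁, hf₂⟩
    refine ⟨fun c X Y => ?_, fun X => (hf₁ X).subset fun Y hY => ?_,
      fun Y => (hf₂ Y).subset fun X hX => ?_⟩
    · simp only [Pi.smul_apply, hf, Functor.map_smul]
      rfl
    · intro h
      exact hY (by simp [h])
    · intro h
      exact hX (by simp [h])

abbrev Hom (a b : OrbitCat A) : Type u := homSubmodule a b

open Classical in
def idHom (a : OrbitCat A) : Hom a a :=
  ⟨fun X Y => if h : X = Y then eqToHom (congrArg Subtype.val h) else 0, by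
    refine ⟨fun c X Y => ?_, fun X => (Set.finite_singleton X).subset fun Y hY => ?_,
      fun Y => (Set.finite_singleton Y).subset fun X hX => ?_⟩
    · by_cases h : X = Y
      · subst h
        simp
        rfl
      · have h' : X.shift c ≠ Y.shift c := fun e => h ((Fiber.shiftEquiv a c).injective e)
        simp [h, h']
        rfl
    · by_contra h
      exact hY (dif_neg fun e => h e.symm)
    · by_contra h
      exact hX (dif_neg h)⟩

theorem idHom_self {a : OrbitCat A} (X : Fiber a) : (idHom a).1 X X = 𝟙 X.1 := by
  simp [idHom]

theorem idHom_of_ne {a : OrbitCat A} {X Y : Fiber a} (h : X ≠ Y) : (idHom a).1 X Y = 0 := by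
  simp [idHom, h]

/-- Matrix multiplication of invariant families. -/
def compFamily {a b c : OrbitCat A} (f : Hom a b) (g : Hom b c) (X : Fiber a) (Z : Fiber c) :
    X.1 ⟶ Z.1 :=
  ∑ᶠ Y : Fiber b, f.1 X Y ≫ g.1 Y Z

theorem compFamily_eq_left {a b c : OrbitCat A} (f : Hom a b) (g : Hom b c) (X : Fiber a)
    (Z : Fiber c) {s : Finset (Fiber b)} (hs : ∀ Y, f.1 X Y ≠ 0 → Y ∈ s) :
    compFamily f g X Z = ∑ Y ∈ s, f.1 X Y ≫ g.1 Y Z := by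
  refine finsum_eq_sum_of_support_subset _ fun Y hY => hs Y fun h => hY ?_
  simp [h]

theorem compFamily_eq_right {a b c : OrbitCat A} (f : Hom a b) (g : Hom b c) (X : Fiber a)
    (Z : Fiber c) {s : Finset (Fiber b)} (hs : ∀ Y, g.1 Y Z ≠ 0 → Y ∈ s) :
    compFamily f g X Z = ∑ Y ∈ s, f.1 X Y ≫ g.1 Y Z := by
  refine finsum_eq_sum_of_support_subset _ fun Y hY => hs Y fun h => hY ?_
  simp [h]

theorem compFamily_mem {a b c : OrbitCat A} (f : Hom a b) (g : Hom b c) :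
    compFamily f g ∈ homSubmodule a c := by
  refine ⟨fun e X Z => ?_, fun X => ?_, fun Z => ?_⟩
  · have hfin := f.2.2.1 X
    have h1 : compFamily f g (X.shift e) (Z.shift e) =
        ∑ᶠ Y : Fiber b, (A.T e).map (f.1 X Y ≫ g.1 Y Z) := by
      unfold compFamily
      rw [← finsum_comp_equiv (Fiber.shiftEquiv b e)]
      refine finsum_congr fun Y => ?_
      rw [Functor.map_comp, ← f.2.1, ← g.2.1]
      rfl
    rw [h1, compFamily_eq_left f g X Z (s := hfin.toFinset) (by simp), Functor.map_sum]
    refine finsum_eq_sum_of_support_subset _ fun Y hY => ?_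
    simp only [Set.Finite.coe_toFinset, Set.mem_ofPred_eq]
    intro h
    apply hY
    simp [h]
    rfl
  · refine ((f.2.2.1 X).biUnion fun Y _ => g.2.2.1 Y).subset fun Z hZ => ?_
    by_contra h
    simp only [Set.mem_iUnion, Set.mem_ofPred_eq, not_exists, not_not] at h
    apply hZ
    rw [compFamily_eq_left f g X Z (s := (f.2.2.1 X).toFinset) (by simp)]
    refine Finset.sum_eq_zero fun Y hY => ?_
    rw [h Y (by simpa using hY), comp_zero]
  · refine ((g.2.2.2 Z).biUnion fun Y _ => f.2.2.2 Y).subset fun X hX => ?_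
    by_contra h
    simp only [Set.mem_iUnion, Set.mem_ofPred_eq, not_exists, not_not] at h
    apply hX
    rw [compFamily_eq_right f g X Z (s := (g.2.2.2 Z).toFinset) (by simp)]
    refine Finset.sum_eq_zero fun Y hY => ?_
    rw [h Y (by simpa using hY), zero_comp]

instance : Category.{u} (OrbitCat A) where
  Hom a b := Hom a b
  id a := idHom a
  comp f g := ⟨compFamily f g, compFamily_mem f g⟩
  id_comp {a b} f := Subtype.ext <| funext fun X => funext fun Y => by
    change compFamily (idHom a) f X Y = f.1 X Y
    rw [compFamily_eq_left (idHom a) f X Y (s := {X})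
      (fun Z hZ => by by_contra h; exact hZ (idHom_of_ne fun e => h (by simp [e])))]
    simp [idHom_self]
  comp_id {a b} f := Subtype.ext <| funext fun X => funext fun Y => by
    change compFamily f (idHom b) X Y = f.1 X Y
    rw [compFamily_eq_right f (idHom b) X Y (s := {Y})
      (fun Z hZ => by by_contra h; exact hZ (idHom_of_ne fun e => h (by simp [e])))]
    simp [idHom_self]
  assoc {a b c e} f g h := Subtype.ext <| funext fun X => funext fun W => by
    let fg : Hom a c := ⟨compFamily f g, compFamily_mem f g⟩
    let gh : Hom b e := ⟨compFamily g h, compFamily_mem g h⟩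
    change compFamily fg h X W = compFamily f gh X W
    rw [compFamily_eq_right fg h X W (s := (h.2.2.2 W).toFinset) (by simp),
      compFamily_eq_left f gh X W (s := (f.2.2.1 X).toFinset) (by simp)]
    have h1 : ∀ Z, fg.1 X Z = ∑ Y ∈ (f.2.2.1 X).toFinset, f.1 X Y ≫ g.1 Y Z := fun Z =>
      compFamily_eq_left f g X Z (by simp)
    have h2 : ∀ Y, gh.1 Y W = ∑ Z ∈ (h.2.2.2 W).toFinset, g.1 Y Z ≫ h.1 Z W := fun Y =>
      compFamily_eq_right g h Y W (by simp)
    simp only [h1, h2, Preadditive.sum_comp, Preadditive.comp_sum, Category.assoc]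
    exact Finset.sum_comm

instance instAddCommGroupHom (a b : OrbitCat A) : AddCommGroup (a ⟶ b) :=
  inferInstanceAs (AddCommGroup (homSubmodule a b))

instance instModuleHom (a b : OrbitCat A) : Module k (a ⟶ b) :=
  inferInstanceAs (Module k (homSubmodule a b))

theorem comp_val {a b c : OrbitCat A} (f : a ⟶ b) (g : b ⟶ c) (X : Fiber a) (Z : Fiber c) :
    (f ≫ g).1 X Z = ∑ᶠ Y : Fiber b, f.1 X Y ≫ g.1 Y Z := rfl

theorem add_val {a b : OrbitCat A} (f g : a ⟶ b) (X : Fiber a) (Y : Fiber b) :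
    (f + g).1 X Y = f.1 X Y + g.1 X Y := rfl

theorem smul_val {a b : OrbitCat A} (r : k) (f : a ⟶ b) (X : Fiber a) (Y : Fiber b) :
    (r • f).1 X Y = r • f.1 X Y := rfl

theorem hom_ext {a b : OrbitCat A} {f g : a ⟶ b} (h : ∀ X Y, f.1 X Y = g.1 X Y) : f = g :=
  Subtype.ext <| funext fun X => funext fun Y => h X Y

instance : Preadditive (OrbitCat A) where
  homGroup a b := instAddCommGroupHom a b
  add_comp a b c f f' g := hom_ext fun X Z => by
    change compFamily (f + f') g X Z = compFamily f g X Z + compFamily f' g X Z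
    have hs := (g.2.2.2 Z)
    rw [compFamily_eq_right (f + f') g X Z (s := hs.toFinset) (by simp),
      compFamily_eq_right f g X Z (s := hs.toFinset) (by simp),
      compFamily_eq_right f' g X Z (s := hs.toFinset) (by simp), ← Finset.sum_add_distrib]
    refine Finset.sum_congr rfl fun Y _ => ?_
    rw [← Preadditive.add_comp]; rfl
  comp_add a b c f g g' := hom_ext fun X Z => by
    change compFamily f (g + g') X Z = compFamily f g X Z + compFamily f g' X Z
    have hs := (f.2.2.1 X)
    rw [compFamily_eq_left f (g + g') X Z (s := hs.toFinset) (by simp),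
      compFamily_eq_left f g X Z (s := hs.toFinset) (by simp),
      compFamily_eq_left f g' X Z (s := hs.toFinset) (by simp), ← Finset.sum_add_distrib]
    refine Finset.sum_congr rfl fun Y _ => ?_
    rw [← Preadditive.comp_add]; rfl

instance : Linear k (OrbitCat A) where
  homModule a b := instModuleHom a b
  smul_comp a b c r f g := hom_ext fun X Z => by
    change compFamily (r • f) g X Z = r • compFamily f g X Z
    have hs := (g.2.2.2 Z)
    rw [compFamily_eq_right (r • f) g X Z (s := hs.toFinset) (by simp),
      compFamily_eq_right f g X Z (s := hs.toFinset) (by simp), Finset.smul_sum]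
    refine Finset.sum_congr rfl fun Y _ => ?_
    rw [← Linear.smul_comp]; rfl
  comp_smul a b c f r g := hom_ext fun X Z => by
    change compFamily f (r • g) X Z = r • compFamily f g X Z
    have hs := (f.2.2.1 X)
    rw [compFamily_eq_left f (r • g) X Z (s := hs.toFinset) (by simp),
      compFamily_eq_left f g X Z (s := hs.toFinset) (by simp), Finset.smul_sum]
    refine Finset.sum_congr rfl fun Y _ => ?_
    rw [← Linear.comp_smul]; rfl

end OrbitCat

section Pushdown
open Opposite

variable (M : Cᵒᵖ ⥤ ModuleCat.{u} k) [M.Additive]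

variable (A) in
abbrev PushdownObj (a : OrbitCat A) : Type u := DirectSum (Fiber a) fun X => M.obj (op X.1)

open Classical in
def pushdownMap {a b : OrbitCat A} (f : a ⟶ b) : PushdownObj A M b →ₗ[k] PushdownObj A M a :=
  DirectSum.toModule k (Fiber b) _ fun Y =>
    ∑ᶠ X : Fiber a, DirectSum.lof k (Fiber a) (fun X => M.obj (op X.1)) X ∘ₗ
      (M.map (f.1 X Y).op).hom

open Classical in
theorem pushdownMap_lof {a b : OrbitCat A} (f : a ⟶ b) (Y : Fiber b) (m : M.obj (op Y.1))
    {s : Finset (Fiber a)} (hs : ∀ X, f.1 X Y ≠ 0 → X ∈ s) :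
    pushdownMap M f (DirectSum.lof k (Fiber b) (fun Y => M.obj (op Y.1)) Y m) =
      ∑ X ∈ s, DirectSum.lof k (Fiber a) (fun X => M.obj (op X.1)) X
        ((M.map (f.1 X Y).op).hom m) := by
  rw [pushdownMap, DirectSum.toModule_lof, finsum_eq_sum_of_support_subset (s := s)]
  · simp
  · intro X hX
    refine hs X fun h => hX ?_
    simp [h]

/-- The push-down `F_* M` of a right module `M` along the covering functor onto the orbit category:
`(F_* M)(a) = ⨁_{X ∈ a} M(X)`. -/
def pushdown : (OrbitCat A)ᵒᵖ ⥤ ModuleCat.{u} k where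
  obj a := ModuleCat.of k (PushdownObj A M a.unop)
  map f := ModuleCat.ofHom (pushdownMap M f.unop)
  map_id a := by
    classical
    ext1
    refine DirectSum.linearMap_ext k fun Y => LinearMap.ext fun m => ?_
    refine (pushdownMap_lof M (𝟙 a.unop) Y m (s := {Y}) ?_).trans ?_
    · intro X hX
      by_contra h
      exact hX (OrbitCat.idHom_of_ne fun e => h (by simp [e]))
    · have h : (𝟙 a.unop : a.unop ⟶ a.unop).1 Y Y = 𝟙 Y.1 := OrbitCat.idHom_self Y
      simp [h]
  map_comp {a b c} f g := by
    classical
    ext1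
    refine DirectSum.linearMap_ext k fun Z => LinearMap.ext fun m => ?_
    change pushdownMap M (g.unop ≫ f.unop)
        (DirectSum.lof k (Fiber a.unop) (fun Y => M.obj (op Y.1)) Z m) =
      pushdownMap M g.unop (pushdownMap M f.unop
        (DirectSum.lof k (Fiber a.unop) (fun Y => M.obj (op Y.1)) Z m))
    have hf := f.unop.2.2.2 Z
    let s := hf.toFinset
    let t := s.biUnion fun Y => (g.unop.2.2.2 Y).toFinset
    have ht : ∀ Y ∈ s, ∀ X, g.unop.1 X Y ≠ 0 → X ∈ t := fun Y hY X hX => by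
      simp only [t, Finset.mem_biUnion]
      exact ⟨Y, hY, by simpa using hX⟩
    have hc : ∀ X, (g.unop ≫ f.unop).1 X Z = ∑ Y ∈ s, g.unop.1 X Y ≫ f.unop.1 Y Z := fun X =>
      OrbitCat.compFamily_eq_right g.unop f.unop X Z (by simp [s])
    rw [pushdownMap_lof M f.unop Z m (s := s) (by simp [s]),
      pushdownMap_lof M (g.unop ≫ f.unop) Z m (s := t), map_sum]
    · have h1 : ∀ Y ∈ s, pushdownMap M g.unop
          (DirectSum.lof k (Fiber b.unop) (fun Y => M.obj (op Y.1)) Y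
            ((M.map (f.unop.1 Y Z).op).hom m)) =
          ∑ X ∈ t, DirectSum.lof k (Fiber c.unop) (fun X => M.obj (op X.1)) X
            ((M.map (g.unop.1 X Y).op).hom ((M.map (f.unop.1 Y Z).op).hom m)) := fun Y hY =>
        pushdownMap_lof M g.unop Y _ (ht Y hY)
      rw [Finset.sum_congr rfl h1, Finset.sum_comm]
      refine Finset.sum_congr rfl fun X _ => ?_
      rw [hc, ← map_sum]
      congr 1
      rw [op_sum, Functor.map_sum]
      simp [ModuleCat.hom_sum]
    · intro X hX
      by_contra h
      apply hX
      rw [hc]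
      refine Finset.sum_eq_zero fun Y hY => ?_
      have : g.unop.1 X Y = 0 := by
        by_contra h'
        exact h (ht Y hY X h')
      rw [this, zero_comp]

variable {M} {N : Cᵒᵖ ⥤ ModuleCat.{u} k} [N.Additive]

def shiftApp (c : ℤ) (α : M ⟶ (A.T c).op ⋙ N) {a : OrbitCat A} (X : Fiber a) :
    M.obj (op X.1) →ₗ[k] N.obj (op (X.shift c).1) :=
  (α.app (op X.1)).hom

open Classical in
def pushdownHomMap (c : ℤ) (α : M ⟶ (A.T c).op ⋙ N) (a : OrbitCat A) :
    PushdownObj A M a →ₗ[k] PushdownObj A N a :=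
  DirectSum.toModule k (Fiber a) _ fun X =>
    DirectSum.lof k (Fiber a) (fun X => N.obj (op X.1)) (X.shift c) ∘ₗ shiftApp c α X

/-- The morphism `F_* M ⟶ F_* N` induced by a morphism from `M` to the translate
`X ↦ N (T c X)` of `N`, under the canonical identification of the push-downs of `N` and of its
translate. -/
def pushdownHom (c : ℤ) (α : M ⟶ (A.T c).op ⋙ N) :
    (pushdown M : (OrbitCat A)ᵒᵖ ⥤ ModuleCat.{u} k) ⟶ pushdown N where
  app a := ModuleCat.ofHom (pushdownHomMap c α a.unop)
  naturality {b a} f := by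
    classical
    ext1
    refine DirectSum.linearMap_ext k fun Y => LinearMap.ext fun m => ?_
    change pushdownHomMap c α a.unop (pushdownMap M f.unop
        (DirectSum.lof k (Fiber b.unop) (fun Y => M.obj (op Y.1)) Y m)) =
      pushdownMap N f.unop (pushdownHomMap c α b.unop
        (DirectSum.lof k (Fiber b.unop) (fun Y => M.obj (op Y.1)) Y m))
    have hf := f.unop.2.2.2 Y
    let s := hf.toFinset
    have hlof : ∀ (e : OrbitCat A) (X : Fiber e) (m : M.obj (op X.1)),
        pushdownHomMap c α e (DirectSum.lof k (Fiber e) (fun X => M.obj (op X.1)) X m) =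
          DirectSum.lof k (Fiber e) (fun X => N.obj (op X.1)) (X.shift c)
            (shiftApp c α X m) := fun e X m => by
      rw [pushdownHomMap, DirectSum.toModule_lof]; rfl
    have hT : ∀ X : Fiber a.unop, f.unop.1 (X.shift c) (Y.shift c) =
        (A.T c).map (f.unop.1 X Y) := fun X => f.unop.2.1 c X Y
    rw [pushdownMap_lof M f.unop Y m (s := s) (by simp [s]), map_sum, hlof]
    refine Eq.trans ?_ (pushdownMap_lof N f.unop (Y.shift c) (shiftApp c α Y m)
      (s := s.map (Fiber.shiftEquiv a.unop c).toEmbedding) ?_).symm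
    · rw [Finset.sum_map]
      refine Finset.sum_congr rfl fun X _ => ?_
      rw [hlof]
      change _ = DirectSum.lof k (Fiber a.unop) (fun X => N.obj (op X.1)) (X.shift c)
        ((N.map (f.unop.1 (X.shift c) (Y.shift c)).op).hom (shiftApp c α Y m))
      congr 1
      rw [hT]
      exact LinearMap.congr_fun (congrArg ModuleCat.Hom.hom (α.naturality (f.unop.1 X Y).op)) m
    · intro X hX
      rw [Finset.mem_map_equiv]
      simp only [s, Set.Finite.mem_toFinset, Set.mem_ofPred_eq]
      intro h
      apply hX
      obtain ⟨X, rfl⟩ := (Fiber.shiftEquiv a.unop c).surjective X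
      rw [Equiv.symm_apply_apply] at h
      exact (hT X).trans (by rw [h, Functor.map_zero]; rfl)

end Pushdown
end IntAction
end Orbit
section Combinatorics

/-- A Kupisch series of type `Ã_{n-1}`: an `n`-periodic sequence of positive integers with
`ℓ i ≤ ℓ (i - 1) + 1`. -/
structure KupischSeries (n : ℕ) where
  pos : 0 < n
  len : ℤ → ℤ
  one_le : ∀ i, 1 ≤ len i
  le_succ : ∀ i, len i ≤ len (i - 1) + 1
  periodic : ∀ i, len (i + n) = len i

/-- The constant Kupisch series `(ℓ, …, ℓ)`. -/
def KupischSeries.const (n : ℕ) (hn : 0 < n) (l : ℤ) (hl : 1 ≤ l) : KupischSeries n where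
  pos := hn
  len _ := l
  one_le _ := hl
  le_succ _ := by lia
  periodic _ := rfl

/-- The ordered sequences `x₁ < ⋯ < x_d` with `x_d - x₁ + 1 ≤ ℓ_{x_d} + d - 1`. -/
def IsOS (len : ℤ → ℤ) {d : ℕ} [NeZero d] (x : Fin d → ℤ) : Prop :=
  StrictMono x ∧ x ⊤ - x 0 + 1 ≤ len (x ⊤) + d - 1

/-- The set of ordered sequences of length `d`. -/
abbrev OS (len : ℤ → ℤ) (d : ℕ) [NeZero d] : Type := {x : Fin d → ℤ // IsOS len x}

/-- The relation `x₁ ≤ y₁ < x₂ ≤ y₂ < ⋯ < x_d ≤ y_d`. -/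
def Prec {d : ℕ} (x y : Fin d → ℤ) : Prop :=
  (∀ i, x i ≤ y i) ∧ ∀ i j : Fin d, (i : ℕ) + 1 = j → y i < x j

namespace KupischSeries
variable {n : ℕ} (ℓ : KupischSeries n) (d : ℕ)

theorem sub_len_mono {i j : ℤ} (h : i ≤ j) : i - ℓ.len i ≤ j - ℓ.len j := by
  induction j, h using Int.leInduction with
  | base => exact le_rfl
  | succ m _ ih =>
    have := ℓ.le_succ (m + 1)
    rw [add_sub_cancel_right] at this
    lia

theorem len_add_mul (i c : ℤ) : ℓ.len (i + c * n) = ℓ.len i := by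
  induction c with
  | zero => simp
  | succ m ih => rw [add_mul, one_mul, ← add_assoc, ℓ.periodic, ih]
  | pred m ih =>
    rw [← ih, ← ℓ.periodic (i + (-(m : ℤ) - 1) * n)]
    congr 1; ring

/-- `f(i) = i - ℓ_i - d + 1`. -/
def f (i : ℤ) : ℤ := i - ℓ.len i - d + 1

/-- The map on `{1, …, n}` induced by `f` (the arrows of the resolution quiver): `fbar i` is the
element of `{1, …, n}` congruent to `f i` modulo `n`. -/
def fbar (i : ℤ) : ℤ := (ℓ.f d i - 1) % n + 1

/-- The vertices on the cycles of the resolution quiver. -/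
def cycleSet : Set ℤ := {i | 1 ≤ i ∧ i ≤ n ∧ ∃ N : ℕ, 0 < N ∧ (ℓ.fbar d)^[N] i = i}

/-- The set `I = J + nℤ`, where `J` is the set of vertices on cycles of the resolution quiver. -/
def cycleLift : Set ℤ := {i | ∃ j ∈ ℓ.cycleSet d, ∃ c : ℤ, i = j + c * n}

theorem cycleSet_subset : ℓ.cycleSet d ⊆ Set.Icc 1 (n : ℤ) := fun _ hi => ⟨hi.1, hi.2.1⟩

theorem cycleSet_ncard_pos : 0 < (ℓ.cycleSet d).ncard := by
  have hn : (0 : ℤ) < n := by exact_mod_cast ℓ.pos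
  have hfin : (ℓ.cycleSet d).Finite := (Set.finite_Icc _ _).subset (ℓ.cycleSet_subset d)
  rw [Set.ncard_pos hfin]
  have hmem : ∀ i, ℓ.fbar d i ∈ Set.Icc (1 : ℤ) n := fun i => by
    have h1 := Int.emod_nonneg (ℓ.f d i - 1) hn.ne'
    have h2 := Int.emod_lt_of_pos (ℓ.f d i - 1) hn
    simp only [fbar, Set.mem_Icc]
    lia
  have hit : ∀ m : ℕ, (ℓ.fbar d)^[m + 1] 1 ∈ Set.Icc (1 : ℤ) n := fun m => by
    rw [Function.iterate_succ_apply']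
    exact hmem _
  obtain ⟨a, b, hab, h⟩ := (Set.finite_Icc (1 : ℤ) n).exists_lt_map_eq_of_forall_mem hit
  refine ⟨(ℓ.fbar d)^[a + 1] 1, (hit a).1, (hit a).2, b - a, by lia, ?_⟩
  have e : b - a + (a + 1) = b + 1 := by lia
  rw [← Function.iterate_add_apply, e, h]

/-- `ℓ'_j = |[f(ι(j)), ι(j)] ∩ I| - d` for an order isomorphism `ι : ℤ ≃ I`. -/
def newLen (ι : ℤ ≃o ℓ.cycleLift d) (j : ℤ) : ℤ :=
  (Set.Icc (ℓ.f d (ι j)) (ι j) ∩ ℓ.cycleLift d).ncard - d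

/-- The constant Kupisch series `(ℓ', …, ℓ')` of type `Ã_{n'-1}`, where `n' = |J|`. -/
def newSeries (ι : ℤ ≃o ℓ.cycleLift d) (h : 2 ≤ ℓ.newLen d ι 1) :
    KupischSeries (ℓ.cycleSet d).ncard :=
  KupischSeries.const _ (ℓ.cycleSet_ncard_pos d) (ℓ.newLen d ι 1) (le_trans one_le_two h)

end KupischSeries
end Combinatorics

section Support
variable (k : Type u) [Field k] {d : ℕ}

/-- `z` lies in the support of `M̂(x)`: `(x₁, …, x_d) ≼ z ≼ (x₂ - 1, …, x_{d+1} - 1)`. -/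
def InSupport (x : Fin (d + 1) → ℤ) (z : Fin d → ℤ) : Prop :=
  Prec (fun i => x i.castSucc) z ∧ Prec z (fun i => x i.succ - 1)

theorem inSupport_iff (x : Fin (d + 1) → ℤ) (z : Fin d → ℤ) :
    InSupport x z ↔ ∀ i : Fin d, x i.castSucc ≤ z i ∧ z i ≤ x i.succ - 1 := by
  refine ⟨fun h i => ⟨h.1.1 i, h.2.1 i⟩, fun h => ⟨⟨fun i => (h i).1, fun i j hij => ?_⟩,
    ⟨fun i => (h i).2, fun i j hij => ?_⟩⟩⟩
  all_goals
    have e : i.succ = j.castSucc := Fin.ext (by simpa using hij)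
    have h1 := (h i).2
    have h2 := (h j).1
    rw [← e] at h2
    lia

theorem InSupport.convex {x : Fin (d + 1) → ℤ} {z u w : Fin d → ℤ} (hz : InSupport x z)
    (hw : InSupport x w) (h1 : z ≤ u) (h2 : u ≤ w) : InSupport x u := by
  rw [inSupport_iff] at *
  exact fun i => ⟨(hz i).1.trans (h1 i), (h2 i).trans (hw i).2⟩

/-- The vector space `M̂(x)_z`: it is `k` if `z` lies in the support and `0` otherwise. -/
abbrev HatSpace (x : Fin (d + 1) → ℤ) (z : Fin d → ℤ) : Type u := PLift (InSupport x z) → k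

open Classical in
/-- The map `M̂(x)_w ⟶ M̂(y)_z` which is the identity of `k` if both spaces are `k`. -/
def hatMap (x : Fin (d + 1) → ℤ) (w : Fin d → ℤ) (y : Fin (d + 1) → ℤ) (z : Fin d → ℤ) :
    HatSpace k x w →ₗ[k] HatSpace k y z where
  toFun m _ := if h : InSupport x w then m ⟨h⟩ else 0
  map_add' m m' := by
    funext i
    by_cases h : InSupport x w <;> simp [h]
  map_smul' r m := by
    funext i
    by_cases h : InSupport x w <;> simp [h]

theorem hatMap_self (x : Fin (d + 1) → ℤ) (z : Fin d → ℤ) :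
    hatMap k x z x z = LinearMap.id := by
  refine LinearMap.ext fun m => funext fun i => ?_
  simp [hatMap, i.down]

theorem hatMap_comp {x y t : Fin (d + 1) → ℤ} {z u w : Fin d → ℤ}
    (h : InSupport x w → InSupport t z → InSupport y u) :
    hatMap k y u t z ∘ₗ hatMap k x w y u = hatMap k x w t z := by
  refine LinearMap.ext fun m => funext fun i => ?_
  by_cases hw : InSupport x w
  · simp [hatMap, hw, h hw i.down]
  · simp [hatMap, hw]

end Support

section Nakayama
variable (k : Type u) [Field k] {n : ℕ} (ℓ : KupischSeries n) (d : ℕ) [NeZero d]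

/-- The vertices of the quiver `Q^d_{ℓ}`: the ordered sequences for the shifted Kupisch series
`ℓ[1]_i = ℓ_{i+1}`. -/
@[ext]
structure Vertex : Type where
  coord : Fin d → ℤ
  isOS : IsOS (fun i => ℓ.len (i + 1)) coord

variable {ℓ d}

/-- There is an arrow `a_i(x) : x ⟶ x + e_i` whenever both ends are vertices. -/
instance : Quiver.{0} (Vertex ℓ d) where
  Hom x y := {i : Fin d // y.coord = x.coord + Pi.single i 1}

/-- The relations of the `d`-Nakayama category: `a_i(x + e_j) a_j(x) = a_j(x + e_i) a_i(x)`, with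
the convention that an arrow is zero if one of its ends is not a vertex. For `d = 1`, where these
relations are void, the quiver is linear, and the relations are the usual ones: a path ending
at `y` is zero if it has at least `ℓ_{y+1}` arrows. -/
inductive NakRel : ∀ x y : Vertex ℓ d, PathSpan k x y → Prop
  | comm {x y z w : Vertex ℓ d} (a : x ⟶ y) (b : y ⟶ w) (a' : x ⟶ z) (b' : z ⟶ w)
      (hab : a.1 = b'.1) (hba : b.1 = a'.1) :
      NakRel x w (Finsupp.single (a.toPath.comp b.toPath) 1 -
        Finsupp.single (a'.toPath.comp b'.toPath) 1)
  | zero {x y w : Vertex ℓ d} (a : x ⟶ y) (b : y ⟶ w)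
      (h : ¬ IsOS (fun i => ℓ.len (i + 1)) (x.coord + Pi.single b.1 1)) :
      NakRel x w (Finsupp.single (a.toPath.comp b.toPath) 1)
  | long (hd : d = 1) {x y : Vertex ℓ d} (p : Quiver.Path x y)
      (h : ℓ.len (y.coord 0 + 1) ≤ p.length) :
      NakRel x y (Finsupp.single p 1)

variable (ℓ d)

/-- The `d`-Nakayama algebra of type `A_∞^∞`, as a `k`-linear category. -/
abbrev NakCover : Type := BoundQuiver (NakRel k (ℓ := ℓ) (d := d))

variable {ℓ d}

theorem IsOS.translate {x : Fin d → ℤ} (c : ℤ) :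
    IsOS (fun i => ℓ.len (i + 1)) (x + fun _ => c * n) ↔ IsOS (fun i => ℓ.len (i + 1)) x := by
  have h : ℓ.len (x ⊤ + c * n + 1) = ℓ.len (x ⊤ + 1) := by
    rw [← ℓ.len_add_mul (x ⊤ + 1) c]; congr 1; ring
  simp only [IsOS, Pi.add_apply, h, add_sub_add_right_eq_sub]
  refine and_congr_left fun _ => ⟨fun hx i j hij => ?_, fun hx i j hij => ?_⟩
  · simpa using hx hij
  · simpa using hx hij

variable (ℓ d) in
/-- Translation of vertices by `(c n, …, c n)`. -/
def translate (c : ℤ) : Vertex ℓ d ⥤q Vertex ℓ d where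
  obj x := ⟨x.coord + fun _ => c * n, (IsOS.translate c).2 x.isOS⟩
  map a := ⟨a.1, (congrArg (· + _) a.2).trans (add_right_comm _ _ _)⟩

theorem prefunctor_ext {F G : Vertex ℓ d ⥤q Vertex ℓ d} (h : ∀ x, F.obj x = G.obj x)
    (h' : ∀ (x y : Vertex ℓ d) (a : x ⟶ y), (F.map a).1 = (G.map a).1) : F = G := by
  obtain ⟨Fo, Fm⟩ := F
  obtain ⟨Go, Gm⟩ := G
  obtain rfl : Fo = Go := funext h
  congr 1
  funext x y a
  exact Subtype.ext (h' x y a)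

theorem translate_zero : translate ℓ d 0 = 𝟭q _ :=
  prefunctor_ext (fun x => by ext i; simp [translate]) fun _ _ _ => rfl

theorem translate_add (a b : ℤ) : translate ℓ d (a + b) = translate ℓ d a ⋙q translate ℓ d b :=
  prefunctor_ext (fun x => by ext i; simp [translate]; ring) fun _ _ _ => rfl

theorem length_mapPath (φ : Vertex ℓ d ⥤q Vertex ℓ d) {x y : Vertex ℓ d} (p : Quiver.Path x y) :
    (φ.mapPath p).length = p.length := by
  induction p with
  | nil => rfl
  | cons p a ih => simp [ih]

theorem translate_rel (c : ℤ) (x y : Vertex ℓ d) (r : PathSpan k x y) (hr : NakRel k x y r) :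
    NakRel k ((translate ℓ d c).obj x) ((translate ℓ d c).obj y)
      (BoundQuiver.pathMap (translate ℓ d c) x y r) := by
  cases hr with
  | comm a b a' b' hab hba =>
    rw [map_sub, BoundQuiver.pathMap_single, BoundQuiver.pathMap_single, Prefunctor.mapPath_comp,
      Prefunctor.mapPath_comp]
    exact NakRel.comm ((translate ℓ d c).map a) ((translate ℓ d c).map b)
      ((translate ℓ d c).map a') ((translate ℓ d c).map b') hab hba
  | zero a b h =>
    rw [BoundQuiver.pathMap_single, Prefunctor.mapPath_comp]
    refine NakRel.zero ((translate ℓ d c).map a) ((translate ℓ d c).map b) fun h' => h ?_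
    rw [← IsOS.translate c, add_right_comm]
    exact h'
  | long hd p h =>
    rw [BoundQuiver.pathMap_single]
    refine NakRel.long hd _ ?_
    rw [length_mapPath]
    refine le_trans (le_of_eq ?_) h
    rw [← ℓ.len_add_mul (y.coord 0 + 1) c]
    congr 1
    simp [translate]; ring

variable (ℓ d)

/-- The action on the `d`-Nakayama category of the infinite cyclic group generated by the
translation by `(n, …, n)`. -/
def nakAction : IntAction k (NakCover k ℓ d) where
  T c := BoundQuiver.mapFunctor (translate ℓ d c) (translate_rel k c)
  additive _ := inferInstance
  linear _ := inferInstance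
  zero := by
    have h : ∀ (φ : Vertex ℓ d ⥤q Vertex ℓ d) (_ : φ = 𝟭q _)
        (h : ∀ a b (r : PathSpan k a b), NakRel k a b r →
          NakRel k (φ.obj a) (φ.obj b) (BoundQuiver.pathMap φ a b r)),
        BoundQuiver.mapFunctor φ h = 𝟭 _ := by
      rintro φ rfl h
      exact BoundQuiver.mapFunctor_id h
    exact h _ translate_zero _
  add a b := by
    have h : ∀ (φ : Vertex ℓ d ⥤q Vertex ℓ d) (_ : φ = translate ℓ d a ⋙q translate ℓ d b)
        (h : ∀ a b (r : PathSpan k a b), NakRel k a b r →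
          NakRel k (φ.obj a) (φ.obj b) (BoundQuiver.pathMap φ a b r)),
        BoundQuiver.mapFunctor φ h =
          BoundQuiver.mapFunctor (translate ℓ d a) (translate_rel k a) ⋙
            BoundQuiver.mapFunctor (translate ℓ d b) (translate_rel k b) := by
      rintro φ rfl h
      exact BoundQuiver.mapFunctor_comp _ _ _ _ h
    exact h _ (translate_add a b) _

/-- The `d`-Nakayama algebra `A_ℓ^{(d)}` of type `Ã_{n-1}`, as a `k`-linear category with finitely
many objects: the orbit category of the `d`-Nakayama category of type `A_∞^∞`. -/
abbrev Nak : Type := IntAction.OrbitCat (nakAction k ℓ d)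

theorem Vertex.coord_bounds : ∃ K : ℤ, ∀ (x : Vertex ℓ d) (i : Fin d),
    x.coord ⊤ - K ≤ x.coord i ∧ x.coord i ≤ x.coord ⊤ := by
  have hn : (0 : ℤ) < n := by exact_mod_cast ℓ.pos
  obtain ⟨L, hL⟩ := ((Set.finite_Icc (0 : ℤ) n).image ℓ.len).bddAbove
  have hL' : ∀ i, ℓ.len i ≤ L := fun i => by
    have h := ℓ.len_add_mul (i % n) (i / n)
    rw [mul_comm, Int.emod_add_mul_ediv] at h
    rw [h]
    exact hL ⟨_, ⟨Int.emod_nonneg _ hn.ne', (Int.emod_lt_of_pos _ hn).le⟩, rfl⟩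
  refine ⟨L + d, fun x i => ⟨?_, x.isOS.1.monotone le_top⟩⟩
  have h1 := x.isOS.2
  have h2 := hL' (x.coord ⊤ + 1)
  have h3 := x.isOS.1.monotone (Fin.zero_le i)
  simp only at h1
  lia

instance : Finite (Nak k ℓ d) := by
  have hn : (0 : ℤ) < n := by exact_mod_cast ℓ.pos
  obtain ⟨K, hK⟩ := Vertex.coord_bounds ℓ d
  let S : Set (Fin d → ℤ) := Set.Icc (fun _ => -K) (fun _ => (n : ℤ))
  let T := {x : Vertex ℓ d // x.coord ∈ S}
  have hT : Finite T := by
    have : Finite S := Set.finite_Icc _ _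
    refine Finite.of_injective (β := S) (fun x => ⟨x.1.coord, x.2⟩) fun x y h => ?_
    exact Subtype.ext (Vertex.ext (congrArg Subtype.val h))
  refine Finite.of_surjective (α := T) (fun x => ⟨Quotient.mk _ ⟨x.1⟩⟩) ?_
  rintro ⟨q⟩
  induction q using Quotient.inductionOn with
  | h x =>
    let c := -(x.vertex.coord ⊤ / n)
    let y := (translate ℓ d c).obj x.vertex
    have hy : y.coord ⊤ = x.vertex.coord ⊤ % n := by
      have := Int.emod_add_mul_ediv (x.vertex.coord ⊤) n
      simp only [y, c, translate, Pi.add_apply]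
      linarith
    have h1 := Int.emod_nonneg (x.vertex.coord ⊤) hn.ne'
    have h2 := (Int.emod_lt_of_pos (x.vertex.coord ⊤) hn).le
    refine ⟨⟨y, fun i => ?_, fun i => ?_⟩, ?_⟩
    · have := (hK y i).1
      simp only; lia
    · have := (hK y i).2
      simp only; lia
    · refine congrArg IntAction.OrbitCat.mk (Eq.symm ?_)
      exact Quotient.sound (s := (nakAction k ℓ d).orbitSetoid) ⟨c, rfl⟩

section Modules
open Opposite
variable {d ℓ}

theorem InSupport.isOS {x : Fin (d + 1) → ℤ} (hx : IsOS ℓ.len x) {z : Fin d → ℤ}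
    (hz : InSupport x z) : IsOS (fun i => ℓ.len (i + 1)) z := by
  rw [inSupport_iff] at hz
  obtain ⟨m, rfl⟩ := Nat.exists_eq_succ_of_ne_zero (NeZero.ne d)
  refine ⟨Fin.strictMono_iff_lt_succ.2 fun i => ?_, ?_⟩
  · have h1 := (hz i.castSucc).2
    have h2 := (hz i.succ).1
    rw [Fin.succ_castSucc] at h1
    lia
  · have h1 := (hz ⊤).2
    have h2 := (hz 0).1
    have h3 := hx.2
    have e1 : (⊤ : Fin (m + 1)).succ = ⊤ := rfl
    have e2 : (0 : Fin (m + 1)).castSucc = 0 := rfl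
    rw [e1] at h1
    rw [e2] at h2
    have h4 := ℓ.sub_len_mono (i := z ⊤ + 1) (j := x ⊤) (by lia)
    push_cast at h3 ⊢
    lia

theorem Vertex.le_of_path {x y : Vertex ℓ d} (p : Quiver.Path x y) : x.coord ≤ y.coord := by
  induction p with
  | nil => exact le_rfl
  | cons p a ih =>
    rw [a.2]
    refine ih.trans (le_add_of_nonneg_right ?_)
    exact Pi.single_nonneg.2 zero_le_one

theorem Vertex.length_of_path (hd : d = 1) {x y : Vertex ℓ d} (p : Quiver.Path x y) :
    y.coord 0 = x.coord 0 + p.length := by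
  subst hd
  induction p with
  | nil => simp
  | cons p a ih =>
    have : a.1 = 0 := Subsingleton.elim _ _
    rw [a.2, Pi.add_apply, this, ih]
    simp [add_assoc]

/-- The action of the morphisms of the `d`-Nakayama category on `M̂(x)`. -/
def hatAct {x : Fin (d + 1) → ℤ} (hx : IsOS ℓ.len x) (z w : NakCover k ℓ d) :
    (z ⟶ w) →ₗ[k] (HatSpace k x w.vertex.coord →ₗ[k] HatSpace k x z.vertex.coord) :=
  (relIdeal (NakRel k) z.vertex w.vertex).liftQ
    (Finsupp.lsum k fun _ => LinearMap.toSpanSingleton k _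
      (hatMap k x w.vertex.coord x z.vertex.coord)) (by
    refine Submodule.span_le.2 ?_
    rintro _ ⟨a, b, p, r, q, hr, rfl⟩
    have hp := Vertex.le_of_path p
    have hq := Vertex.le_of_path q
    have key : ∀ s : Quiver.Path a b,
        ¬ (InSupport x a.coord ∧ InSupport x b.coord) →
        hatMap k x w.vertex.coord x z.vertex.coord = 0 := fun s hs => by
      have hle := Vertex.le_of_path s
      refine LinearMap.ext fun m => funext fun i => ?_
      have hz := i.down
      have hw : ¬ InSupport x w.vertex.coord := fun hw =>
        hs ⟨hz.convex hw hp (hle.trans hq), hz.convex hw (hp.trans hle) hq⟩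
      simp [hatMap, hw]
    rw [SetLike.mem_coe, LinearMap.mem_ker]
    cases hr with
    | comm c e c' e' h h' =>
      simp [pathComp_single, map_sub, LinearMap.sub_apply]
    | zero c e h =>
      have h0 := key (c.toPath.comp e.toPath) (by
        rintro ⟨ha, hb⟩
        refine h (InSupport.isOS hx (ha.convex hb ?_ ?_))
        · exact le_add_of_nonneg_right (Pi.single_nonneg.2 zero_le_one)
        · have hb' : b.coord = a.coord + Pi.single e.1 1 + Pi.single c.1 1 :=
            (e.2.trans (congrArg (· + _) c.2)).trans (add_right_comm _ _ _)
          refine le_of_le_of_eq ?_ hb'.symm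
          exact le_add_of_nonneg_right (Pi.single_nonneg.2 zero_le_one))
      simp [pathComp_single, h0]
    | long hd s h =>
      have h0 := key s (by
        rintro ⟨ha, hb⟩
        have hl := Vertex.length_of_path hd s
        subst hd
        have h1 := ((inSupport_iff _ _).1 hb 0).2

        have h2 := ((inSupport_iff _ _).1 ha 0).1
        have h3 := hx.2
        have e1 : (0 : Fin 1).succ = ⊤ := rfl
        have e2 : (0 : Fin 1).castSucc = 0 := rfl
        rw [e1] at h1
        rw [e2] at h2
        have h4 := ℓ.sub_len_mono (i := b.coord 0 + 1) (j := x ⊤) (by lia)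
        push_cast at h3
        lia)
      simp [pathComp_single, h0])

theorem hatAct_single {x : Fin (d + 1) → ℤ} (hx : IsOS ℓ.len x) (z w : NakCover k ℓ d)
    (p : Quiver.Path z.vertex w.vertex) (r : k) :
    hatAct k hx z w (BoundQuiver.ofPaths z w (Finsupp.single p r)) =
      r • hatMap k x w.vertex.coord x z.vertex.coord := by
  change Finsupp.lsum k _ (Finsupp.single p r) = _
  simp

theorem hatAct_comp {x : Fin (d + 1) → ℤ} (hx : IsOS ℓ.len x) {z u w : NakCover k ℓ d}
    (f : z ⟶ u) (g : u ⟶ w) : hatAct k hx z w (f ≫ g) = hatAct k hx z u f ∘ₗ hatAct k hx u w g := by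
  obtain ⟨f, rfl⟩ := BoundQuiver.ofPaths_surjective z u f
  obtain ⟨g, rfl⟩ := BoundQuiver.ofPaths_surjective u w g
  induction f using Finsupp.induction_linear with
  | zero => simp only [map_zero, Limits.zero_comp, LinearMap.zero_comp]
  | add f₁ f₂ h₁ h₂ => simp only [map_add, Preadditive.add_comp, h₁, h₂, LinearMap.add_comp]
  | single p r =>
    induction g using Finsupp.induction_linear with
    | zero => simp only [map_zero, Limits.comp_zero, LinearMap.comp_zero]
    | add f₁ f₂ h₁ h₂ => simp only [map_add, Preadditive.comp_add, h₁, h₂, LinearMap.comp_add]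
    | single q s =>
      rw [BoundQuiver.ofPaths_comp, pathComp_single, hatAct_single, hatAct_single, hatAct_single,
        LinearMap.smul_comp, LinearMap.comp_smul, hatMap_comp k, mul_smul]
      exact fun hw hz => hz.convex hw (Vertex.le_of_path p) (Vertex.le_of_path q)

/-- The module `M̂(x)` over the `d`-Nakayama category of type `A_∞^∞`. (Right modules are
contravariant functors.) -/
def hatModule (x : OS ℓ.len (d + 1)) : (NakCover k ℓ d)ᵒᵖ ⥤ ModuleCat.{u} k where
  obj z := ModuleCat.of k (HatSpace k x.1 z.unop.vertex.coord)
  map f := ModuleCat.ofHom (hatAct k x.2 _ _ f.unop)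
  map_id z := by
    ext1
    refine (hatAct_single k x.2 z.unop z.unop Quiver.Path.nil 1).trans ?_
    rw [one_smul, hatMap_self]
    rfl
  map_comp f g := by
    ext1
    exact hatAct_comp k x.2 g.unop f.unop

instance (x : OS ℓ.len (d + 1)) : (hatModule k x).Additive where
  map_add {z w} f g := by
    ext1
    exact map_add (hatAct k x.2 _ _) f.unop g.unop

end Modules

section Homs
open Opposite
variable {d ℓ}

/-- The morphism `M̂(x) ⟶ M̂(σ^c(y))`, for `x ≼ σ^c(y)`, given by the identity of `k` wherever both
modules are `k`. Here `σ` is the translation by `(-n, …, -n)`, so that `M̂(σ^c(y))` is the translate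
`z ↦ M̂(y)_{z + c n}` of `M̂(y)`. -/
def hatHom (x y : OS ℓ.len (d + 1)) (c : ℤ) (h : Prec x.1 (fun i => y.1 i - c * n)) :
    hatModule k x ⟶ ((nakAction k ℓ d).T c).op ⋙ hatModule k y where
  app z := ModuleCat.ofHom (hatMap k x.1 z.unop.vertex.coord y.1
    (z.unop.vertex.coord + fun _ => c * n))
  naturality {w z} f := by
    obtain ⟨f, rfl⟩ : ∃ g : z.unop ⟶ w.unop, f = g.op := ⟨f.unop, rfl⟩
    ext1
    change hatMap k x.1 _ y.1 _ ∘ₗ hatAct k x.2 z.unop w.unop f =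
      hatAct k y.2 ⟨(translate ℓ d c).obj z.unop.vertex⟩ ⟨(translate ℓ d c).obj w.unop.vertex⟩
        (((nakAction k ℓ d).T c).map f) ∘ₗ hatMap k x.1 _ y.1 _
    obtain ⟨f, rfl⟩ := BoundQuiver.ofPaths_surjective _ _ f
    induction f using Finsupp.induction_linear with
    | zero => simp only [map_zero, Functor.map_zero, LinearMap.comp_zero]; rfl
    | add f₁ f₂ h₁ h₂ =>
      rw [map_add, map_add, Functor.map_add, LinearMap.comp_add, h₁, h₂]
      exact (LinearMap.add_comp _ _ _).symm.trans (congrArg (· ∘ₗ _) (map_add _ _ _).symm)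
    | single p r =>
      have hle := Vertex.le_of_path p
      have hT : ((nakAction k ℓ d).T c).map
          (BoundQuiver.ofPaths z.unop w.unop (Finsupp.single p r)) =
          BoundQuiver.ofPaths ⟨(translate ℓ d c).obj z.unop.vertex⟩
            ⟨(translate ℓ d c).obj w.unop.vertex⟩
            (Finsupp.single ((translate ℓ d c).mapPath p) r) :=
        congrArg _ (BoundQuiver.pathMap_single _ p r)
      rw [hT, hatAct_single, hatAct_single, LinearMap.comp_smul, LinearMap.smul_comp,
        hatMap_comp k, hatMap_comp k]
      · intro hw hz
        rw [inSupport_iff] at hw hz ⊢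
        intro i
        have h1 := hw i
        have h2 := hz i
        have h3 := hle i
        have h4 := h.1 i.succ
        simp only [translate, Pi.add_apply] at h2 ⊢
        lia
      · intro hw hz
        rw [inSupport_iff] at hw hz ⊢
        intro i
        have h1 := hw i
        have h2 := hz i
        have h3 := hle i
        have h4 := h.1 i.castSucc
        simp only [translate, Pi.add_apply] at h2 ⊢
        lia

/-- The module `M(x) = F_* M̂(x)` over the `d`-Nakayama algebra `A_ℓ^{(d)}`. -/
def indecModule (x : OS ℓ.len (d + 1)) : (Nak k ℓ d)ᵒᵖ ⥤ ModuleCat.{u} k :=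
  IntAction.pushdown (A := nakAction k ℓ d) (hatModule k x)

open Classical in
/-- The morphism `f^c_{yx} : M(x) ⟶ M(y)`, the image of `M̂(x) ⟶ M̂(σ^c(y))` (zero unless
`x ≼ σ^c(y)`). -/
def indecHom (x y : OS ℓ.len (d + 1)) (c : ℤ) : indecModule k x ⟶ indecModule k y :=
  if h : Prec x.1 (fun i => y.1 i - c * n) then IntAction.pushdownHom c (hatHom k x y c h) else 0

end Homs

end Nakayama

section Algebra

/-- The algebra `⨁_{a, b} Hom(a, b)` of a `k`-linear category with finitely many objects. -/
def CatAlgebra (C : Type) [Category.{u} C] : Type u := ∀ a b : C, a ⟶ b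

namespace CatAlgebra
variable {k : Type u} [Field k] {C : Type} [Category.{u} C] [Preadditive C] [Linear k C]

@[ext]
theorem ext {C : Type} [Category.{u} C] {f g : CatAlgebra C} (h : ∀ a b, f a b = g a b) : f = g :=
  funext fun a => funext fun b => h a b

instance : AddCommGroup (CatAlgebra C) := inferInstanceAs (AddCommGroup (∀ a b : C, a ⟶ b))

instance : Module k (CatAlgebra C) := inferInstanceAs (Module k (∀ a b : C, a ⟶ b))

theorem add_apply (f g : CatAlgebra C) (a b : C) : (f + g) a b = f a b + g a b := rfl

theorem zero_apply (a b : C) : (0 : CatAlgebra C) a b = 0 := rfl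

theorem smul_apply (r : k) (f : CatAlgebra C) (a b : C) : (r • f) a b = r • f a b := rfl

open Classical in
instance : One (CatAlgebra C) := ⟨fun a b => if h : a = b then eqToHom h else 0⟩

theorem one_self (a : C) : (1 : CatAlgebra C) a a = 𝟙 a := dif_pos rfl

theorem one_of_ne {a b : C} (h : a ≠ b) : (1 : CatAlgebra C) a b = 0 := dif_neg h

variable [Fintype C]

/-- The product `f * g` is composition, `g` being applied first; thus right modules over the
algebra are contravariant functors on the category. -/
instance : Mul (CatAlgebra C) := ⟨fun f g a b => ∑ c, g a c ≫ f c b⟩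

theorem mul_apply (f g : CatAlgebra C) (a b : C) : (f * g) a b = ∑ c, g a c ≫ f c b := rfl

instance : Ring (CatAlgebra C) where
  __ := (inferInstance : AddCommGroup (CatAlgebra C))
  __ := (inferInstance : One (CatAlgebra C))
  __ := (inferInstance : Mul (CatAlgebra C))
  left_distrib f g h := by
    ext a b
    simp only [mul_apply, add_apply, Preadditive.add_comp, Finset.sum_add_distrib]
  right_distrib f g h := by
    ext a b
    simp only [mul_apply, add_apply, Preadditive.comp_add, Finset.sum_add_distrib]
  zero_mul f := by
    ext a b
    simp only [mul_apply, zero_apply, comp_zero, Finset.sum_const_zero]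
  mul_zero f := by
    ext a b
    simp only [mul_apply, zero_apply, zero_comp, Finset.sum_const_zero]
  mul_assoc f g h := by
    ext a b
    simp only [mul_apply, Preadditive.comp_sum, Preadditive.sum_comp, Category.assoc]
    exact Finset.sum_comm
  one_mul f := by
    ext a b
    rw [mul_apply, Finset.sum_eq_single b]
    · rw [one_self, Category.comp_id]
    · intro c _ h
      rw [one_of_ne h, comp_zero]
    · simp
  mul_one f := by
    ext a b
    rw [mul_apply, Finset.sum_eq_single a]
    · rw [one_self, Category.id_comp]
    · intro c _ h
      rw [one_of_ne h.symm, zero_comp]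
    · simp

instance : Algebra k (CatAlgebra C) :=
  Algebra.ofModule
    (fun r f g => by
      ext a b
      simp only [mul_apply, smul_apply, Linear.comp_smul, Finset.smul_sum])
    (fun r f g => by
      ext a b
      simp only [mul_apply, smul_apply, Linear.smul_comp, Finset.smul_sum])

end CatAlgebra

/-- A ring is (right) self-injective if it is injective as a right module over itself. -/
def IsSelfInjective (R : Type u) [Ring R] : Prop := Module.Injective Rᵐᵒᵖ R

end Algebra

section AddClosure
variable {D : Type*} [Category D] [Preadditive D] [HasFiniteBiproducts D]

/-- `add S`: the direct summands of finite direct sums of objects in `S`. -/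
def addClosure (S : Set D) : ObjectProperty D := fun X =>
  ∃ (m : ℕ) (F : Fin m → D), (∀ i, F i ∈ S) ∧ Nonempty (Retract X (⨁ F))

theorem mem_addClosure {S : Set D} {X : D} (hX : X ∈ S) : addClosure S X :=
  ⟨1, fun _ => X, fun _ => hX, ⟨{
    i := biproduct.ι (fun _ : Fin 1 => X) 0
    r := biproduct.π (fun _ : Fin 1 => X) 0
    retract := by simp }⟩⟩

/-- `P` is a basic additive generator of the class `Q` of objects: `Q = add P`, and `P` is a finite
direct sum of pairwise non-isomorphic indecomposable objects. -/
def IsBasicAdditiveGenerator [HasBinaryBiproducts D] (Q : ObjectProperty D) (P : D) : Prop :=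
  Q = addClosure {P} ∧
    ∃ (m : ℕ) (F : Fin m → D), (∀ i, Indecomposable (F i)) ∧
      (∀ i j, Nonempty (F i ≅ F j) → i = j) ∧ Nonempty (P ≅ ⨁ F)

end AddClosure

section Subcategories
variable (k : Type u) [Field k] {n : ℕ} (ℓ : KupischSeries n) (d : ℕ) [NeZero d]

instance (C : Type) [Category.{u} C] : HasFiniteBiproducts (Cᵒᵖ ⥤ ModuleCat.{u} k) :=
  HasFiniteBiproducts.of_hasFiniteProducts

instance : Fintype (Nak k ℓ d) := Fintype.ofFinite _

/-- The `d`-Nakayama algebra `A_ℓ^{(d)}`, as an algebra. -/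
abbrev NakAlgebra : Type u := CatAlgebra (Nak k ℓ d)

/-- The distinguished `dℤ`-cluster tilting subcategory `add {M(x)}`. -/
def clusterTilting : ObjectProperty ((Nak k ℓ d)ᵒᵖ ⥤ ModuleCat.{u} k) :=
  addClosure (Set.range fun x : OS ℓ.len (d + 1) => indecModule k x)

/-- The projective objects of `clusterTilting`: the additive closure of the `M(x)` with
`x_{d+1} - x₁ + 1 = ℓ_{x_{d+1}} + d`. -/
def projectives : ObjectProperty ((Nak k ℓ d)ᵒᵖ ⥤ ModuleCat.{u} k) :=
  addClosure {X | ∃ x : OS ℓ.len (d + 1),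
    x.1 ⊤ - x.1 0 + 1 = ℓ.len (x.1 ⊤) + d ∧ X = indecModule k x}

/-- The ordered sequences with all coordinates in `I`. -/
abbrev OSI : Type := {x : OS ℓ.len (d + 1) // ∀ i, x.1 i ∈ ℓ.cycleLift d}

/-- The subcategory `𝒲 = add {M(x)}`, `x` running over the sequences with coordinates in `I`. -/
def wide : ObjectProperty ((Nak k ℓ d)ᵒᵖ ⥤ ModuleCat.{u} k) :=
  addClosure (Set.range fun x : OSI ℓ d => indecModule k x.1)

variable {ℓ d}

/-- `M(x)` as an object of the distinguished cluster tilting subcategory. -/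
def clusterTiltingObj (x : OS ℓ.len (d + 1)) : (clusterTilting k ℓ d).FullSubcategory :=
  ⟨indecModule k x, mem_addClosure ⟨x, rfl⟩⟩

/-- `M(x)` as an object of `𝒲`. -/
def wideObj (x : OSI ℓ d) : (wide k ℓ d).FullSubcategory :=
  ⟨indecModule k x.1, mem_addClosure ⟨x, rfl⟩⟩

/-- `f^c_{yx}` as a morphism of the distinguished cluster tilting subcategory. -/
def clusterTiltingHom (x y : OS ℓ.len (d + 1)) (c : ℤ) :
    clusterTiltingObj k x ⟶ clusterTiltingObj k y :=
  ObjectProperty.homMk (indecHom k x y c)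

/-- `f^c_{yx}` as a morphism of `𝒲`. -/
def wideHom (x y : OSI ℓ d) (c : ℤ) : wideObj k x ⟶ wideObj k y :=
  ObjectProperty.homMk (indecHom k x.1 y.1 c)

end Subcategories
end HigherNakayama
end

open CategoryTheory HigherNakayama

noncomputable section
namespace HigherNakayama
universe u
set_option linter.unusedSectionVars false

/-! ### Paths in the `d`-Nakayama category modulo the relations -/

section Paths
variable {k : Type u} [Field k] {n : ℕ} {ℓ : KupischSeries n} {d : ℕ} [NeZero d]

namespace KupischSeries

/-! Everything is governed by the function `f`. It is monotone, commutes with translation by `n`,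
and a strictly increasing `x` is an ordered sequence exactly if `f(x_{d+1}) ≤ x₁`, with equality
exactly for the projective `M(x)`. On `I` it is a bijection: points with the same image have a
common iterate, hence differ by a multiple of `n`, hence agree, while periodicity supplies
preimages. Read through `ι`, it is therefore an order automorphism of `ℤ`, that is, a translation,
and the amount makes it the function `f` of the constant series with value `ℓ'` (`f_coe`). Likewise
translation by `n` on `I` becomes translation by `n'` (`coe_add_mul`). So `ι` respects ordered
sequences, all relations `x ≼ σ^c(y)`, and projectivity.

It remains to see that the module categories depend on these data only. In the covering category the
space of morphisms `X ⟶ Y` is spanned by any path, and it is non-zero exactly if `X` lies in a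
certain interval below `Y` (`pathHom_eq_of_fullBox`, `pathHom_eq_zero`, `homCoeff_basisHom`). As
`M(x)` is generated by one element at the largest vertex of its support, the `f^c_{yx}` with `x ≼
σ^c(y)` form a basis of the morphisms `M(x) ⟶ M(y)`, and the degrees `c` add under composition
(`eq_sum_indecHom`, `indecHom_comp`). Thus the `M(x)` and the `M(ι(x))` have the same structure
constants, and since idempotents split this extends to the additive closures
(`HomTransport.exists_equivalence`).

For (b), replacing `x₁` by `f(x_{d+1})` gives the projective cover of `M(x)` and does not leave `I`,
so `𝒫_I` is generated by the projective `M(x)` with `x` over `I` (`wide_inf_projectives`).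
Endomorphism rings of the `M(x)` have trivial idempotents only, so by Krull-Schmidt the basic
generator is unique up to isomorphism. It corresponds to the sum of all representable `A'`-modules,
which has endomorphism algebra `A'`; it is also a sum of pairwise different representable
`A`-modules, which gives the idempotent subalgebra of `A`. Finally `f` is injective for a constant
series, so different representable `A'`-modules have different socles, and the sum of the socle
coefficients is a non-degenerate linear form on `A'` (`socleForm_nondegenerate`), which forces
self-injectivity. -/

theorem f_mono (ℓ : KupischSeries n) (d : ℕ) : Monotone (ℓ.f d) := fun i j h => by
  have := ℓ.sub_len_mono h
  simp only [f]
  lia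

theorem f_add_mul (ℓ : KupischSeries n) (d : ℕ) (i c : ℤ) :
    ℓ.f d (i + c * n) = ℓ.f d i + c * n := by
  simp only [f, len_add_mul]
  ring

end KupischSeries

theorem isOS_iff_f (x : Fin (d + 1) → ℤ) :
    IsOS ℓ.len x ↔ StrictMono x ∧ ℓ.f d (x ⊤) ≤ x 0 := by
  refine and_congr_right fun _ => ?_
  simp only [KupischSeries.f]
  push_cast
  constructor <;> intro h <;> lia

theorem isOS_shift_iff_f (z : Fin d → ℤ) :
    IsOS (fun i => ℓ.len (i + 1)) z ↔ StrictMono z ∧ ℓ.f d (z ⊤ + 1) ≤ z 0 := by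
  refine and_congr_right fun _ => ?_
  simp only [KupischSeries.f]
  constructor <;> intro h <;> lia

variable (ℓ) in
/-- The sequence `(f(z_d + 1), z₁ + 1, …, z_d + 1)`: the index of the projective module `Hom(-, z)`. -/
def projSeq (z : Fin d → ℤ) : Fin (d + 1) → ℤ :=
  Fin.cons (ℓ.f d (z ⊤ + 1)) fun i => z i + 1

@[simp]
theorem projSeq_succ (z : Fin d → ℤ) (i : Fin d) : projSeq ℓ z i.succ = z i + 1 := by
  simp [projSeq]

@[simp]
theorem projSeq_zero (z : Fin d → ℤ) : projSeq ℓ z 0 = ℓ.f d (z ⊤ + 1) := by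
  simp [projSeq]

theorem top_eq_succ_top : (⊤ : Fin (d + 1)) = (⊤ : Fin d).succ := by
  obtain ⟨m, rfl⟩ := Nat.exists_eq_succ_of_ne_zero (NeZero.ne d)
  rfl

theorem zero_eq_castSucc_zero : (0 : Fin (d + 1)) = (0 : Fin d).castSucc := by
  obtain ⟨m, rfl⟩ := Nat.exists_eq_succ_of_ne_zero (NeZero.ne d)
  rfl

@[simp]
theorem projSeq_top (z : Fin d → ℤ) : projSeq ℓ z ⊤ = z ⊤ + 1 := by
  rw [top_eq_succ_top, projSeq_succ]

theorem projSeq_isOS {z : Fin d → ℤ} (hz : IsOS (fun i => ℓ.len (i + 1)) z) :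
    IsOS ℓ.len (projSeq ℓ z) := by
  rw [isOS_shift_iff_f] at hz
  rw [isOS_iff_f]
  refine ⟨?_, by simp⟩
  obtain ⟨m, rfl⟩ := Nat.exists_eq_succ_of_ne_zero (NeZero.ne d)
  refine Fin.strictMono_iff_lt_succ.2 fun i => ?_
  rw [projSeq_succ]
  induction i using Fin.cases with
  | zero =>
    rw [Fin.castSucc_zero, projSeq_zero]
    exact Int.lt_add_one_of_le hz.2
  | succ i =>
    rw [← Fin.succ_castSucc, projSeq_succ]
    have := hz.1 (Fin.castSucc_lt_succ (i := i))
    lia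

theorem inSupport_projSeq_self {z : Fin d → ℤ} (hz : IsOS (fun i => ℓ.len (i + 1)) z) :
    InSupport (projSeq ℓ z) z := by
  rw [inSupport_iff]
  intro i
  have h := (projSeq_isOS hz).1 (Fin.castSucc_lt_succ (i := i))
  rw [projSeq_succ] at h ⊢
  constructor <;> lia

/-- The lower bound of the support of `Hom(-, z)` in each coordinate depends on one coordinate of
`z` only, which is a different one if `2 ≤ d`. -/
theorem exists_prev (m : Fin d) : ∃ m' : Fin d, (2 ≤ d → m' ≠ m) ∧
    ∀ z z' : Fin d → ℤ, z m' = z' m' →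
      projSeq ℓ z m.castSucc = projSeq ℓ z' m.castSucc := by
  obtain ⟨e, rfl⟩ := Nat.exists_eq_succ_of_ne_zero (NeZero.ne d)
  induction m using Fin.cases with
  | zero =>
    -- `m'` is the cyclic predecessor of `m`: the first bound is `f(z_d + 1)`.
    refine ⟨⊤, fun h => ?_, fun z z' h => ?_⟩
    · intro h'
      have := congrArg Fin.val h'
      simp [Fin.top_eq_last] at this
      lia
    · rw [Fin.castSucc_zero, projSeq_zero, projSeq_zero, h]
  | succ m =>
    refine ⟨m.castSucc, fun h => (Fin.castSucc_lt_succ).ne, fun z z' h => ?_⟩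
    rw [← Fin.succ_castSucc, projSeq_succ, projSeq_succ, h]

namespace Vertex

instance (x y : Vertex ℓ d) : Subsingleton (x ⟶ y) where
  allEq a b := by
    refine Subtype.ext ?_
    by_contra h
    have := congrFun (a.2.symm.trans b.2) a.1
    simp [Pi.single_eq_of_ne h] at this

/-- Each arrow raises the coordinate sum by one, so the ends of a path fix its length. -/
theorem sum_of_path {x y : Vertex ℓ d} (p : Quiver.Path x y) :
    ∑ i, y.coord i = ∑ i, x.coord i + p.length := by
  induction p with
  | nil => simp
  | cons p a ih =>
    rw [a.2]
    simp [Finset.sum_add_distrib, ih]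
    ring

variable (x y : Vertex ℓ d)

/-- All integral points of the box between `x` and `y` are vertices. -/
def FullBox (x y : Vertex ℓ d) : Prop :=
  ∀ t, x.coord ≤ t → t ≤ y.coord → IsOS (fun i => ℓ.len (i + 1)) t

variable {x y}

/-- Induction on the difference of the coordinate sums: an arrow into `y` can be split off in any
direction where `x` lies strictly below `y`, and its source stays in the box. -/
theorem nonempty_path (hxy : x.coord ≤ y.coord) (h : FullBox x y) :
    Nonempty (Quiver.Path x y) := by
  obtain ⟨N, hN⟩ : ∃ N : ℕ, ∑ i, y.coord i = ∑ i, x.coord i + N := by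
    obtain ⟨N, hN⟩ := Int.eq_ofNat_of_zero_le
      (sub_nonneg.2 (Finset.sum_le_sum fun i (_ : i ∈ Finset.univ) => hxy i))
    exact ⟨N, by rw [← hN]; ring⟩
  induction N generalizing y with
  | zero =>
    have : x.coord = y.coord := funext fun i =>
      ((Finset.sum_eq_sum_iff_of_le fun i _ => hxy i).1 (by simpa using hN.symm)) i
        (Finset.mem_univ i)
    obtain rfl : x = y := Vertex.ext this
    exact ⟨.nil⟩
  | succ N ih =>
    obtain ⟨i, hi⟩ : ∃ i, x.coord i < y.coord i := by
      by_contra! h'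
      have : x.coord = y.coord := le_antisymm hxy h'
      rw [this] at hN
      push_cast at hN
      lia
    have hle : y.coord - Pi.single i 1 ≤ y.coord :=
      sub_le_self _ (Pi.single_nonneg.2 zero_le_one)
    have hx : x.coord ≤ y.coord - Pi.single i 1 := by
      intro j
      by_cases hj : j = i
      · subst hj; simp; lia
      · simpa [hj] using hxy j
    obtain ⟨p⟩ := ih (y := ⟨y.coord - Pi.single i 1, h _ hx hle⟩) hx
      (fun t h1 h2 => h t h1 (h2.trans hle)) (by
        simp [Finset.sum_sub_distrib, hN]
        ring)
    exact ⟨p.cons ⟨i, (sub_add_cancel _ _).symm⟩⟩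

end Vertex

namespace BoundQuiver
variable {V : Type} [Quiver.{0} V] {R : ∀ a b : V, PathSpan k a b → Prop}

variable (R) in
/-- The morphism represented by a path. -/
def ofPath {a b : V} (p : Quiver.Path a b) : (⟨a⟩ : BoundQuiver R) ⟶ ⟨b⟩ :=
  ofPaths ⟨a⟩ ⟨b⟩ (Finsupp.single p 1)

theorem ofPath_comp {a b c : V} (p : Quiver.Path a b) (q : Quiver.Path b c) :
    ofPath R (p.comp q) = ofPath R p ≫ ofPath R q := by
  rw [ofPath, ofPath, ofPath, ofPaths_comp, pathComp_single, one_mul]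

theorem ofPaths_eq_zero {a b : V} {r : PathSpan k a b} (hr : R a b r) :
    ofPaths (R := R) ⟨a⟩ ⟨b⟩ r = 0 := by
  refine (Submodule.Quotient.mk_eq_zero _).2 (Submodule.subset_span ⟨a, b, .nil, r, .nil, hr, ?_⟩)
  rw [pathComp_nil_right, pathComp_nil_left]

end BoundQuiver

open BoundQuiver Vertex

variable (k) in
/-- The morphism of the `d`-Nakayama category represented by a path. -/
def pathHom {x y : Vertex ℓ d} (p : Quiver.Path x y) :
    (⟨x⟩ : NakCover k ℓ d) ⟶ ⟨y⟩ := ofPath (NakRel k) p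

theorem pathHom_comp {x y z : Vertex ℓ d} (p : Quiver.Path x y) (q : Quiver.Path y z) :
    pathHom k (p.comp q) = pathHom k p ≫ pathHom k q := ofPath_comp p q

theorem pathHom_cons {x y z : Vertex ℓ d} (p : Quiver.Path x y) (e : y ⟶ z) :
    pathHom k (p.cons e) = pathHom k p ≫ pathHom k e.toPath := ofPath_comp p e.toPath

theorem pathHom_comm {x y z w : Vertex ℓ d} (a : x ⟶ y) (b : y ⟶ w) (a' : x ⟶ z) (b' : z ⟶ w)
    (hab : a.1 = b'.1) (hba : b.1 = a'.1) :
    pathHom k a.toPath ≫ pathHom k b.toPath = pathHom k a'.toPath ≫ pathHom k b'.toPath := by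
  rw [← pathHom_comp, ← pathHom_comp, ← sub_eq_zero, pathHom, pathHom, ofPath, ofPath, ← map_sub]
  exact ofPaths_eq_zero (NakRel.comm a b a' b' hab hba)

theorem pathHom_zero {x y w : Vertex ℓ d} (a : x ⟶ y) (b : y ⟶ w)
    (h : ¬ IsOS (fun i => ℓ.len (i + 1)) (x.coord + Pi.single b.1 1)) :
    pathHom k a.toPath ≫ pathHom k b.toPath = 0 := by
  rw [← pathHom_comp]
  exact ofPaths_eq_zero (NakRel.zero a b h)

/-- A diamond argument, by induction on the length. If the last arrows differ, both paths may be
rerouted through the vertex one step below both of their sources, which the full box supplies; a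
commutativity relation then exchanges the last two arrows. -/
theorem pathHom_eq_of_fullBox {x y : Vertex ℓ d} (h : FullBox x y) (p q : Quiver.Path x y) :
    pathHom k p = pathHom k q := by
  obtain ⟨N, hN⟩ : ∃ N, p.length = N := ⟨_, rfl⟩
  induction N generalizing y with
  | zero =>
    obtain rfl := Quiver.Path.eq_of_length_zero p hN
    have hq : q.length = 0 := by
      have := sum_of_path q
      lia
    rw [Quiver.Path.eq_nil_of_length_zero p hN, Quiver.Path.eq_nil_of_length_zero q hq]
  | succ N ih =>
    cases p with
    | nil => simp at hN
    | @cons b _ p a =>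
      cases q with
      | nil =>
        have := sum_of_path (p.cons a)
        simp at this
        lia
      | @cons b' _ q a' =>
        have hb : b.coord ≤ y.coord := le_of_path a.toPath
        have hb' : b'.coord ≤ y.coord := le_of_path a'.toPath
        have hpb := le_of_path p
        have hqb := le_of_path q
        have hlen : q.length = p.length := by
          have h1 := sum_of_path (p.cons a)
          have h2 := sum_of_path (q.cons a')
          simp at h1 h2
          lia
        simp at hN
        have hB : FullBox x b := fun t h1 h2 => h t h1 (h2.trans hb)
        have hB' : FullBox x b' := fun t h1 h2 => h t h1 (h2.trans hb')
        rw [pathHom_cons, pathHom_cons]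
        by_cases hij : a.1 = a'.1
        · have hbb : b = b' := Vertex.ext (by
            have := a.2.symm.trans a'.2
            rw [hij] at this
            exact add_right_cancel this)
          subst hbb
          rw [ih hB p q hN, Subsingleton.elim a a']
        · have e : ∀ t, y.coord t = b.coord t + Pi.single (M := fun _ => ℤ) a.1 1 t :=
            fun t => congrFun a.2 t
          have e' : ∀ t, y.coord t = b'.coord t + Pi.single (M := fun _ => ℤ) a'.1 1 t :=
            fun t => congrFun a'.2 t
          -- `w` is `y` lowered by one in both directions. It lies above `x` since in each
          -- coordinate it agrees with `b` or with `b'`.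
          let w : Fin d → ℤ := b.coord - Pi.single a'.1 1
          have hw : b.coord = w + Pi.single a'.1 1 := (sub_add_cancel _ _).symm
          have hw' : b'.coord = w + Pi.single a.1 1 := by
            funext t
            have h1 := e t
            have h2 := e' t
            simp only [w, Pi.add_apply, Pi.sub_apply]
            lia
          have hxw : x.coord ≤ w := by
            intro t
            have h1 := hpb t
            have h2 := hqb t
            have h3 := congrFun hw t
            have h4 := congrFun hw' t
            simp only [Pi.add_apply] at h3 h4
            by_cases ht : t = a.1
            · subst ht
              rw [Pi.single_eq_of_ne hij] at h3
              lia
            · rw [Pi.single_eq_of_ne ht] at h4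
              lia
          have hwb : w ≤ b.coord := by
            rw [hw]; exact le_add_of_nonneg_right (Pi.single_nonneg.2 zero_le_one)
          let W : Vertex ℓ d := ⟨w, h w hxw (hwb.trans hb)⟩
          obtain ⟨s⟩ := nonempty_path (x := x) (y := W) hxw fun t h1 h2 => hB t h1 (h2.trans hwb)
          rw [ih hB p (s.cons (⟨a'.1, hw⟩ : W ⟶ b)) hN,
            ih hB' q (s.cons (⟨a.1, hw'⟩ : W ⟶ b')) (hlen.trans hN), pathHom_cons, pathHom_cons,
            Category.assoc, Category.assoc, pathHom_comm (k := k) (⟨a'.1, hw⟩ : W ⟶ b) a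
              (⟨a.1, hw'⟩ : W ⟶ b') a' rfl rfl]

theorem FullBox.of_inSupport {x : Fin (d + 1) → ℤ} (hx : IsOS ℓ.len x) {z w : Vertex ℓ d}
    (hz : InSupport x z.coord) (hw : InSupport x w.coord) : FullBox z w :=
  fun _ h1 h2 => InSupport.isOS hx (hz.convex hw h1 h2)

theorem FullBox.of_projSeq {z w : Vertex ℓ d} (h : InSupport (projSeq ℓ w.coord) z.coord) :
    FullBox z w :=
  FullBox.of_inSupport (projSeq_isOS w.isOS) h (inSupport_projSeq_self w.isOS)

theorem InSupport.le_of_projSeq {z w : Fin d → ℤ} (h : InSupport (projSeq ℓ w) z) : z ≤ w := by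
  intro i
  have := ((inSupport_iff _ _).1 h i).2
  rw [projSeq_succ] at this
  lia

/-- For `d = 1` this is the relation on long paths. For `2 ≤ d`, induct on the length. In the
critical case, removing the first arrow and removing the last arrow both put the source back into
the support. These arrows then have different directions; a step in the direction of the first can
be moved next to the last, and the pair is either a zero relation or can be exchanged, which exposes
a shorter vanishing path. -/
theorem pathHom_eq_zero {w z : Vertex ℓ d} (p : Quiver.Path w z)
    (h : ¬ InSupport (projSeq ℓ z.coord) w.coord) : pathHom k p = 0 := by
  have key : ∀ {w z : Vertex ℓ d}, w.coord ≤ z.coord →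
      ¬ InSupport (projSeq ℓ z.coord) w.coord →
      ∃ m : Fin d, w.coord m < projSeq ℓ z.coord m.castSucc := by
    intro w z hwz h
    by_contra! h'
    refine h ((inSupport_iff _ _).2 fun i => ⟨h' i, ?_⟩)
    rw [projSeq_succ]
    have := hwz i
    lia
  rcases Nat.lt_or_ge 1 d with hd | hd
  swap
  · have hd1 : d = 1 := le_antisymm hd (NeZero.one_le)
    obtain ⟨m, hm⟩ := key (le_of_path p) h
    refine ofPaths_eq_zero (NakRel.long hd1 p ?_)
    have := length_of_path hd1 p
    subst hd1
    obtain rfl : m = 0 := Subsingleton.elim _ _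
    rw [Fin.castSucc_zero, projSeq_zero] at hm
    simp only [KupischSeries.f] at hm
    have e : (⊤ : Fin 1) = 0 := rfl
    rw [e] at hm
    push_cast at hm
    lia
  obtain ⟨N, hN⟩ : ∃ N, p.length = N := ⟨_, rfl⟩
  induction N using Nat.strong_induction_on generalizing w z with
  | h N ih =>
  have hwz := le_of_path p
  obtain ⟨m, hm⟩ := key hwz h
  have hN0 : p.length ≠ 0 := by
    intro h0
    obtain rfl := Quiver.Path.eq_of_length_zero p h0
    exact h (inSupport_projSeq_self w.isOS)
  obtain ⟨w', a, p₁, hp₁, hlen₁⟩ := (Quiver.Path.length_ne_zero_iff_eq_comp p).1 hN0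
  by_cases hw' : InSupport (projSeq ℓ z.coord) w'.coord
  swap
  · rw [hp₁, pathHom_comp, ih p₁.length (by lia) p₁ hw' rfl, comp_zero]
  cases p with
  | nil => exact absurd (inSupport_projSeq_self w.isOS) h
  | @cons z' _ p b =>
  rw [Quiver.Path.length_cons] at hN
  rw [pathHom_cons]
  by_cases hz' : InSupport (projSeq ℓ z'.coord) w.coord
  swap
  · rw [ih p.length (by lia) p hz' rfl, zero_comp]
  have ha : ∀ t, w'.coord t = w.coord t + Pi.single (M := fun _ => ℤ) a.1 1 t :=
    fun t => congrFun a.2 t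
  have hb : ∀ t, z.coord t = z'.coord t + Pi.single (M := fun _ => ℤ) b.1 1 t :=
    fun t => congrFun b.2 t
  obtain ⟨m', hm', hdep⟩ := exists_prev (ℓ := ℓ) m
  -- Dropping the first arrow repairs the bound violated at `m`, so this arrow raises coordinate
  -- `m`.
  have ham : a.1 = m := by
    by_contra hne
    have h1 := ha m
    rw [Pi.single_eq_of_ne (Ne.symm hne)] at h1
    have := ((inSupport_iff _ _).1 hw' m).1
    lia
  -- Dropping the last arrow lowers the bound at `m`, so this arrow raises the coordinate `m'` on
  -- which that bound depends.
  have hbm : b.1 = m' := by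
    by_contra hne
    have h1 := hb m'
    rw [Pi.single_eq_of_ne (Ne.symm hne), add_zero] at h1
    have := ((inSupport_iff _ _).1 hz' m).1
    rw [← hdep _ _ h1] at this
    lia
  have hne : b.1 ≠ a.1 := by rw [ham, hbm]; exact hm' hd
  -- All paths from `w` to `z'` agree, so the given one may be assumed to end with a step in
  -- direction `m`, coming from `y`.
  let y : Fin d → ℤ := z'.coord - Pi.single a.1 1
  have hy : z'.coord = y + Pi.single a.1 1 := (sub_add_cancel _ _).symm
  have hyz' : y ≤ z'.coord := by
    rw [hy]; exact le_add_of_nonneg_right (Pi.single_nonneg.2 zero_le_one)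
  have hwy : w.coord ≤ y := by
    intro t
    have h1 := le_of_path p t
    have h2 := congrFun hy t
    rw [Pi.add_apply] at h2
    by_cases ht : t = a.1
    · subst ht
      have h3 := InSupport.le_of_projSeq hw' a.1
      have h4 := ha a.1
      have h5 := hb a.1
      rw [Pi.single_eq_same] at h2 h4
      rw [Pi.single_eq_of_ne hne.symm] at h5
      lia
    · rw [Pi.single_eq_of_ne ht] at h2
      lia
  have hbox := FullBox.of_projSeq hz'
  let Y : Vertex ℓ d := ⟨y, hbox y hwy hyz'⟩
  let a' : Y ⟶ z' := ⟨a.1, hy⟩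
  obtain ⟨s⟩ := nonempty_path (x := w) (y := Y) hwy fun t h1 h2 => hbox t h1 (h2.trans hyz')
  rw [pathHom_eq_of_fullBox hbox p (s.cons a'), pathHom_cons, Category.assoc]
  have hls : s.length + 1 = p.length := by
    have h1 := sum_of_path (s.cons a')
    have h2 := sum_of_path p
    rw [Quiver.Path.length_cons] at h1
    push_cast at h1
    lia
  by_cases hu : IsOS (fun i => ℓ.len (i + 1)) (y + Pi.single b.1 1)
  · let U : Vertex ℓ d := ⟨_, hu⟩
    let c : Y ⟶ U := ⟨b.1, rfl⟩
    let e : U ⟶ z := ⟨a.1, b.2.trans ((congrArg (· + _) hy).trans (add_right_comm _ _ _))⟩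
    rw [pathHom_comm (k := k) a' b c e rfl rfl, ← Category.assoc, ← pathHom_cons]
    -- `U` and `z` agree in coordinate `m'`, so the bound at `m` is violated for `U` too, and the
    -- path to `U` is one step shorter.
    have hU : ¬ InSupport (projSeq ℓ U.coord) w.coord := by
      intro hU
      have h1 := ((inSupport_iff _ _).1 hU m).1
      rw [← hdep z.coord U.coord] at h1
      · lia
      · have h2 := congrFun e.2 m'
        rw [Pi.add_apply, Pi.single_eq_of_ne (by rw [← hbm]; exact hne), add_zero] at h2
        exact h2
    rw [ih _ (by rw [Quiver.Path.length_cons]; lia) (s.cons c) hU rfl, zero_comp]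
  · rw [pathHom_zero a' b hu, comp_zero]

end Paths

/-! ### Morphism spaces of the covering category -/

section CoverHom
variable {k : Type u} [Field k] {n : ℕ} {ℓ : KupischSeries n} {d : ℕ} [NeZero d]
open BoundQuiver Vertex

theorem projSeq_translate (z : Fin d → ℤ) (c : ℤ) (i : Fin (d + 1)) :
    projSeq ℓ (z + fun _ => c * n) i = projSeq ℓ z i + c * n := by
  induction i using Fin.cases with
  | zero =>
    rw [projSeq_zero, projSeq_zero, Pi.add_apply, add_right_comm, KupischSeries.f_add_mul]
  | succ i => simp; ring

theorem inSupport_add_iff (x : Fin (d + 1) → ℤ) (z : Fin d → ℤ) (c : ℤ) :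
    InSupport (fun i => x i + c) (z + fun _ => c) ↔ InSupport x z := by
  simp only [inSupport_iff, Pi.add_apply]
  refine forall_congr' fun i => ⟨fun h => ⟨by lia, by lia⟩, fun h => ⟨by lia, by lia⟩⟩

/-- The condition for the space of morphisms `X ⟶ Y` to be non-zero. -/
def Linked (X Y : NakCover k ℓ d) : Prop := InSupport (projSeq ℓ Y.vertex.coord) X.vertex.coord

theorem Linked.fullBox {X Y : NakCover k ℓ d} (h : Linked X Y) : FullBox X.vertex Y.vertex :=
  FullBox.of_projSeq h

theorem Linked.le {X Y : NakCover k ℓ d} (h : Linked X Y) : X.vertex.coord ≤ Y.vertex.coord :=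
  InSupport.le_of_projSeq h

theorem Linked.nonempty_path {X Y : NakCover k ℓ d} (h : Linked X Y) :
    Nonempty (Quiver.Path X.vertex Y.vertex) :=
  Vertex.nonempty_path h.le h.fullBox

/-- The lower bounds of the interval of `Y` do not exceed those of the support of `M̂(x)`; for the
first coordinate this is monotonicity of `f`. -/
theorem linked_of_inSupport {x : Fin (d + 1) → ℤ} (hx : IsOS ℓ.len x) {X Y : NakCover k ℓ d}
    (hX : InSupport x X.vertex.coord) (hY : InSupport x Y.vertex.coord)
    (h : X.vertex.coord ≤ Y.vertex.coord) : Linked X Y := by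
  rw [isOS_iff_f] at hx
  rw [inSupport_iff] at hX hY
  refine (inSupport_iff _ _).2 fun i => ⟨?_, by rw [projSeq_succ]; have := h i; lia⟩
  have key : ∀ j : Fin (d + 1), j ≠ ⊤ → projSeq ℓ Y.vertex.coord j ≤ x j := by
    intro j hj
    induction j using Fin.cases with
    | zero =>
      rw [projSeq_zero]
      refine (ℓ.f_mono d ?_).trans hx.2
      have := (hY ⊤).2
      rw [top_eq_succ_top]
      lia
    | succ j =>
      rw [projSeq_succ]
      have := (hY j).2
      lia
  refine (key _ ?_).trans (hX i).1
  rw [Fin.top_eq_last]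
  exact (Fin.castSucc_lt_last i).ne

theorem Linked.translate_iff {X Y : NakCover k ℓ d} (c : ℤ) :
    Linked (((nakAction k ℓ d).T c).obj X) (((nakAction k ℓ d).T c).obj Y) ↔ Linked X Y := by
  unfold Linked
  rw [← inSupport_add_iff (projSeq ℓ Y.vertex.coord) _ (c * n)]
  refine iff_of_eq (congrArg₂ _ (funext fun i => ?_) rfl)
  exact projSeq_translate _ _ _

open Classical in
/-- The canonical generator of the space of morphisms `X ⟶ Y`. -/
def basisHom (X Y : NakCover k ℓ d) : X ⟶ Y :=
  if h : Linked X Y then pathHom k h.nonempty_path.some else 0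

theorem basisHom_of_not_linked {X Y : NakCover k ℓ d} (h : ¬ Linked X Y) : basisHom X Y = 0 :=
  dif_neg h

/-- The choice of a path in `basisHom` is immaterial. -/
theorem pathHom_eq_basisHom {x y : Vertex ℓ d} (p : Quiver.Path x y) :
    pathHom k p = basisHom ⟨x⟩ ⟨y⟩ := by
  by_cases h : Linked (⟨x⟩ : NakCover k ℓ d) ⟨y⟩
  · rw [basisHom, dif_pos h]
    exact pathHom_eq_of_fullBox h.fullBox _ _
  · rw [basisHom_of_not_linked h]
    exact pathHom_eq_zero p h

/-- `X` and `Z` need not be linked; the right-hand side is then the default value zero. -/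
theorem basisHom_comp {X Y Z : NakCover k ℓ d} (h : Linked X Y) (h' : Linked Y Z) :
    basisHom X Y ≫ basisHom Y Z = basisHom X Z := by
  obtain ⟨p⟩ := h.nonempty_path
  obtain ⟨q⟩ := h'.nonempty_path
  rw [← pathHom_eq_basisHom p, ← pathHom_eq_basisHom q, ← pathHom_eq_basisHom (p.comp q),
    pathHom_comp]

theorem exists_eq_smul_basisHom {X Y : NakCover k ℓ d} (g : X ⟶ Y) :
    ∃ r : k, g = r • basisHom X Y := by
  obtain ⟨g, rfl⟩ := ofPaths_surjective X Y g
  induction g using Finsupp.induction_linear with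
  | zero => exact ⟨0, by simp⟩
  | add f₁ f₂ h₁ h₂ =>
    obtain ⟨r, hr⟩ := h₁
    obtain ⟨s, hs⟩ := h₂
    exact ⟨r + s, by rw [map_add, hr, hs, add_smul]⟩
  | single p r =>
    refine ⟨r, ?_⟩
    rw [← pathHom_eq_basisHom p, pathHom, ofPath, ← map_smul, Finsupp.smul_single, smul_eq_mul,
      mul_one]

theorem map_basisHom (c : ℤ) (X Y : NakCover k ℓ d) :
    ((nakAction k ℓ d).T c).map (basisHom X Y) = basisHom _ _ := by
  by_cases h : Linked X Y
  · obtain ⟨p⟩ := h.nonempty_path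
    rw [← pathHom_eq_basisHom p]
    refine Eq.trans ?_ (pathHom_eq_basisHom ((translate ℓ d c).mapPath p))
    exact congrArg _ (BoundQuiver.pathMap_single _ p 1)
  · rw [basisHom_of_not_linked h, basisHom_of_not_linked (by rwa [Linked.translate_iff]),
      Functor.map_zero]

variable (k) in
/-- The canonical element of `M̂(x)_z`. -/
def hatOne (x : Fin (d + 1) → ℤ) (z : Fin d → ℤ) : HatSpace k x z := fun _ => 1

theorem hatOne_eq_zero {x : Fin (d + 1) → ℤ} {z : Fin d → ℤ} (h : ¬ InSupport x z) :
    hatOne k x z = 0 := funext fun i => (h i.down).elim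

theorem hatMap_hatOne {x y : Fin (d + 1) → ℤ} {w z : Fin d → ℤ} (h : InSupport x w) :
    hatMap k x w y z (hatOne k x w) = hatOne k y z := by
  funext i
  simp [hatMap, hatOne, h]

theorem hatAct_basisHom {x : Fin (d + 1) → ℤ} (hx : IsOS ℓ.len x) {z w : NakCover k ℓ d}
    (h : Linked z w) :
    hatAct k hx z w (basisHom z w) = hatMap k x w.vertex.coord x z.vertex.coord := by
  obtain ⟨p⟩ := h.nonempty_path
  rw [← pathHom_eq_basisHom p, pathHom, ofPath, hatAct_single, one_smul]

open Classical in
/-- The coefficient of a morphism with respect to `basisHom X Y`. -/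
def homCoeff (X Y : NakCover k ℓ d) : (X ⟶ Y) →ₗ[k] k :=
  if h : Linked X Y then
    LinearMap.proj (R := k) (⟨h⟩ : PLift (InSupport (projSeq ℓ Y.vertex.coord) X.vertex.coord)) ∘ₗ
      LinearMap.applyₗ (hatOne k _ _) ∘ₗ hatAct k (projSeq_isOS Y.vertex.isOS) X Y
  else 0

open Classical in
-- For linked `X` and `Y` the generator is non-zero because it acts as the identity of `k` on the
-- interval module of `projSeq`, whose support contains both vertices.
theorem homCoeff_basisHom (X Y : NakCover k ℓ d) :
    homCoeff X Y (basisHom X Y) = if Linked X Y then 1 else 0 := by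
  by_cases h : Linked X Y
  · rw [homCoeff, dif_pos h, if_pos h, LinearMap.comp_apply, LinearMap.comp_apply,
      hatAct_basisHom _ h, LinearMap.applyₗ_apply_apply,
      hatMap_hatOne (inSupport_projSeq_self Y.vertex.isOS)]
    rfl
  · rw [homCoeff, dif_neg h, if_neg h]; rfl

theorem homCoeff_basisHom_of_linked {X Y : NakCover k ℓ d} (h : Linked X Y) :
    homCoeff X Y (basisHom X Y) = 1 := by rw [homCoeff_basisHom, if_pos h]

theorem homCoeff_smul_basisHom {X Y : NakCover k ℓ d} (g : X ⟶ Y) :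
    homCoeff X Y g • basisHom X Y = g := by
  obtain ⟨r, rfl⟩ := exists_eq_smul_basisHom g
  by_cases h : Linked X Y
  · rw [map_smul, homCoeff_basisHom_of_linked h, smul_eq_mul, mul_one]
  · rw [basisHom_of_not_linked h, smul_zero, smul_zero]

theorem homCoeff_of_not_linked {X Y : NakCover k ℓ d} (h : ¬ Linked X Y) (g : X ⟶ Y) :
    homCoeff X Y g = 0 := by rw [homCoeff, dif_neg h]; rfl

theorem linked_of_ne_zero {X Y : NakCover k ℓ d} {g : X ⟶ Y} (h : g ≠ 0) : Linked X Y := by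
  by_contra h'
  exact h (by rw [← homCoeff_smul_basisHom g, homCoeff_of_not_linked h', zero_smul])

theorem homCoeff_eq_zero_iff {X Y : NakCover k ℓ d} (g : X ⟶ Y) : homCoeff X Y g = 0 ↔ g = 0 :=
  ⟨fun h => by rw [← homCoeff_smul_basisHom g, h, zero_smul], fun h => by rw [h, map_zero]⟩

open Classical in
theorem hatAct_hatOne {x : Fin (d + 1) → ℤ} (hx : IsOS ℓ.len x) {z w : NakCover k ℓ d}
    (g : z ⟶ w) :
    hatAct k hx z w g (hatOne k x w.vertex.coord) =
      (if InSupport x w.vertex.coord then homCoeff z w g else 0) • hatOne k x z.vertex.coord := by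
  by_cases hw : InSupport x w.vertex.coord
  swap
  · rw [hatOne_eq_zero hw, map_zero, if_neg hw, zero_smul]
  rw [if_pos hw]
  conv_lhs => rw [← homCoeff_smul_basisHom g]
  rw [map_smul, LinearMap.smul_apply]
  by_cases h : Linked z w
  · rw [hatAct_basisHom hx h, hatMap_hatOne hw]
  · rw [homCoeff_of_not_linked h, zero_smul, zero_smul]

end CoverHom

/-! ### Morphisms of the orbit category -/

section OrbitHom
variable {k : Type u} [Field k] {n : ℕ} {ℓ : KupischSeries n} {d : ℕ} [NeZero d]
open IntAction

/-- The objects of the cover lying over an object of the `d`-Nakayama algebra. -/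
abbrev NakFiber (a : Nak k ℓ d) : Type := Fiber (A := nakAction k ℓ d) a

variable {a b : Nak k ℓ d}

/-- The underlying sequence of an object of a fiber. -/
abbrev NakFiber.coord (X : NakFiber a) : Fin d → ℤ := X.1.vertex.coord

theorem fiber_exists_shift (X Y : NakFiber a) : ∃ c, X.shift c = Y := by
  obtain ⟨c, hc⟩ := Quotient.exact (s := (nakAction k ℓ d).orbitSetoid) (X.2.trans Y.2.symm)
  exact ⟨c, Subtype.ext hc⟩

theorem coord_shift (X : NakFiber a) (c : ℤ) :
    NakFiber.coord (X.shift c) = X.coord + fun _ => c * n := rfl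

theorem shift_inj (X : NakFiber a) {c c' : ℤ} (h : X.shift c = X.shift c') : c = c' := by
  have h1 := congrFun (congrArg NakFiber.coord h) 0
  rw [coord_shift, coord_shift, Pi.add_apply, Pi.add_apply] at h1
  have hn : (n : ℤ) ≠ 0 := by exact_mod_cast ℓ.pos.ne'
  exact mul_right_cancel₀ hn (add_left_cancel h1)

/-- Invariance under the translations determines a family from a single column. -/
theorem nak_hom_ext {f g : a ⟶ b} (Y : NakFiber b) (h : ∀ X, f.1 X Y = g.1 X Y) : f = g := by
  refine OrbitCat.hom_ext fun X Y' => ?_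
  obtain ⟨c, rfl⟩ := fiber_exists_shift Y Y'
  obtain ⟨X, rfl⟩ := (Fiber.shiftEquiv a c).surjective X
  exact (f.2.1 c X Y).trans ((congrArg _ (h X)).trans (g.2.1 c X Y).symm)

open Classical in
/-- The image in the orbit category of the canonical generator of the morphisms `X ⟶ Y`. -/
def orbitHom (X : NakFiber a) (Y : NakFiber b) : a ⟶ b :=
  ⟨fun X' Y' => if ∃ c, X.shift c = X' ∧ Y.shift c = Y' then basisHom X'.1 Y'.1 else 0, by
    refine ⟨fun e X' Y' => ?_, fun X' => ?_, fun Y' => ?_⟩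
    · have : (∃ c, X.shift c = X'.shift e ∧ Y.shift c = Y'.shift e) ↔
          ∃ c, X.shift c = X' ∧ Y.shift c = Y' := by
        constructor
        · rintro ⟨c, h1, h2⟩
          refine ⟨c - e, (Fiber.shiftEquiv a e).injective ?_, (Fiber.shiftEquiv b e).injective ?_⟩
          · exact (Fiber.shift_shift _ _ _).trans (by rw [sub_add_cancel]; exact h1)
          · exact (Fiber.shift_shift _ _ _).trans (by rw [sub_add_cancel]; exact h2)
        · rintro ⟨c, rfl, rfl⟩
          exact ⟨c + e, (Fiber.shift_shift _ _ _).symm, (Fiber.shift_shift _ _ _).symm⟩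
      simp only [this]
      split_ifs
      · exact (map_basisHom e _ _).symm
      · exact (((nakAction k ℓ d).T e).map_zero _ _).symm
    · obtain ⟨c, rfl⟩ := fiber_exists_shift X X'
      refine (Set.finite_singleton (Y.shift c)).subset fun Y' hY' => ?_
      by_contra h
      refine hY' (if_neg ?_)
      rintro ⟨c', h1, rfl⟩
      exact h (by rw [shift_inj X h1]; rfl)
    · obtain ⟨c, rfl⟩ := fiber_exists_shift Y Y'
      refine (Set.finite_singleton (X.shift c)).subset fun X' hX' => ?_
      by_contra h
      refine hX' (if_neg ?_)
      rintro ⟨c', rfl, h1⟩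
      exact h (by rw [shift_inj Y h1]; rfl)⟩

theorem orbitHom_shift (X : NakFiber a) (Y : NakFiber b) (c : ℤ) :
    (orbitHom X Y).1 (X.shift c) (Y.shift c) = basisHom (X.shift c).1 (Y.shift c).1 :=
  if_pos ⟨c, rfl, rfl⟩

theorem orbitHom_self (X : NakFiber a) (Y : NakFiber b) :
    (orbitHom X Y).1 X Y = basisHom X.1 Y.1 :=
  if_pos ⟨0, Fiber.shift_zero _, Fiber.shift_zero _⟩

theorem orbitHom_right {X : NakFiber a} {Y : NakFiber b} {c : ℤ} {X' : NakFiber a}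
    (h : X' ≠ X.shift c) : (orbitHom X Y).1 X' (Y.shift c) = 0 := by
  refine if_neg ?_
  rintro ⟨c', rfl, h1⟩
  exact h (by rw [shift_inj Y h1])

theorem orbitHom_self_left {X : NakFiber a} {Y : NakFiber b} {Y' : NakFiber b}
    (h : Y' ≠ Y) : (orbitHom X Y).1 X Y' = 0 := by
  refine if_neg ?_
  rintro ⟨c', h1, rfl⟩
  exact h (by rw [shift_inj X (h1.trans (Fiber.shift_zero X).symm), Fiber.shift_zero])

end OrbitHom

section Pushdown
open IntAction Opposite
variable {k : Type u} [Field k] {C : Type} [Category.{u} C] [Preadditive C] [Linear k C]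
  {A : IntAction k C} {M N : Cᵒᵖ ⥤ ModuleCat.{u} k} [M.Additive] [N.Additive]

open Classical in
theorem pushdownHomMap_lof (c : ℤ) (α : M ⟶ (A.T c).op ⋙ N) {a : OrbitCat A} (X : Fiber a)
    (m : M.obj (op X.1)) :
    pushdownHomMap c α a (DirectSum.lof k (Fiber a) (fun X => M.obj (op X.1)) X m) =
      DirectSum.lof k (Fiber a) (fun X => N.obj (op X.1)) (X.shift c) (shiftApp c α X m) := by
  rw [pushdownHomMap, DirectSum.toModule_lof]
  rfl

end Pushdown

/-! ### Coordinates on the modules `M(x)` -/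

section IndecModule
variable {k : Type u} [Field k] {n : ℕ} {ℓ : KupischSeries n} {d : ℕ} [NeZero d]
open IntAction Opposite
variable {a b : Nak k ℓ d} (x y z : OS ℓ.len (d + 1))

open Classical in
/-- The canonical element of `M(x)` at an object of a fiber (zero outside the support). -/
def vec (X : NakFiber a) : (indecModule k x).obj (op a) :=
  DirectSum.lof k (NakFiber a) (fun X => (hatModule k x).obj (op X.1)) X (hatOne k x.1 X.coord)

theorem vec_eq_zero {x : OS ℓ.len (d + 1)} {X : NakFiber a} (h : ¬ InSupport x.1 X.coord) :
    vec x X = 0 := by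
  classical
  rw [vec, hatOne_eq_zero h]
  exact map_zero _

open Classical in
/-- The coordinate of an element of `M(x)` at an object of a fiber. -/
def crd (X : NakFiber a) : (indecModule k x).obj (op a) →ₗ[k] k :=
  if h : InSupport x.1 X.coord then
    LinearMap.proj (R := k) (⟨h⟩ : PLift (InSupport x.1 X.coord)) ∘ₗ
      DirectSum.component k (NakFiber a) (fun X => HatSpace k x.1 X.coord) X
  else 0

/-- The spaces `M̂(x)_z` are at most one-dimensional, so the vectors `vec x X` span. -/
theorem indec_linearMap_ext {N : Type*} [AddCommGroup N] [Module k N]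
    {f g : (indecModule k x).obj (op a) →ₗ[k] N} (h : ∀ X, f (vec x X) = g (vec x X)) : f = g := by
  classical
  refine DirectSum.linearMap_ext k fun (X : NakFiber a) => LinearMap.ext fun m => ?_
  have hm : ∃ r : k, m = r • hatOne k x.1 X.coord := by
    by_cases hX : InSupport x.1 X.coord
    · refine ⟨m ⟨hX⟩, funext fun i => ?_⟩
      simp [hatOne]
    · exact ⟨0, funext fun i => (hX i.down).elim⟩
  obtain ⟨r, rfl⟩ := hm
  refine (map_smul _ r _).trans (Eq.trans ?_ (map_smul _ r _).symm)
  exact congrArg _ (h X)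

open Classical in
theorem crd_vec (X Y : NakFiber a) :
    crd x X (vec x Y) = if Y = X ∧ InSupport x.1 X.coord then 1 else 0 := by
  by_cases h : InSupport x.1 X.coord
  · rw [crd, dif_pos h]
    by_cases hY : Y = X
    · subst hY
      rw [if_pos ⟨rfl, h⟩]
      exact congrFun (DirectSum.component.lof_self k (M := fun X : NakFiber a =>
        HatSpace k x.1 X.coord) Y (hatOne k x.1 Y.coord)) ⟨h⟩
    · rw [if_neg fun e => hY e.1]
      refine congrFun ((DirectSum.component.of k (M := fun X : NakFiber a =>
        HatSpace k x.1 X.coord) X Y (hatOne k x.1 Y.coord)).trans (dif_neg hY)) ⟨h⟩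
  · rw [crd, dif_neg h, if_neg fun e => h e.2]; rfl

theorem crd_of_not_inSupport {x : OS ℓ.len (d + 1)} {X : NakFiber a} (h : ¬ InSupport x.1 X.coord)
    (m : (indecModule k x).obj (op a)) : crd x X m = 0 := by
  rw [crd, dif_neg h]; rfl

theorem crd_ext {m m' : (indecModule k x).obj (op a)} (h : ∀ X, crd x X m = crd x X m') :
    m = m' := by
  classical
  refine DFinsupp.ext fun (X : NakFiber a) => funext fun i => ?_
  have := h X
  rw [crd, dif_pos i.down] at this
  exact this

open Classical in
theorem crd_map_vec (f : a ⟶ b) (X : NakFiber a) (Y : NakFiber b) :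
    crd x X ((indecModule k x).map f.op (vec x Y)) =
      if InSupport x.1 X.coord ∧ InSupport x.1 Y.coord then homCoeff X.1 Y.1 (f.1 X Y) else 0 := by
  by_cases hX : InSupport x.1 X.coord
  swap
  · rw [crd, dif_neg hX, if_neg fun e => hX e.1]; rfl
  have hfin := f.2.2.2 Y
  -- `X` is inserted so that its term is present even if the coefficient there vanishes.
  have h := pushdownMap_lof (hatModule k x) f Y (hatOne k x.1 Y.coord) (s := insert X hfin.toFinset)
    (fun X hX => by simp [hX])
  have h' : ∀ X : NakFiber a, ((hatModule k x).map (f.1 X Y).op).hom (hatOne k x.1 Y.coord) =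
      (if InSupport x.1 Y.coord then homCoeff X.1 Y.1 (f.1 X Y) else 0) • hatOne k x.1 X.coord :=
    fun X => hatAct_hatOne x.2 (f.1 X Y)
  have e : (indecModule k x).map f.op (vec x Y) =
      ∑ X ∈ insert X hfin.toFinset,
        (if InSupport x.1 Y.coord then homCoeff X.1 Y.1 (f.1 X Y) else 0) • vec x X := by
    refine h.trans (Finset.sum_congr rfl fun X _ => ?_)
    exact (congrArg _ (h' X)).trans (map_smul _ _ _)
  rw [e, map_sum, Finset.sum_eq_single X]
  · rw [map_smul, crd_vec]
    simp [hX]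
  · intro Z _ hZ
    rw [map_smul, crd_vec]
    simp [hZ]
  · intro h
    exact absurd (Finset.mem_insert_self _ _) h

theorem indecModule_map_smul_add (r s : k) (f g : a ⟶ b) (m : (indecModule k x).obj (op b)) :
    (indecModule k x).map (r • f + s • g).op m =
      r • (indecModule k x).map f.op m + s • (indecModule k x).map g.op m := by
  classical
  have : ((indecModule k x).map (r • f + s • g).op).hom =
      r • ((indecModule k x).map f.op).hom + s • ((indecModule k x).map g.op).hom := by
    refine indec_linearMap_ext x fun Y => crd_ext x fun X => ?_
    rw [LinearMap.add_apply, LinearMap.smul_apply, LinearMap.smul_apply, map_add, map_smul,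
      map_smul]
    refine (crd_map_vec x _ X Y).trans ?_
    refine Eq.trans ?_ (congrArg₂ (fun p q => r • p + s • q) (crd_map_vec x f X Y).symm
      (crd_map_vec x g X Y).symm)
    split_ifs
    · rw [OrbitCat.add_val, OrbitCat.smul_val, OrbitCat.smul_val, map_add, map_smul, map_smul]
    · simp
  exact LinearMap.congr_fun this m

open Classical in
-- A single path can thus be used to test whether an element of `M(x)` has a given coordinate.
theorem crd_map_orbitHom (X : NakFiber a) (Y : NakFiber b) (c : ℤ)
    (m : (indecModule k x).obj (op b)) :
    crd x (X.shift c) ((indecModule k x).map (orbitHom X Y).op m) =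
      if Linked X.1 Y.1 ∧ InSupport x.1 (NakFiber.coord (X.shift c)) then
        crd x (Y.shift c) m else 0 := by
  have : crd x (X.shift c) ∘ₗ ((indecModule k x).map (orbitHom X Y).op).hom =
      if Linked X.1 Y.1 ∧ InSupport x.1 (NakFiber.coord (X.shift c)) then
        crd x (Y.shift c) else 0 := by
    refine indec_linearMap_ext x fun Z => ?_
    refine (crd_map_vec x _ _ Z).trans ?_
    have hl : Linked (X.shift c).1 (Y.shift c).1 ↔ Linked X.1 Y.1 := Linked.translate_iff c
    by_cases hZ : Z = Y.shift c
    · subst hZ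
      rw [orbitHom_shift, homCoeff_basisHom, hl, apply_ite (fun f : _ →ₗ[k] k => f _), crd_vec]
      split_ifs <;> first | rfl | tauto
    · have h0 : (orbitHom X Y).1 (X.shift c) Z = 0 := by
        obtain ⟨c', rfl⟩ := fiber_exists_shift Y Z
        refine orbitHom_right fun e => hZ ?_
        rw [shift_inj X e]
      rw [h0, map_zero, apply_ite (fun f : _ →ₗ[k] k => f _), crd_vec]
      simp [hZ]
  have h := LinearMap.congr_fun this m
  rw [apply_ite (fun f : _ →ₗ[k] k => f _)] at h
  exact h

theorem map_orbitHom_vec {X : NakFiber a} {Y : NakFiber b} (h : Linked X.1 Y.1)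
    (hY : InSupport x.1 Y.coord) :
    (indecModule k x).map (orbitHom X Y).op (vec x Y) = vec x X := by
  classical
  refine crd_ext x fun X' => ?_
  obtain ⟨c, rfl⟩ := fiber_exists_shift X X'
  rw [crd_map_orbitHom, crd_vec, crd_vec]
  have h0 : Y = Y.shift c ↔ X = X.shift c := by
    constructor <;> intro e
    · rw [← shift_inj Y ((Fiber.shift_zero Y).trans e), Fiber.shift_zero]
    · rw [← shift_inj X ((Fiber.shift_zero X).trans e), Fiber.shift_zero]
  by_cases e : Y = Y.shift c
  · rw [← e, ← h0.1 e]
    simp [h, hY]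
  · have e' : ¬ X = X.shift c := fun h => e (h0.2 h)
    simp [e, e']

open Classical in
theorem indecHom_vec (c : ℤ) (X : NakFiber a) :
    (indecHom k x y c).app (op a) (vec x X) =
      if Prec x.1 (fun i => y.1 i - c * n) ∧ InSupport x.1 X.coord then vec y (X.shift c) else 0 := by
  by_cases h : Prec x.1 (fun i => y.1 i - c * n)
  · by_cases hX : InSupport x.1 X.coord
    · have e : indecHom k x y c = pushdownHom c (hatHom k x y c h) := dif_pos h
      rw [e, if_pos ⟨h, hX⟩]
      refine Eq.trans (pushdownHomMap_lof c (hatHom k x y c h) X (hatOne k x.1 X.coord)) ?_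
      have e' := congrArg (DirectSum.lof k (NakFiber a) (fun X : NakFiber a =>
        HatSpace k y.1 X.coord) (X.shift c)) (hatMap_hatOne (k := k) (y := y.1)
          (z := NakFiber.coord (X.shift c)) hX)
      exact e'
    · rw [vec_eq_zero hX, map_zero, if_neg fun e => hX e.2]
  · have e : indecHom k x y c = 0 := dif_neg h
    rw [e, if_neg fun e => h e.1]; rfl

end IndecModule

/-! ### The basis `f^c_{yx}` of the morphisms `M(x) ⟶ M(y)` -/

section HomBasis
variable {k : Type u} [Field k] {n : ℕ} {ℓ : KupischSeries n} {d : ℕ} [NeZero d]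
open IntAction Opposite
variable {a b : Nak k ℓ d} (x y z : OS ℓ.len (d + 1))

theorem inSupport_top : InSupport x.1 (fun i : Fin d => x.1 i.succ - 1) := by
  rw [inSupport_iff]
  intro i
  have := x.2.1 (Fin.castSucc_lt_succ (i := i))
  constructor <;> lia

/-- The largest vertex in the support of `M̂(x)`. -/
def topVertex : Vertex ℓ d := ⟨fun i => x.1 i.succ - 1, InSupport.isOS x.2 (inSupport_top x)⟩

variable (k) in
/-- The orbit of the largest vertex in the support of `M̂(x)`. -/
def topObj : Nak k ℓ d := ⟨Quotient.mk _ ⟨topVertex x⟩⟩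

variable (k) in
/-- The largest vertex in the support of `M̂(x)`, as an object of a fiber. -/
def topFiber : NakFiber (topObj k x) := ⟨⟨topVertex x⟩, rfl⟩

theorem coord_topFiber : (topFiber k x).coord = fun i => x.1 i.succ - 1 := rfl

theorem inSupport_topFiber : InSupport x.1 (topFiber k x).coord := inSupport_top x

theorem le_top_of_inSupport {x : OS ℓ.len (d + 1)} {w : Fin d → ℤ} (h : InSupport x.1 w) :
    w ≤ (topVertex x).coord := fun i => ((inSupport_iff _ _).1 h i).2

variable (k) in
/-- The canonical generator of `M(x)`. -/
def gen : (indecModule k x).obj (op (topObj k x)) := vec x (topFiber k x)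

theorem linked_topFiber {X : NakFiber a} (h : InSupport x.1 X.coord) :
    Linked X.1 (topFiber k x).1 :=
  linked_of_inSupport x.2 h (inSupport_topFiber x) (le_top_of_inSupport h)

theorem map_orbitHom_gen {X : NakFiber a} (h : InSupport x.1 X.coord) :
    (indecModule k x).map (orbitHom X (topFiber k x)).op (gen k x) = vec x X :=
  map_orbitHom_vec x (linked_topFiber x h) (inSupport_topFiber x)

/-- `M(x)` is cyclic: a path from `X` up to the top vertex carries the generator to `vec x X`. -/
theorem hom_ext_gen {N : (Nak k ℓ d)ᵒᵖ ⥤ ModuleCat.{u} k} {φ ψ : indecModule k x ⟶ N}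
    (h : φ.app _ (gen k x) = ψ.app _ (gen k x)) : φ = ψ := by
  ext a : 2
  refine ModuleCat.hom_ext (indec_linearMap_ext x fun X => ?_)
  by_cases hX : InSupport x.1 X.coord
  · have e := map_orbitHom_gen x hX
    have h1 := NatTrans.naturality_apply φ (orbitHom X (topFiber k x)).op (gen k x)
    have h2 := NatTrans.naturality_apply ψ (orbitHom X (topFiber k x)).op (gen k x)
    rw [e] at h1 h2
    exact h1.trans ((congrArg _ h).trans h2.symm)
  · rw [vec_eq_zero hX, map_zero, map_zero]

/-- The coefficients of a morphism `M(x) ⟶ M(y)` with respect to the morphisms `f^c_{yx}`. -/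
def indecCoeff : (indecModule k x ⟶ indecModule k y) →ₗ[k] ℤ → k where
  toFun φ c := crd y ((topFiber k x).shift c) (φ.app _ (gen k x))
  map_add' φ ψ := funext fun _ => map_add (crd y _) (φ.app _ (gen k x)) (ψ.app _ (gen k x))
  map_smul' r φ := funext fun _ => map_smul (crd y _) r (φ.app _ (gen k x))

theorem indecCoeff_injective : Function.Injective (indecCoeff (k := k) x y) := by
  intro φ ψ h
  refine hom_ext_gen x (crd_ext y fun X => ?_)
  obtain ⟨c, rfl⟩ := fiber_exists_shift (topFiber k x) X
  exact congrFun h c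

variable {x y}

/-- Membership of the translated top vertex in the support of `M̂(y)` encodes every inequality of
`≼` except the first, `x₁ ≤ y₁ - c n`, which has to be supplied. -/
theorem prec_of_inSupport {c : ℤ}
    (h : InSupport y.1 (NakFiber.coord ((topFiber k x).shift c))) (h0 : x.1 0 ≤ y.1 0 - c * n) :
    Prec x.1 (fun i => y.1 i - c * n) := by
  rw [inSupport_iff] at h
  simp only [coord_shift, coord_topFiber, Pi.add_apply] at h
  refine ⟨fun i => ?_, fun i j hij => ?_⟩
  · induction i using Fin.cases with
    | zero => exact h0
    | succ i => have := (h i).2; lia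
  · have hi : (i : ℕ) < d := by have := j.2; lia
    have := (h ⟨i, hi⟩).1
    have e1 : (⟨i, hi⟩ : Fin d).castSucc = i := rfl
    have e2 : (⟨i, hi⟩ : Fin d).succ = j := Fin.ext hij
    rw [e1, e2] at this
    lia

theorem inSupport_of_prec {c : ℤ} (h : Prec x.1 (fun i => y.1 i - c * n)) :
    InSupport y.1 (NakFiber.coord ((topFiber k x).shift c)) := by
  rw [inSupport_iff]
  simp only [coord_shift, coord_topFiber, Pi.add_apply]
  intro i
  have h1 := h.1 i.succ
  have h2 := h.2 i.castSucc i.succ (by simp)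
  constructor <;> lia

/-- If the coefficient is non-zero, only the first inequality of `≼` can fail. Lowering the first
coordinate of the top vertex to `x₁ - 1` then gives a vertex outside the support of `M̂(x)` whose
translate lies in that of `M̂(y)`. The path from it to the top kills the generator but preserves the
coordinate of its image, contradicting naturality. -/
theorem indecCoeff_eq_zero (φ : indecModule k x ⟶ indecModule k y) {c : ℤ}
    (h : ¬ Prec x.1 (fun i => y.1 i - c * n)) : indecCoeff x y φ c = 0 := by
  classical
  by_contra hne
  have hy : InSupport y.1 (NakFiber.coord ((topFiber k x).shift c)) := by
    by_contra h'
    exact hne (crd_of_not_inSupport h' _)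
  have h0 : y.1 0 - c * n < x.1 0 := by
    by_contra! h'
    exact h (prec_of_inSupport hy h')
  let w : Fin d → ℤ := Function.update (topVertex x).coord 0 (x.1 0 - 1)
  have hw0 : w 0 = x.1 0 - 1 := Function.update_self _ _ _
  have hle : w ≤ (topVertex x).coord := by
    intro i
    by_cases hi : i = 0
    · subst hi
      rw [hw0]
      have := ((inSupport_iff _ _).1 (inSupport_top x) 0).1
      rw [← zero_eq_castSucc_zero] at this
      simp only [topVertex]
      lia
    · exact (Function.update_of_ne hi _ _).le
  have hyw : InSupport y.1 (w + fun _ => c * n) := by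
    rw [inSupport_iff] at hy ⊢
    intro i
    have h1 := hy i
    rw [coord_shift] at h1
    refine ⟨?_, le_trans (add_le_add_left (hle i) _) h1.2⟩
    by_cases hi : i = 0
    · subst hi
      rw [Pi.add_apply, hw0, ← zero_eq_castSucc_zero]
      lia
    · have : w i = (topVertex x).coord i := Function.update_of_ne hi _ _
      rw [Pi.add_apply, this]
      exact h1.1
  let W : NakCover k ℓ d := ⟨⟨w, (IsOS.translate c).1 (InSupport.isOS y.2 hyw)⟩⟩
  let o : Nak k ℓ d := ⟨Quotient.mk _ W⟩
  let F : NakFiber o := ⟨W, rfl⟩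
  have hl : Linked F.1 (topFiber k x).1 :=
    (Linked.translate_iff c).1 (linked_of_inSupport y.2 hyw hy fun i => add_le_add_left (hle i) _)
  have hx : ¬ InSupport x.1 w := fun h' => by
    have := ((inSupport_iff _ _).1 h' 0).1
    rw [← zero_eq_castSucc_zero] at this
    lia
  have hzero : (indecModule k x).map (orbitHom F (topFiber k x)).op (gen k x) = 0 := by
    refine crd_ext x fun X => ?_
    obtain ⟨e, rfl⟩ := fiber_exists_shift F X
    rw [crd_map_orbitHom, map_zero, gen, crd_vec]
    split_ifs with h1 h2
    · have := shift_inj (topFiber k x) ((Fiber.shift_zero _).trans h2.1)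
      subst this
      refine absurd h1.2 ?_
      rw [Fiber.shift_zero]
      exact hx
    · rfl
    · rfl
  have hnat := NatTrans.naturality_apply φ (orbitHom F (topFiber k x)).op (gen k x)
  rw [hzero, map_zero] at hnat
  have := congrArg (crd y (F.shift c)) hnat
  rw [map_zero, crd_map_orbitHom, if_pos ⟨hl, hyw⟩] at this
  exact hne this.symm

/-- Such `c` satisfy `x₁ ≤ y₁ - c n < x₂`, and `1 ≤ n` turns this into bounds for `c`. -/
theorem finite_prec (x y : OS ℓ.len (d + 1)) :
    {c : ℤ | Prec x.1 (fun i => y.1 i - c * n)}.Finite := by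
  have hn : (1 : ℤ) ≤ n := by exact_mod_cast ℓ.pos
  refine (Set.finite_Icc (-(|y.1 0| + |x.1 (Fin.succ 0)|)) (|y.1 0| + |x.1 0|)).subset
    fun c hc => ?_
  have h1 := hc.1 0
  have h2 := hc.2 (Fin.castSucc 0) (Fin.succ 0) (Fin.val_succ _).symm
  rw [← zero_eq_castSucc_zero] at h2
  have h3 := abs_nonneg (y.1 0)
  have h4 := neg_abs_le (y.1 0)
  have h5 := le_abs_self (y.1 0)
  have h6 := neg_abs_le (x.1 0)
  have h7 := le_abs_self (x.1 (Fin.succ 0))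
  have h8 := abs_nonneg (x.1 0)
  have h9 := abs_nonneg (x.1 (Fin.succ 0))
  simp only at h1 h2
  constructor
  · by_contra! h
    have : c * n ≤ c := by nlinarith
    lia
  · by_contra! h
    have : c ≤ c * n := by nlinarith
    lia

open Classical in
theorem indecCoeff_indecHom (c e : ℤ) :
    indecCoeff x y (indecHom k x y c) e =
      if c = e ∧ Prec x.1 (fun i => y.1 i - e * n) then 1 else 0 := by
  change crd y _ ((indecHom k x y c).app _ (vec x (topFiber k x))) = _
  rw [indecHom_vec]
  by_cases hc : Prec x.1 (fun i => y.1 i - c * n)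
  · rw [if_pos ⟨hc, inSupport_topFiber x⟩, crd_vec]
    by_cases hce : c = e
    · subst hce
      rw [if_pos ⟨rfl, inSupport_of_prec hc⟩, if_pos ⟨rfl, hc⟩]
    · rw [if_neg fun h => hce (shift_inj _ h.1), if_neg fun h => hce h.1]
  · rw [if_neg fun h => hc h.1, map_zero, if_neg]
    rintro ⟨rfl, h⟩
    exact hc h

/-- The indices of the morphisms in the basis `f^c_{yx}` of the morphisms `M(x) ⟶ M(y)`. -/
def precFinset (x y : OS ℓ.len (d + 1)) : Finset ℤ := (finite_prec x y).toFinset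

theorem mem_precFinset {c : ℤ} :
    c ∈ precFinset x y ↔ Prec x.1 (fun i => y.1 i - c * n) := by
  simp [precFinset]

/-- Together with `indecCoeff_indecHom` this makes the `f^c_{yx}` with `c` in `precFinset x y` a
basis. -/
theorem eq_sum_indecHom (φ : indecModule k x ⟶ indecModule k y) :
    φ = ∑ c ∈ precFinset x y, indecCoeff x y φ c • indecHom k x y c := by
  classical
  refine indecCoeff_injective x y (funext fun e => ?_)
  rw [map_sum, Finset.sum_apply]
  simp only [map_smul, Pi.smul_apply, indecCoeff_indecHom, smul_eq_mul]
  by_cases he : Prec x.1 (fun i => y.1 i - e * n)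
  · rw [Finset.sum_eq_single e]
    · simp [he]
    · intro c _ hc
      simp [hc]
    · exact fun h => absurd (mem_precFinset.2 he) h
  · rw [indecCoeff_eq_zero φ he]
    simp [he]

theorem indecHom_id : indecHom k x x 0 = 𝟙 _ := by
  refine hom_ext_gen x ?_
  have h : Prec x.1 (fun i => x.1 i - 0 * n) := by
    simp only [zero_mul, sub_zero]
    exact ⟨fun i => le_rfl, fun i j h => x.2.1 (Fin.lt_def.2 (by lia))⟩
  have := indecHom_vec x x 0 (topFiber k x)
  rw [if_pos ⟨h, inSupport_topFiber x⟩, Fiber.shift_zero] at this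
  exact this

variable {z}

theorem indecHom_comp {c e : ℤ} (h : Prec x.1 (fun i => y.1 i - c * n))
    (h' : Prec y.1 (fun i => z.1 i - e * n)) :
    indecHom k x y c ≫ indecHom k y z e = indecHom k x z (c + e) := by
  classical
  refine hom_ext_gen x ?_
  change (indecHom k y z e).app _ ((indecHom k x y c).app _ (vec x (topFiber k x))) =
    (indecHom k x z (c + e)).app _ (vec x (topFiber k x))
  rw [indecHom_vec, indecHom_vec, if_pos ⟨h, inSupport_topFiber x⟩, indecHom_vec,
    if_pos ⟨h', inSupport_of_prec h⟩, Fiber.shift_shift]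
  split_ifs with h1
  · rfl
  -- The first inequalities of the two relations compose. So if `≼` fails for the composite, the
  -- translated generator lies outside the support of `M̂(z)`, and both sides are zero.
  · refine vec_eq_zero fun hz => h1 ⟨prec_of_inSupport hz ?_, inSupport_topFiber x⟩
    have h2 := h.1 0
    have h3 := h'.1 0
    simp only at h2 h3
    lia

end HomBasis

/-! ### The representable modules among the `M(x)` -/

section Yoneda
variable {k : Type u} [Field k] {n : ℕ} {ℓ : KupischSeries n} {d : ℕ} [NeZero d]
open IntAction Opposite

/-- The morphism `Hom(-, v) ⟶ M(x)`, where `v` is the largest vertex in the support. -/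
def yonedaHom (x : OS ℓ.len (d + 1)) :
    (linearYoneda k (Nak k ℓ d)).obj (topObj k x) ⟶ indecModule k x where
  app b := ModuleCat.ofHom
    { toFun := fun g : b.unop ⟶ topObj k x => (indecModule k x).map g.op (gen k x)
      map_add' := fun f g => by
        have := indecModule_map_smul_add x 1 1 f g (gen k x)
        simp only [one_smul] at this
        exact this
      map_smul' := fun r f => by
        have := indecModule_map_smul_add x r 0 f 0 (gen k x)
        simp only [zero_smul, add_zero] at this
        exact this }
  naturality b c f := by
    ext1
    refine LinearMap.ext fun g : b.unop ⟶ topObj k x => ?_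
    change (indecModule k x).map (f.unop ≫ g).op (gen k x) =
      (indecModule k x).map f ((indecModule k x).map g.op (gen k x))
    rw [op_comp, Functor.map_comp]
    rfl

variable {x : OS ℓ.len (d + 1)} (hx : ℓ.f d (x.1 ⊤) = x.1 0)
include hx

theorem projSeq_topVertex : projSeq ℓ (topVertex x).coord = x.1 := by
  funext i
  induction i using Fin.cases with
  | zero =>
    rw [projSeq_zero, ← hx, top_eq_succ_top]
    simp [topVertex]
  | succ i => simp [topVertex]

/-- The coordinates of the image of `g` are the coefficients in the column of `g` at the top vertex.
Since `projSeq` of the top vertex is `x`, the vertices linked to it are those of the support, so no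
coefficient is lost; surjectivity holds because `M(x)` is cyclic. -/
theorem yonedaHom_bijective (b : (Nak k ℓ d)ᵒᵖ) :
    Function.Bijective ((yonedaHom x).app b).hom := by
  have hs : ∀ (X : NakFiber b.unop), Linked X.1 (topFiber k x).1 ↔ InSupport x.1 X.coord := by
    intro X
    unfold Linked
    exact iff_of_eq (congrArg (InSupport · _) (projSeq_topVertex hx))
  constructor
  · refine (injective_iff_map_eq_zero _).2 fun (g : b.unop ⟶ topObj k x) hg => ?_
    refine nak_hom_ext (topFiber k x) fun X => ?_
    change g.1 X _ = 0
    by_cases hX : InSupport x.1 X.1.vertex.coord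
    · have h1 := crd_map_vec x g X (topFiber k x)
      rw [if_pos ⟨hX, inSupport_topFiber x⟩] at h1
      rw [← homCoeff_eq_zero_iff, ← h1]
      exact (congrArg (crd x X) hg).trans (map_zero _)
    · by_contra h0
      exact hX ((hs X).1 (linked_of_ne_zero h0))
  · rw [← LinearMap.range_eq_top, ← Submodule.ker_mkQ (LinearMap.range _), LinearMap.ker_eq_top]
    refine indec_linearMap_ext x fun X => ?_
    refine (Submodule.Quotient.mk_eq_zero _).2 ?_
    by_cases hX : InSupport x.1 X.coord
    · exact ⟨orbitHom X (topFiber k x), map_orbitHom_gen x hX⟩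
    · rw [vec_eq_zero hX]
      exact zero_mem _

/-- `M(x)` is the representable module `Hom(-, v)`, if `x₁ = f(x_{d+1})`. -/
def yonedaIso : (linearYoneda k (Nak k ℓ d)).obj (topObj k x) ≅ indecModule k x := by
  have : ∀ b, IsIso ((yonedaHom (k := k) x).app b) := fun b =>
    (ConcreteCategory.isIso_iff_bijective _).2 (yonedaHom_bijective hx b)
  exact @asIso _ _ _ _ (yonedaHom x) (NatIso.isIso_of_isIso_app _)

end Yoneda

/-! ### Additive closures through factorisations of the identity -/

section AddClosureLemmas
variable {D : Type*} [Category D] [Preadditive D] [HasFiniteBiproducts D]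

/-- Being a summand of a finite sum amounts to a decomposition `∑ i_s r_s = 1`; together with
`exists_sum_of_addClosure` this avoids manipulating biproducts. -/
theorem addClosure_of_sum {S : Set D} {X : D} {σ : Type*} [Fintype σ] (F : σ → D)
    (hF : ∀ s, F s ∈ S) (i : ∀ s, X ⟶ F s) (r : ∀ s, F s ⟶ X) (h : ∑ s, i s ≫ r s = 𝟙 X) :
    addClosure S X := by
  let e := (Fintype.equivFin σ).symm
  refine ⟨Fintype.card σ, F ∘ e, fun s => hF _, ⟨⟨biproduct.lift fun s => i (e s),
    biproduct.desc fun s => r (e s), ?_⟩⟩⟩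
  rw [biproduct.lift_desc, ← h]
  exact e.sum_comp fun s => i s ≫ r s

theorem exists_sum_of_addClosure {S : Set D} {X : D} (h : addClosure S X) :
    ∃ (m : ℕ) (F : Fin m → D) (i : ∀ s, X ⟶ F s) (r : ∀ s, F s ⟶ X),
      (∀ s, F s ∈ S) ∧ ∑ s, i s ≫ r s = 𝟙 X := by
  obtain ⟨m, F, hF, ⟨ρ⟩⟩ := h
  refine ⟨m, F, fun s => ρ.i ≫ biproduct.π F s, fun s => biproduct.ι F s ≫ ρ.r, hF, ?_⟩
  have : ∑ s, (ρ.i ≫ biproduct.π F s) ≫ biproduct.ι F s ≫ ρ.r =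
      ρ.i ≫ (∑ s, biproduct.π F s ≫ biproduct.ι F s) ≫ ρ.r := by
    simp only [Preadditive.sum_comp, Preadditive.comp_sum, Category.assoc]
  rw [this, biproduct.total, Category.id_comp, ρ.retract]

theorem addClosure_trans {S T : Set D} (h : ∀ X ∈ S, addClosure T X) {X : D}
    (hX : addClosure S X) : addClosure T X := by
  obtain ⟨m, F, i, r, hF, hs⟩ := exists_sum_of_addClosure hX
  choose m' F' i' r' hF' hs' using fun s => exists_sum_of_addClosure (h _ (hF s))
  refine addClosure_of_sum (σ := Σ s, Fin (m' s)) (fun p => F' p.1 p.2) (fun p => hF' p.1 p.2)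
    (fun p => i p.1 ≫ i' p.1 p.2) (fun p => r' p.1 p.2 ≫ r p.1) ?_
  rw [Fintype.sum_sigma, ← hs]
  refine Finset.sum_congr rfl fun s _ => ?_
  have : ∑ t, (i s ≫ i' s t) ≫ r' s t ≫ r s = i s ≫ (∑ t, i' s t ≫ r' s t) ≫ r s := by
    simp only [Preadditive.sum_comp, Preadditive.comp_sum, Category.assoc]
  rw [this, hs', Category.id_comp]

theorem addClosure_mono {S T : Set D} (h : S ⊆ T) {X : D} (hX : addClosure S X) :
    addClosure T X := addClosure_trans (fun _ hX => mem_addClosure (h hX)) hX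

theorem addClosure_of_retract {S : Set D} {X Y : D} (hX : addClosure S X) (ρ : Retract Y X) :
    addClosure S Y := by
  obtain ⟨m, F, hF, ⟨ρ'⟩⟩ := hX
  exact ⟨m, F, hF, ⟨ρ.trans ρ'⟩⟩

end AddClosureLemmas

/-! ### Extending isomorphisms of morphism spaces to additive closures -/

section Transport
variable (k : Type u) [Field k] {D D' : Type*} [Category D] [Category D'] [Preadditive D]
  [Preadditive D'] [Linear k D] [Linear k D'] {J : Type*}

/-- Compatible linear isomorphisms between the morphism spaces of two families of objects. -/
structure HomTransport (X : J → D) (Y : J → D') where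
  e : ∀ a b, (X a ⟶ X b) ≃ₗ[k] (Y a ⟶ Y b)
  map_id : ∀ a, e a a (𝟙 _) = 𝟙 _
  map_comp : ∀ {a b c} (f : X a ⟶ X b) (g : X b ⟶ X c), e a c (f ≫ g) = e a b f ≫ e b c g

variable {k} {X : J → D} {Y : J → D'}

/-- The inverse of a transport of morphisms. -/
def HomTransport.symm (T : HomTransport k X Y) : HomTransport k Y X where
  e a b := (T.e a b).symm
  map_id a := by rw [LinearEquiv.symm_apply_eq, T.map_id]
  map_comp f g := by
    rw [LinearEquiv.symm_apply_eq, T.map_comp, LinearEquiv.apply_symm_apply,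
      LinearEquiv.apply_symm_apply]

/-- Objects `A` and `B` are matched by a transport of morphisms if they are cut out of finite sums
of the `X a` and of the `Y a` by corresponding idempotent matrices. -/
structure Matched (T : HomTransport k X Y) (A : D) (B : D') where
  σ : Type
  fin : Fintype σ
  idx : σ → J
  i : ∀ s, A ⟶ X (idx s)
  r : ∀ s, X (idx s) ⟶ A
  total : ∑ s, i s ≫ r s = 𝟙 A
  i' : ∀ s, B ⟶ Y (idx s)
  r' : ∀ s, Y (idx s) ⟶ B
  total' : ∑ s, i' s ≫ r' s = 𝟙 B
  compat : ∀ s t, T.e _ _ (r s ≫ i t) = r' s ≫ i' t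

attribute [instance] Matched.fin

namespace Matched
variable {T : HomTransport k X Y} {A A₁ A₂ : D} {B B₁ B₂ : D'}

/-- The matching for the inverse transport. -/
def symm (M : Matched T A B) : Matched T.symm B A where
  σ := M.σ
  fin := M.fin
  idx := M.idx
  i := M.i'
  r := M.r'
  total := M.total'
  i' := M.i
  r' := M.r
  total' := M.total
  compat s t := ((T.e _ _).symm_apply_eq).2 (M.compat s t).symm

theorem hom_ext' (M : Matched T A B) (N : Matched T A₁ B₁) {f g : B ⟶ B₁}
    (h : ∀ s t, M.r' s ≫ f ≫ N.i' t = M.r' s ≫ g ≫ N.i' t) : f = g := by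
  have key : ∀ f : B ⟶ B₁,
      f = ∑ s, ∑ t, M.i' s ≫ (M.r' s ≫ f ≫ N.i' t) ≫ N.r' t := by
    intro f
    have : ∑ s, ∑ t, M.i' s ≫ (M.r' s ≫ f ≫ N.i' t) ≫ N.r' t =
        (∑ s, M.i' s ≫ M.r' s) ≫ f ≫ ∑ t, N.i' t ≫ N.r' t := by
      simp only [Preadditive.sum_comp, Preadditive.comp_sum, Category.assoc]
      exact Finset.sum_comm
    rw [this, M.total', N.total', Category.id_comp, Category.comp_id]
  rw [key f, key g]
  simp only [h]

/-- The morphism between matched objects which corresponds to a given one. -/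
def map (M : Matched T A B) (N : Matched T A₁ B₁) : (A ⟶ A₁) →ₗ[k] (B ⟶ B₁) where
  toFun f := ∑ s, ∑ t, M.i' s ≫ T.e _ _ (M.r s ≫ f ≫ N.i t) ≫ N.r' t
  map_add' f g := by
    simp only [Preadditive.add_comp, Preadditive.comp_add, map_add, Finset.sum_add_distrib]
  map_smul' r f := by
    simp only [Linear.smul_comp, Linear.comp_smul, map_smul, Finset.smul_sum, RingHom.id_apply]

/-- The matrix of the image is the transported matrix of `f`: the idempotents on both sides are
absorbed by `compat` and by the decompositions of the identities. -/
theorem comp_map_comp (M : Matched T A B) (N : Matched T A₁ B₁) (f : A ⟶ A₁) (s : M.σ)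
    (t : N.σ) : M.r' s ≫ M.map N f ≫ N.i' t = T.e _ _ (M.r s ≫ f ≫ N.i t) := by
  have h : ∀ s' t', M.r' s ≫ (M.i' s' ≫ T.e _ _ (M.r s' ≫ f ≫ N.i t') ≫ N.r' t') ≫ N.i' t =
      T.e _ _ (M.r s ≫ (M.i s' ≫ M.r s') ≫ f ≫ (N.i t' ≫ N.r t') ≫ N.i t) := by
    intro s' t'
    have e1 : M.r s ≫ (M.i s' ≫ M.r s') ≫ f ≫ (N.i t' ≫ N.r t') ≫ N.i t =
        (M.r s ≫ M.i s') ≫ (M.r s' ≫ f ≫ N.i t') ≫ (N.r t' ≫ N.i t) := by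
      simp only [Category.assoc]
    rw [e1, T.map_comp, T.map_comp, M.compat, N.compat]
    simp only [Category.assoc]
  have e2 : M.r s ≫ f ≫ N.i t =
      M.r s ≫ (∑ s', M.i s' ≫ M.r s') ≫ f ≫ (∑ t', N.i t' ≫ N.r t') ≫ N.i t := by
    rw [M.total, N.total, Category.id_comp, Category.id_comp]
  rw [e2]
  simp only [map, LinearMap.coe_mk, AddHom.coe_mk, Preadditive.sum_comp, Preadditive.comp_sum, h,
    map_sum]
  exact Finset.sum_comm

theorem map_id (M : Matched T A B) : M.map M (𝟙 A) = 𝟙 B := by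
  refine M.hom_ext' M fun s t => ?_
  rw [comp_map_comp, Category.id_comp, Category.id_comp, M.compat]

theorem map_comp (M : Matched T A B) (N : Matched T A₁ B₁) (P : Matched T A₂ B₂) (f : A ⟶ A₁)
    (g : A₁ ⟶ A₂) : M.map P (f ≫ g) = M.map N f ≫ N.map P g := by
  refine M.hom_ext' P fun s u => ?_
  have e1 : M.r' s ≫ (M.map N f ≫ N.map P g) ≫ P.i' u =
      ∑ t, (M.r' s ≫ M.map N f ≫ N.i' t) ≫ (N.r' t ≫ N.map P g ≫ P.i' u) := by
    have : M.r' s ≫ (M.map N f ≫ N.map P g) ≫ P.i' u =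
        M.r' s ≫ M.map N f ≫ (∑ t, N.i' t ≫ N.r' t) ≫ N.map P g ≫ P.i' u := by
      rw [N.total', Category.id_comp, Category.assoc]
    rw [this]
    simp only [Preadditive.sum_comp, Preadditive.comp_sum, Category.assoc]
  have e2 : M.r s ≫ (f ≫ g) ≫ P.i u =
      ∑ t, (M.r s ≫ f ≫ N.i t) ≫ (N.r t ≫ g ≫ P.i u) := by
    have : M.r s ≫ (f ≫ g) ≫ P.i u =
        M.r s ≫ f ≫ (∑ t, N.i t ≫ N.r t) ≫ g ≫ P.i u := by
      rw [N.total, Category.id_comp, Category.assoc]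
    rw [this]
    simp only [Preadditive.sum_comp, Preadditive.comp_sum, Category.assoc]
  rw [e1, comp_map_comp, e2, map_sum]
  refine Finset.sum_congr rfl fun t _ => ?_
  rw [comp_map_comp, comp_map_comp, T.map_comp]

theorem symm_map_map (M : Matched T A B) (N : Matched T A₁ B₁) (f : A ⟶ A₁) :
    M.symm.map N.symm (M.map N f) = f := by
  refine M.symm.hom_ext' N.symm fun s t => ?_
  rw [comp_map_comp]
  refine ((T.e _ _).symm_apply_eq).2 ?_
  exact comp_map_comp M N f s t

/-- The linear isomorphism between the morphism spaces of matched objects. -/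
def mapEquiv (M : Matched T A B) (N : Matched T A₁ B₁) : (A ⟶ A₁) ≃ₗ[k] (B ⟶ B₁) :=
  { M.map N with
    invFun := M.symm.map N.symm
    left_inv := symm_map_map M N
    right_inv := symm_map_map M.symm N.symm }

/-- Two objects matched with the same object are isomorphic. -/
def iso (M : Matched T A B) (N : Matched T A B₁) : B ≅ B₁ where
  hom := M.map N (𝟙 A)
  inv := N.map M (𝟙 A)
  hom_inv_id := by rw [← map_comp, Category.comp_id, map_id]
  inv_hom_id := by rw [← map_comp, Category.comp_id, map_id]

variable (T) in
/-- The members of the two families are matched. -/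
def single (a : J) : Matched T (X a) (Y a) where
  σ := Unit
  fin := inferInstance
  idx _ := a
  i _ := 𝟙 _
  r _ := 𝟙 _
  total := by simp
  i' _ := 𝟙 _
  r' _ := 𝟙 _
  total' := by simp
  compat _ _ := by rw [Category.comp_id, Category.comp_id, T.map_id]

theorem single_map (a b : J) (f : X a ⟶ X b) :
    (single T a).map (single T b) f = T.e a b f := by
  have h := comp_map_comp (single T a) (single T b) f () ()
  exact ((Category.id_comp _).trans (Category.comp_id _)).symm.trans
    (h.trans (congrArg _ ((Category.id_comp _).trans (Category.comp_id _))))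

section Biproducts
variable [HasFiniteBiproducts D] [HasFiniteBiproducts D']

variable (T) in
/-- Finite direct sums of corresponding members of the two families are matched. -/
def biproduct {σ : Type} [Fintype σ] (F : σ → J) :
    Matched T (⨁ fun s => X (F s)) (⨁ fun s => Y (F s)) where
  σ := σ
  fin := inferInstance
  idx := F
  i s := biproduct.π (fun s => X (F s)) s
  r s := biproduct.ι (fun s => X (F s)) s
  total := biproduct.total
  i' s := biproduct.π (fun s => Y (F s)) s
  r' s := biproduct.ι (fun s => Y (F s)) s
  total' := biproduct.total
  compat s t := by
    by_cases h : s = t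
    · subst h
      rw [biproduct.ι_π_self, biproduct.ι_π_self, T.map_id]
    · rw [biproduct.ι_π_ne _ h, biproduct.ι_π_ne _ h, map_zero]

/-- The matrix with entries `r s ≫ i t` is idempotent since the `i s ≫ r s` sum to the identity. Its
transport is an idempotent of the sum of the `Y (F s)`, and `B` splits it. The index range is
recorded to keep track of subfamilies. -/
theorem exists_matched [IsIdempotentComplete D'] (T : HomTransport k X Y) {m : ℕ}
    (F : Fin m → J) (i : ∀ s, A ⟶ X (F s)) (r : ∀ s, X (F s) ⟶ A) (h : ∑ s, i s ≫ r s = 𝟙 A) :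
    ∃ (B : D') (M : Matched T A B), Set.range M.idx = Set.range F := by
  let E : D' := ⨁ fun s => Y (F s)
  let p : E ⟶ E := biproduct.matrix fun s t => T.e _ _ (r s ≫ i t)
  have hp : p ≫ p = p := by
    refine biproduct.hom_ext' _ _ fun s => biproduct.hom_ext _ _ fun u => ?_
    have e1 : (biproduct.ι (fun s => Y (F s)) s ≫ p ≫ p) ≫ biproduct.π (fun s => Y (F s)) u =
        ∑ t, (biproduct.ι (fun s => Y (F s)) s ≫ p ≫ biproduct.π (fun s => Y (F s)) t) ≫ biproduct.ι (fun s => Y (F s)) t ≫ p ≫ biproduct.π (fun s => Y (F s)) u := by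
      have : (biproduct.ι (fun s => Y (F s)) s ≫ p ≫ p) ≫ biproduct.π (fun s => Y (F s)) u = biproduct.ι (fun s => Y (F s)) s ≫ p ≫
          (∑ t, biproduct.π (fun s => Y (F s)) t ≫ biproduct.ι (fun s => Y (F s)) t) ≫ p ≫ biproduct.π (fun s => Y (F s)) u := by
        rw [biproduct.total, Category.id_comp, Category.assoc, Category.assoc]
      rw [this]
      simp only [Preadditive.sum_comp, Preadditive.comp_sum, Category.assoc]
    have e2 : r s ≫ i u = ∑ t, (r s ≫ i t) ≫ (r t ≫ i u) := by
      have : r s ≫ i u = r s ≫ (∑ t, i t ≫ r t) ≫ i u := by rw [h, Category.id_comp]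
      rw [this]
      simp only [Preadditive.sum_comp, Preadditive.comp_sum, Category.assoc]
    have e3 : ∀ s t, biproduct.ι (fun s => Y (F s)) s ≫ p ≫ biproduct.π (fun s => Y (F s)) t = T.e _ _ (r s ≫ i t) := fun s t => by
      simp [p]
    rw [e1, Category.assoc, e3, e2, map_sum]
    simp only [e3, T.map_comp]
  obtain ⟨B, ι, π, h1, h2⟩ := IsIdempotentComplete.idempotents_split E p hp
  refine ⟨B, ⟨Fin m, inferInstance, F, i, r, h, fun s => ι ≫ biproduct.π (fun s => Y (F s)) s,
    fun s => biproduct.ι (fun s => Y (F s)) s ≫ π, ?_, ?_⟩, rfl⟩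
  · have : ∑ s, (ι ≫ biproduct.π (fun s => Y (F s)) s) ≫ biproduct.ι (fun s => Y (F s)) s ≫ π =
        ι ≫ (∑ s, biproduct.π (fun s => Y (F s)) s ≫ biproduct.ι (fun s => Y (F s)) s) ≫ π := by
      simp only [Preadditive.sum_comp, Preadditive.comp_sum, Category.assoc]
    rw [this, biproduct.total, Category.id_comp, h1]
  · intro s t
    have : (biproduct.ι (fun s => Y (F s)) s ≫ π) ≫ ι ≫ biproduct.π (fun s => Y (F s)) t =
        biproduct.ι (fun s => Y (F s)) s ≫ (π ≫ ι) ≫ biproduct.π (fun s => Y (F s)) t := by simp only [Category.assoc]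
    rw [this, h2]
    simp [p]

theorem addClosure_right (M : Matched T A B) : addClosure (Y '' Set.range M.idx) B :=
  addClosure_of_sum _ (fun s => ⟨_, ⟨s, rfl⟩, rfl⟩) M.i' M.r' M.total'

theorem exists_matched_of_addClosure [IsIdempotentComplete D'] (T : HomTransport k X Y) {K : Set J}
    (hA : addClosure (X '' K) A) :
    ∃ B, addClosure (Y '' K) B ∧ Nonempty (Matched T A B) := by
  obtain ⟨m, F, i, r, hF, hs⟩ := exists_sum_of_addClosure hA
  choose G hG hG' using hF
  obtain rfl : F = fun s => X (G s) := funext fun s => (hG' s).symm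
  obtain ⟨B, M, hM⟩ := exists_matched T G i r hs
  refine ⟨B, addClosure_mono (Set.image_mono ?_) M.addClosure_right, ⟨M⟩⟩
  rw [hM]
  rintro _ ⟨s, rfl⟩
  exact hG s

/-- Partners of `A` are unique up to isomorphism, so `B` may be compared with the partner built from
members of `K`. -/
theorem addClosure_image [IsIdempotentComplete D'] (M : Matched T A B) {K : Set J}
    (hA : addClosure (X '' K) A) : addClosure (Y '' K) B := by
  obtain ⟨B', hB', ⟨N⟩⟩ := exists_matched_of_addClosure T hA
  exact addClosure_of_retract hB' (Retract.ofIso (M.iso N))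

end Biproducts
end Matched

/-- A choice of partners gives a functor, fully faithful by `mapEquiv` and essentially surjective by
the inverse transport. The matchings are part of the conclusion, so that the functor can be
identified on the `X a` and on closures of subfamilies. -/
theorem HomTransport.exists_equivalence [HasFiniteBiproducts D] [HasFiniteBiproducts D']
    [IsIdempotentComplete D] [IsIdempotentComplete D'] (T : HomTransport k X Y)
    (Q : ObjectProperty D) (Q' : ObjectProperty D') (hQ : Q = addClosure (Set.range X))
    (hQ' : Q' = addClosure (Set.range Y)) :
    ∃ (E : Q.FullSubcategory ≌ Q'.FullSubcategory), E.functor.Additive ∧ E.functor.Linear k ∧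
      ∃ M : ∀ A : Q.FullSubcategory, Matched T A.obj (E.functor.obj A).obj,
        ∀ (A B : Q.FullSubcategory) (f : A ⟶ B),
          (E.functor.map f).hom = (M A).map (M B) f.hom := by
  subst hQ hQ'
  have h : ∀ A : (addClosure (Set.range X)).FullSubcategory,
      ∃ B : (addClosure (Set.range Y)).FullSubcategory, Nonempty (Matched T A.obj B.obj) := by
    intro A
    obtain ⟨B, hB, hM⟩ := Matched.exists_matched_of_addClosure T (K := Set.univ)
      (by rw [Set.image_univ]; exact A.property)
    rw [Set.image_univ] at hB
    exact ⟨⟨B, hB⟩, hM⟩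
  choose obj M using h
  let M : ∀ A, Matched T A.obj (obj A).obj := fun A => (M A).some
  let F : (addClosure (Set.range X)).FullSubcategory ⥤ (addClosure (Set.range Y)).FullSubcategory :=
    { obj := obj
      map := fun {A B} f => ObjectProperty.homMk ((M A).map (M B) f.hom)
      map_id := fun A => by
        ext
        exact (M A).map_id
      map_comp := fun {A B C} f g => by
        ext
        exact (M A).map_comp (M B) (M C) f.hom g.hom }
  have hfull : F.Full := ⟨fun {A B} g => ⟨ObjectProperty.homMk (((M A).mapEquiv (M B)).symm g.hom),
    by ext; exact ((M A).mapEquiv (M B)).apply_symm_apply g.hom⟩⟩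
  have hfaithful : F.Faithful := ⟨fun {A B} f g h => by
    ext
    exact ((M A).mapEquiv (M B)).injective (congrArg InducedCategory.Hom.hom h)⟩
  have hess : F.EssSurj := ⟨fun B => by
    obtain ⟨A, hA, ⟨N⟩⟩ := Matched.exists_matched_of_addClosure T.symm (K := Set.univ)
      (A := B.obj) (by rw [Set.image_univ]; exact B.property)
    rw [Set.image_univ] at hA
    have i := (M ⟨A, hA⟩).iso N.symm
    exact ⟨⟨A, hA⟩, ⟨ObjectProperty.isoMk _ i⟩⟩⟩
  have hequiv : F.IsEquivalence := {}
  refine ⟨F.asEquivalence, ⟨fun {A B f g} => ?_⟩, ⟨fun {A B} f r => ?_⟩, M, fun A B f => rfl⟩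
  · ext
    exact map_add ((M A).map (M B)) f.hom g.hom
  · ext
    exact map_smul ((M A).map (M B)) r f.hom

end Transport

/-! ### The cycles of the resolution quiver -/

namespace KupischSeries
variable {n : ℕ} (ℓ : KupischSeries n) (d : ℕ)

theorem iterate_f_add_mul (N : ℕ) (i c : ℤ) :
    (ℓ.f d)^[N] (i + c * n) = (ℓ.f d)^[N] i + c * n := by
  induction N with
  | zero => rfl
  | succ N ih => rw [Function.iterate_succ_apply', Function.iterate_succ_apply', ih, f_add_mul]

theorem exists_fbar_iterate (N : ℕ) (i : ℤ) :
    ∃ c : ℤ, (ℓ.fbar d)^[N] i = (ℓ.f d)^[N] i + c * n := by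
  induction N with
  | zero => exact ⟨0, by simp⟩
  | succ N ih =>
    obtain ⟨c, hc⟩ := ih
    rw [Function.iterate_succ_apply', Function.iterate_succ_apply', hc, fbar, f_add_mul]
    refine ⟨c - ((ℓ.f d ((ℓ.f d)^[N] i) + c * n - 1) / n), ?_⟩
    have := Int.emod_add_mul_ediv (ℓ.f d ((ℓ.f d)^[N] i) + c * n - 1) n
    linear_combination this

theorem fbar_mem_Icc (i : ℤ) : ℓ.fbar d i ∈ Set.Icc (1 : ℤ) n := by
  have hn : (0 : ℤ) < n := by exact_mod_cast ℓ.pos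
  have h1 := Int.emod_nonneg (ℓ.f d i - 1) hn.ne'
  have h2 := Int.emod_lt_of_pos (ℓ.f d i - 1) hn
  simp only [fbar, Set.mem_Icc]
  lia

theorem eq_of_mem_Icc {i j c : ℤ} (hi : i ∈ Set.Icc (1 : ℤ) n) (hj : j ∈ Set.Icc (1 : ℤ) n)
    (h : i = j + c * n) : i = j := by
  have hi' := hi.1
  have hi'' := hi.2
  have hj' := hj.1
  have hj'' := hj.2
  have hc : c = 0 := by
    rcases lt_trichotomy c 0 with hc | hc | hc
    · have : c * n ≤ -1 * n := mul_le_mul_of_nonneg_right (by lia) (by simp)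
      lia
    · exact hc
    · have : 1 * (n : ℤ) ≤ c * n := mul_le_mul_of_nonneg_right (by lia) (by simp)
      lia
  rw [h, hc, zero_mul, add_zero]

/-- Replaces `fbar` by `f` and equality by congruence modulo `n`, which makes stability under `f`
visible. -/
theorem mem_cycleLift_iff {i : ℤ} :
    i ∈ ℓ.cycleLift d ↔ ∃ N : ℕ, 0 < N ∧ ∃ c : ℤ, (ℓ.f d)^[N] i = i + c * n := by
  constructor
  · rintro ⟨j, ⟨-, -, N, hN, h⟩, c, rfl⟩
    obtain ⟨c', hc'⟩ := ℓ.exists_fbar_iterate d N j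
    refine ⟨N, hN, -c', ?_⟩
    rw [iterate_f_add_mul]
    linear_combination h - hc'
  · rintro ⟨N, hN, c, h⟩
    have hn : (0 : ℤ) < n := by exact_mod_cast ℓ.pos
    have h0 := Int.emod_add_mul_ediv (i - 1) n
    have h1 := Int.emod_nonneg (i - 1) hn.ne'
    have h2 := Int.emod_lt_of_pos (i - 1) hn
    refine ⟨(i - 1) % n + 1, ⟨by lia, by lia, N, hN, ?_⟩, (i - 1) / n, by linear_combination -h0⟩
    obtain ⟨c', hc'⟩ := ℓ.exists_fbar_iterate d N ((i - 1) % n + 1)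
    -- Both sides lie in `[1, n]` and are congruent modulo `n`.
    refine eq_of_mem_Icc (n := n) (c := c + c') ?_ ⟨by lia, by lia⟩ ?_
    · obtain ⟨M, rfl⟩ := Nat.exists_eq_succ_of_ne_zero hN.ne'
      rw [Function.iterate_succ_apply']
      exact ℓ.fbar_mem_Icc d _
    · have h3 := ℓ.iterate_f_add_mul d N ((i - 1) % n + 1) ((i - 1) / n)
      have h4 : (i - 1) % n + 1 + (i - 1) / n * n = i := by linear_combination h0
      rw [h4] at h3
      linear_combination hc' - h3 + h - h0

theorem cycleLift_add_mul {i : ℤ} (hi : i ∈ ℓ.cycleLift d) (c : ℤ) :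
    i + c * n ∈ ℓ.cycleLift d := by
  obtain ⟨j, hj, e, rfl⟩ := hi
  exact ⟨j, hj, e + c, by ring⟩

theorem f_mem_cycleLift {i : ℤ} (hi : i ∈ ℓ.cycleLift d) : ℓ.f d i ∈ ℓ.cycleLift d := by
  rw [mem_cycleLift_iff] at hi ⊢
  obtain ⟨N, hN, c, h⟩ := hi
  refine ⟨N, hN, c, ?_⟩
  rw [← Function.iterate_succ_apply, Function.iterate_succ_apply', h, f_add_mul]

theorem iterate_f_mul {N : ℕ} {i c : ℤ} (h : (ℓ.f d)^[N] i = i + c * n) (M : ℕ) :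
    (ℓ.f d)^[N * M] i = i + (M * c) * n := by
  induction M with
  | zero => simp
  | succ M ih =>
    rw [Nat.mul_succ, add_comm, Function.iterate_add_apply, ih, iterate_f_add_mul, h]
    push_cast
    ring

/-- If `f i = f j`, the iterates of order `N * M`, the product of the periods, agree, so `i` and `j`
are congruent modulo `n`. As `f` commutes with translation by multiples of `n`, their difference
vanishes. -/
theorem f_injOn_cycleLift : Set.InjOn (ℓ.f d) (ℓ.cycleLift d) := by
  intro i hi j hj hij
  obtain ⟨N, hN, c, h⟩ := (ℓ.mem_cycleLift_iff d).1 hi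
  obtain ⟨M, hM, e, h'⟩ := (ℓ.mem_cycleLift_iff d).1 hj
  have h1 := ℓ.iterate_f_mul d h M
  have h2 := ℓ.iterate_f_mul d h' N
  have h3 : (ℓ.f d)^[N * M] i = (ℓ.f d)^[M * N] j := by
    obtain ⟨K, hK⟩ := Nat.exists_eq_succ_of_ne_zero (Nat.mul_pos hN hM).ne'
    rw [mul_comm M N, hK, Function.iterate_succ_apply, Function.iterate_succ_apply, hij]
  have h4 : j = i + (M * c - N * e) * n := by linear_combination h1 - h2 - h3
  have h5 := ℓ.f_add_mul d i (M * c - N * e)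
  rw [← h4, hij] at h5
  have h6 : ((M * c - N * e : ℤ)) * n = 0 := by linear_combination -h5
  rw [h4, h6, add_zero]

/-- A preimage is the penultimate iterate along the cycle, corrected by a multiple of `n`. -/
theorem f_surjOn_cycleLift : Set.SurjOn (ℓ.f d) (ℓ.cycleLift d) (ℓ.cycleLift d) := by
  intro i hi
  obtain ⟨N, hN, c, h⟩ := (ℓ.mem_cycleLift_iff d).1 hi
  obtain ⟨M, rfl⟩ := Nat.exists_eq_succ_of_ne_zero hN.ne'
  have hM : ∀ M : ℕ, (ℓ.f d)^[M] i ∈ ℓ.cycleLift d := fun M => by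
    induction M with
    | zero => exact hi
    | succ M ih => rw [Function.iterate_succ_apply']; exact ℓ.f_mem_cycleLift d ih
  refine ⟨_, ℓ.cycleLift_add_mul d (hM M) (-c), ?_⟩
  rw [f_add_mul, ← Function.iterate_succ_apply' (ℓ.f d), h]
  ring

theorem cycleSet_nonempty : (ℓ.cycleSet d).Nonempty :=
  Set.nonempty_of_ncard_ne_zero (ℓ.cycleSet_ncard_pos d).ne'

/-- `I` is non-empty, unbounded in both directions by translation, and locally finite as a subset of
`ℤ`. -/
theorem nonempty_orderIso : Nonempty (ℤ ≃o ℓ.cycleLift d) := by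
  classical
  have hn : (0 : ℤ) < n := by exact_mod_cast ℓ.pos
  obtain ⟨j, hj⟩ := ℓ.cycleSet_nonempty d
  have : Nonempty (ℓ.cycleLift d) := ⟨⟨j, j, hj, 0, by simp⟩⟩
  have : NoMaxOrder (ℓ.cycleLift d) := ⟨fun i =>
    ⟨⟨_, ℓ.cycleLift_add_mul d i.2 1⟩, Subtype.mk_lt_mk.2 (by lia)⟩⟩
  have : NoMinOrder (ℓ.cycleLift d) := ⟨fun i =>
    ⟨⟨_, ℓ.cycleLift_add_mul d i.2 (-1)⟩, Subtype.mk_lt_mk.2 (by lia)⟩⟩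
  let : LocallyFiniteOrder (ℓ.cycleLift d) := Subtype.instLocallyFiniteOrder _
  let := LinearLocallyFiniteOrder.succOrder (ℓ.cycleLift d)
  let := LinearLocallyFiniteOrder.predOrder (ℓ.cycleLift d)
  exact ⟨(orderIsoIntOfLinearSuccPredArch (ι := ℓ.cycleLift d)).symm⟩

theorem exists_orderIso_int_eq_add (g : ℤ ≃o ℤ) : ∃ c, ∀ j, g j = j + c := by
  refine ⟨g 0, fun j => ?_⟩
  have h : ∀ j, g (j + 1) = g j + 1 := fun j => g.map_succ j
  induction j with
  | zero => simp
  | succ j ih => rw [h, ih]; ring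
  | pred j ih =>
    have := h (-(j : ℤ) - 1)
    rw [sub_add_cancel, ih] at this
    linear_combination -this

variable {ℓ d} (ι : ℤ ≃o ℓ.cycleLift d)

theorem exists_period : ∃ t : ℤ, ∀ j, (ι (j + t) : ℤ) = ι j + n := by
  let s : ℓ.cycleLift d ≃o ℓ.cycleLift d :=
    { toFun := fun i => ⟨i + n, by simpa using ℓ.cycleLift_add_mul d i.2 1⟩
      invFun := fun i => ⟨i - n, by simpa [sub_eq_add_neg] using ℓ.cycleLift_add_mul d i.2 (-1)⟩
      left_inv := fun i => Subtype.ext (add_sub_cancel_right _ _)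
      right_inv := fun i => Subtype.ext (sub_add_cancel _ _)
      map_rel_iff' := by
        intro a b
        simp [← Subtype.coe_le_coe] }
  obtain ⟨t, ht⟩ := exists_orderIso_int_eq_add (ι.trans (s.trans ι.symm))
  refine ⟨t, fun j => ?_⟩
  rw [← ht j]
  simp [s]

/-- A monotone bijection of `I` is an order automorphism, and those of `ℤ` are translations. -/
theorem exists_f_eq : ∃ g : ℤ, ∀ j, ℓ.f d (ι j) = ι (j - g) := by
  have hs : StrictMono fun i : ℓ.cycleLift d => (⟨ℓ.f d i, ℓ.f_mem_cycleLift d i.2⟩ : ℓ.cycleLift d) :=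
    Monotone.strictMono_of_injective (fun i j h => ℓ.f_mono d h) fun i j h =>
      Subtype.ext (ℓ.f_injOn_cycleLift d i.2 j.2 (congrArg Subtype.val h))
  let s : ℓ.cycleLift d ≃o ℓ.cycleLift d := hs.orderIsoOfSurjective _ fun i => by
    obtain ⟨j, hj, h⟩ := ℓ.f_surjOn_cycleLift d i.2
    exact ⟨⟨j, hj⟩, Subtype.ext h⟩
  obtain ⟨t, ht⟩ := exists_orderIso_int_eq_add (ι.trans (s.trans ι.symm))
  refine ⟨-t, fun j => ?_⟩
  rw [sub_neg_eq_add, ← ht j]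
  simp [s]
  rfl

theorem coe_lt_coe {i j : ℤ} : (ι i : ℤ) < ι j ↔ i < j := by simp

theorem coe_le_coe {i j : ℤ} : (ι i : ℤ) ≤ ι j ↔ i ≤ j := by simp

theorem coe_inj {i j : ℤ} : (ι i : ℤ) = ι j ↔ i = j := by
  rw [Subtype.coe_inj, EmbeddingLike.apply_eq_iff_eq]

theorem ncard_image (s : Set ℤ) : ((fun j => (ι j : ℤ)) '' s).ncard = s.ncard :=
  Set.ncard_image_of_injective _ fun _ _ h => (coe_inj ι).1 h

/-- `J` is a fundamental domain for translation by `n` on `I`: it is the image of the `t`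
consecutive integers starting at the least `m` with `1 ≤ ι m`. -/
theorem period_eq {t : ℤ} (ht : ∀ j, (ι (j + t) : ℤ) = ι j + n) : t = (ℓ.cycleSet d).ncard := by
  have hn : (0 : ℤ) < n := by exact_mod_cast ℓ.pos
  have ht' : ∀ c j : ℤ, (ι (j + c * t) : ℤ) = ι j + c * n := by
    intro c j
    induction c with
    | zero => simp
    | succ c ih =>
      have := ht (j + c * t)
      rw [show j + (c + 1 : ℤ) * t = j + c * t + t by ring, this, ih]
      ring
    | pred c ih =>
      have := ht (j + (-(c : ℤ) - 1) * t)
      rw [show j + (-(c : ℤ) - 1) * t + t = j + -(c : ℤ) * t by ring, ih] at this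
      linear_combination -this
  have hbound := abs_nonneg (ι 0 : ℤ)
  have h1 := le_abs_self (ι 0 : ℤ)
  have h2 := neg_abs_le (ι 0 : ℤ)
  obtain ⟨m, hm, hm'⟩ : ∃ m : ℤ, 1 ≤ (ι m : ℤ) ∧ ∀ j, 1 ≤ (ι j : ℤ) → m ≤ j := by
    -- Since `1 ≤ n`, a shift by `|ι 0| + 1` periods moves `ι 0` below `1`, respectively to at least
    -- `1`.
    refine Int.exists_least_of_bdd (P := fun j => 1 ≤ (ι j : ℤ))
      ⟨0 + (-(|(ι 0 : ℤ)| + 1)) * t, fun j hj => ?_⟩ ⟨0 + (|(ι 0 : ℤ)| + 1) * t, ?_⟩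
    · rw [← coe_le_coe ι, ht']
      nlinarith
    · rw [ht']
      nlinarith
  have hset : ℓ.cycleSet d = (fun j => (ι j : ℤ)) '' Set.Ico m (m + t) := by
    ext i
    constructor
    · intro hi
      obtain ⟨j, hj⟩ := ι.surjective ⟨i, i, hi, 0, by simp⟩
      have hj' : (ι j : ℤ) = i := congrArg Subtype.val hj
      refine ⟨j, ⟨hm' j (by rw [hj']; exact hi.1), ?_⟩, hj'⟩
      rw [← coe_lt_coe ι, ht, hj']
      have := hi.2.1
      lia
    · rintro ⟨j, ⟨h3, h4⟩, rfl⟩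
      rw [← coe_le_coe ι] at h3
      obtain ⟨i, hi, c, hc⟩ := (ι j).2
      have h5 : (ι j : ℤ) ≤ n := by
        by_contra! h
        have h6 := ht (j - t)
        rw [sub_add_cancel] at h6
        have := hm' (j - t) (by lia)
        lia
      simp only
      rwa [eq_of_mem_Icc (n := n) ⟨hm.trans h3, h5⟩ ⟨hi.1, hi.2.1⟩ hc]
  have ht0 : 0 < t := by
    have := ht 0
    rw [zero_add] at this
    rw [← coe_lt_coe ι]
    lia
  rw [hset, ncard_image, Set.ncard_eq_toFinset_card', Set.toFinset_Ico, Int.card_Ico]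
  lia

theorem coe_add_mul (j c : ℤ) : (ι (j + c * (ℓ.cycleSet d).ncard) : ℤ) = ι j + c * n := by
  obtain ⟨t, ht⟩ := exists_period ι
  rw [← period_eq ι ht]
  induction c with
  | zero => simp
  | succ c ih =>
    have := ht (j + c * t)
    rw [show j + (c + 1 : ℤ) * t = j + c * t + t by ring, this, ih]
    ring
  | pred c ih =>
    have := ht (j + (-(c : ℤ) - 1) * t)
    rw [show j + (-(c : ℤ) - 1) * t + t = j + -(c : ℤ) * t by ring, ih] at this
    linear_combination -this

/-- If `f(ι j) = ι(j - g)` for all `j`, the set counted by `newLen` is the image of `[i - g, i]`, so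
`newLen = g + 1 - d`. The index `i` is independent of `j`, which yields the constancy of `newLen`.
-/
theorem f_coe (i j : ℤ) : ℓ.f d (ι j) = ι (j - ℓ.newLen d ι i - d + 1) := by
  obtain ⟨g, hg⟩ := exists_f_eq ι
  have hset : Set.Icc (ℓ.f d (ι i)) (ι i) ∩ ℓ.cycleLift d =
      (fun j => (ι j : ℤ)) '' Set.Icc (i - g) i := by
    ext m
    constructor
    · rintro ⟨⟨h1, h2⟩, hm⟩
      obtain ⟨j, hj⟩ := ι.surjective ⟨m, hm⟩
      obtain rfl : (ι j : ℤ) = m := congrArg Subtype.val hj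
      rw [hg, coe_le_coe] at h1
      rw [coe_le_coe] at h2
      exact ⟨j, ⟨h1, h2⟩, rfl⟩
    · rintro ⟨j, ⟨h1, h2⟩, rfl⟩
      exact ⟨⟨by rw [hg]; exact (coe_le_coe ι).2 h1, (coe_le_coe ι).2 h2⟩, (ι j).2⟩
  have hg0 : 0 ≤ g := by
    have h1 : (ι (i - g) : ℤ) ≤ ι i := by
      rw [← hg]
      have := ℓ.one_le (ι i)
      simp only [f]
      lia
    rw [coe_le_coe] at h1
    lia
  have : ℓ.newLen d ι i = g + 1 - d := by
    rw [newLen, hset, ncard_image, Set.ncard_eq_toFinset_card', Set.toFinset_Icc, Int.card_Icc]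
    lia
  rw [hg, this]
  congr 2
  ring

theorem newLen_eq (i j : ℤ) : ℓ.newLen d ι i = ℓ.newLen d ι j := by
  have h := (f_coe ι i 0).symm.trans (f_coe ι j 0)
  rw [coe_inj] at h
  lia

end KupischSeries

/-! ### Ordered sequences over `I` -/

section Bijection
variable {n : ℕ} {ℓ : KupischSeries n} {d : ℕ} [NeZero d] (ι : ℤ ≃o ℓ.cycleLift d)
  (h : 2 ≤ ℓ.newLen d ι 1)
open KupischSeries

/-- `ι` intertwines the two functions `f`, through which ordered sequences and projectivity are
expressed. -/
theorem coe_newSeries_f (j : ℤ) : (ι ((ℓ.newSeries d ι h).f d j) : ℤ) = ℓ.f d (ι j) := by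
  rw [f_coe ι 1]
  rfl

theorem isOS_newSeries_iff (x : Fin (d + 1) → ℤ) :
    IsOS (ℓ.newSeries d ι h).len x ↔ IsOS ℓ.len (fun i => (ι (x i) : ℤ)) := by
  rw [isOS_iff_f, isOS_iff_f, ← coe_newSeries_f ι h, coe_le_coe]
  refine and_congr_left fun _ => ⟨fun hx i j hij => (coe_lt_coe ι).2 (hx hij), fun hx i j hij =>
    (coe_lt_coe ι).1 (hx hij)⟩

/-- The bijection between the ordered sequences for `ℓ'` and those for `ℓ` with all coordinates
in `I`. -/
def osEquiv : OS (ℓ.newSeries d ι h).len (d + 1) ≃ OSI ℓ d where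
  toFun x := ⟨⟨fun i => ι (x.1 i), (isOS_newSeries_iff ι h _).1 x.2⟩, fun i => (ι (x.1 i)).2⟩
  invFun x := ⟨fun i => ι.symm ⟨x.1.1 i, x.2 i⟩, by
    rw [isOS_newSeries_iff ι h]
    simpa using x.1.2⟩
  left_inv x := by ext; simp
  right_inv x := by ext; simp

theorem osEquiv_apply (x : OS (ℓ.newSeries d ι h).len (d + 1)) (i : Fin (d + 1)) :
    (osEquiv ι h x).1.1 i = ι (x.1 i) := rfl

/-- Translation by `c n` on `I` is translation by `c n'` on indices, so the relation is respected in
every degree `c`. -/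
theorem prec_osEquiv_iff (x y : OS (ℓ.newSeries d ι h).len (d + 1)) (c : ℤ) :
    Prec (osEquiv ι h x).1.1 (fun i => (osEquiv ι h y).1.1 i - c * n) ↔
      Prec x.1 (fun i => y.1 i - c * (ℓ.cycleSet d).ncard) := by
  have : ∀ i, (osEquiv ι h y).1.1 i - c * n = ι (y.1 i - c * (ℓ.cycleSet d).ncard) := fun i => by
    have := coe_add_mul ι (y.1 i) (-c)
    rw [osEquiv_apply, sub_eq_add_neg, ← neg_mul, ← this, neg_mul, sub_eq_add_neg]
  have e : (fun i => (osEquiv ι h y).1.1 i - c * n) =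
      fun i => (ι (y.1 i - c * (ℓ.cycleSet d).ncard) : ℤ) := funext this
  rw [e]
  unfold Prec
  simp only [osEquiv_apply, coe_le_coe, coe_lt_coe]

theorem f_osEquiv_iff (x : OS (ℓ.newSeries d ι h).len (d + 1)) :
    ℓ.f d ((osEquiv ι h x).1.1 ⊤) = (osEquiv ι h x).1.1 0 ↔
      (ℓ.newSeries d ι h).f d (x.1 ⊤) = x.1 0 := by
  rw [osEquiv_apply, osEquiv_apply, ← coe_newSeries_f ι h, coe_inj]

end Bijection

/-! ### Local rings from trivial idempotents -/

section Fitting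
open Polynomial

/-- Write the minimal polynomial of `a` as `X^m q` with `q` prime to `X`. A Bézout relation between
`X^(m+1)` and `q` yields an idempotent in `k[a]`: if it is `0` then `a^m = 0`, and if it is `1` then
`a` is invertible. -/
theorem isUnit_or_isNilpotent (k : Type*) {E : Type*} [Field k] [Ring E] [Algebra k E]
    [Module.Finite k E] 
    (h : ∀ e : E, e * e = e → e = 0 ∨ e = 1) (a : E) :
    IsUnit a ∨ IsNilpotent a := by
  have hint : IsIntegral k a := IsIntegral.of_finite k a
  obtain ⟨q, hq, hdvd⟩ := exists_eq_pow_rootMultiplicity_mul_and_not_dvd (minpoly k a)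
    (minpoly.ne_zero hint) 0
  rw [map_zero, sub_zero] at hq hdvd
  set m := rootMultiplicity 0 (minpoly k a)
  -- The exponent `m + 1` leaves a factor `a` to be inverted even if `m = 0`.
  have hcop : IsCoprime (X ^ (m + 1)) q := ((irreducible_X.coprime_iff_not_dvd).2 hdvd).pow_left
  obtain ⟨s, t, hst⟩ := hcop
  have hz : a ^ m * aeval a q = 0 := by
    have := minpoly.aeval k a
    rwa [hq, map_mul, map_pow, aeval_X] at this
  have h1 : aeval a s * a ^ (m + 1) + aeval a t * aeval a q = 1 := by
    have := congrArg (aeval a) hst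
    simpa using this
  have hcomm : ∀ p r : k[X], aeval a p * aeval a r = aeval a r * aeval a p := fun p r => by
    rw [← map_mul, mul_comm, map_mul]
  have hcs : aeval a s * a = a * aeval a s := by simpa using hcomm s X
  have hct : aeval a t * aeval a q = aeval a q * aeval a t := hcomm t q
  have hidem : (aeval a s * a ^ (m + 1)) * (aeval a s * a ^ (m + 1)) =
      aeval a s * a ^ (m + 1) := by
    have h2 : aeval a s * a ^ (m + 1) = 1 - aeval a t * aeval a q := eq_sub_of_add_eq h1
    have h3 : (aeval a s * a ^ (m + 1)) * (aeval a t * aeval a q) = 0 := by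
      have : aeval a s * a ^ (m + 1) * (aeval a t * aeval a q) =
          aeval a s * a * (a ^ m * aeval a q) * aeval a t := by
        rw [hct, pow_succ']
        simp only [mul_assoc]
      rw [this, hz, mul_zero, zero_mul]
    conv_lhs => rw [mul_assoc]
    rw [← mul_assoc]
    conv_lhs => rhs; rw [h2]
    rw [mul_sub, mul_one, h3, sub_zero]
  rcases h _ hidem with h0 | h0
  · right
    refine ⟨m, ?_⟩
    rw [h0, zero_add] at h1
    have : a ^ m * (aeval a q * aeval a t) = 0 := by rw [← mul_assoc, hz, zero_mul]
    rwa [← hct, h1, mul_one] at this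
  · left
    refine isUnit_iff_exists.2 ⟨aeval a s * a ^ m, ?_, ?_⟩
    · rw [← mul_assoc, ← hcs, mul_assoc, ← pow_succ', h0]
    · rw [mul_assoc, ← pow_succ, h0]

theorem isLocalRing_of_idempotents (k : Type*) {E : Type*} [Field k] [Ring E] [Algebra k E]
    [Module.Finite k E] [Nontrivial E]
    (h : ∀ e : E, e * e = e → e = 0 ∨ e = 1) :
    IsLocalRing E where
  isUnit_or_isUnit_of_add_one {a b} hab := by
    rcases isUnit_or_isNilpotent k h a with ha | ha
    · exact Or.inl ha
    · right
      rw [eq_sub_of_add_eq' hab]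
      exact ha.isUnit_one_sub

end Fitting

/-! ### Krull-Schmidt and basic additive generators -/

section KrullSchmidt
variable {D : Type*} [Category D] [Preadditive D]

/-- All idempotent endomorphisms of `X` are trivial. -/
def TrivialIdempotents (X : D) : Prop := ∀ e : X ⟶ X, e ≫ e = e → e = 0 ∨ e = 𝟙 X

theorem TrivialIdempotents.indecomposable [HasBinaryBiproducts D] {X : D}
    (h : TrivialIdempotents X) (h0 : ¬ IsZero X) : Indecomposable X := by
  refine ⟨h0, fun Y Z i => ?_⟩
  have hY : biprod.inl ≫ i.inv ≫ i.hom ≫ (biprod.fst : Y ⊞ Z ⟶ Y) = 𝟙 Y := by simp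
  have hZ : biprod.inr ≫ i.inv ≫ i.hom ≫ (biprod.snd : Y ⊞ Z ⟶ Z) = 𝟙 Z := by simp
  rcases h (i.hom ≫ biprod.fst ≫ biprod.inl ≫ i.inv) (by simp) with h | h
  · left
    rw [IsZero.iff_id_eq_zero]
    have := congrArg (fun e => (biprod.inl ≫ i.inv) ≫ e ≫ i.hom ≫ biprod.fst) h
    simpa using this
  · right
    rw [IsZero.iff_id_eq_zero]
    have := congrArg (fun e => (biprod.inr ≫ i.inv) ≫ e ≫ i.hom ≫ biprod.snd) h
    simpa using this.symm

/-- Splitting both `e` and `1 - e` writes `X` as the direct sum of their images, one of which must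
be zero. -/
theorem _root_.CategoryTheory.Indecomposable.trivialIdempotents [HasBinaryBiproducts D]
    [IsIdempotentComplete D] {X : D} (h : Indecomposable X) : TrivialIdempotents X := by
  intro e he
  obtain ⟨Y, i, p, h1, h2⟩ := IsIdempotentComplete.idempotents_split X e he
  obtain ⟨Z, j, q, h3, h4⟩ := IsIdempotentComplete.idempotents_split X (𝟙 X - e) (by
    simp [he])
  have hiq : i ≫ q = 0 := by
    have h5 : i ≫ (𝟙 X - e) = 0 := by
      rw [Preadditive.comp_sub, Category.comp_id, ← h2, ← Category.assoc, h1, Category.id_comp,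
        sub_self]
    have h6 : (i ≫ q) ≫ j ≫ q = 0 := by
      rw [Category.assoc, ← Category.assoc q, h4, ← Category.assoc, h5, zero_comp]
    rwa [h3, Category.comp_id] at h6
  have hjp : j ≫ p = 0 := by
    have h5 : j ≫ e = 0 := by
      have : e = 𝟙 X - q ≫ j := by rw [h4]; abel
      rw [this, Preadditive.comp_sub, Category.comp_id, ← Category.assoc, h3, Category.id_comp,
        sub_self]
    have h6 : (j ≫ p) ≫ i ≫ p = 0 := by
      rw [Category.assoc, ← Category.assoc p, h2, ← Category.assoc, h5, zero_comp]
    rwa [h1, Category.comp_id] at h6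
  let φ : X ≅ Y ⊞ Z :=
    { hom := biprod.lift p q
      inv := biprod.desc i j
      hom_inv_id := by rw [biprod.lift_desc, h2, h4]; abel
      inv_hom_id := by
        apply biprod.hom_ext' <;> apply biprod.hom_ext <;> simp [h1, h3, hiq, hjp] }
  rcases h.2 Y Z φ with h | h
  · left
    rw [← h2, h.eq_zero_of_tgt p, zero_comp]
  · right
    rw [h.eq_zero_of_tgt q, zero_comp] at h4
    exact (sub_eq_zero.1 h4.symm).symm

theorem TrivialIdempotents.iso_of_retract {F X : D} (h : TrivialIdempotents X) (h0 : ¬ IsZero F)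
    (i : F ⟶ X) (r : X ⟶ F) (hir : i ≫ r = 𝟙 F) : Nonempty (F ≅ X) := by
  rcases h (r ≫ i) (by rw [Category.assoc, ← Category.assoc i, hir, Category.id_comp]) with h | h
  · refine absurd ((IsZero.iff_id_eq_zero F).2 ?_) h0
    have : 𝟙 F = (i ≫ r) ≫ (i ≫ r) := by rw [hir, Category.comp_id]
    rw [this, Category.assoc, ← Category.assoc r, h, zero_comp, comp_zero]
  · exact ⟨⟨i, r, hir, h⟩⟩

variable (k : Type*) [Field k] [Linear k D]

/-- `End F` embeds into matrices of morphisms between the `X s`, so it is finite-dimensional and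
hence local. Some term of `∑ i s ≫ r s = 1` is then a unit, which makes `F` a non-zero retract of
that `X s`. -/
theorem exists_iso_of_indecomposable [HasBinaryBiproducts D] [IsIdempotentComplete D] {F : D}
    (hF : Indecomposable F) {σ : Type*} [Fintype σ] (X : σ → D)
    (hX : ∀ s, TrivialIdempotents (X s)) (hfin : ∀ s t, Module.Finite k (X s ⟶ X t))
    (i : ∀ s, F ⟶ X s) (r : ∀ s, X s ⟶ F) (h : ∑ s, i s ≫ r s = 𝟙 F) :
    ∃ s, Nonempty (F ≅ X s) := by
  have hfinF : Module.Finite k (End F) := by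
    let m : End F →ₗ[k] ∀ s t, (X s ⟶ X t) :=
      { toFun := fun f s t => r s ≫ f ≫ i t
        map_add' := fun f g => by
          funext s t
          exact (congrArg (r s ≫ ·) (Preadditive.add_comp _ _ _ f g (i t))).trans
            (Preadditive.comp_add _ _ _ _ _ _)
        map_smul' := fun c f => by
          funext s t
          exact (congrArg (r s ≫ ·) (Linear.smul_comp _ _ _ c f (i t))).trans
            (Linear.comp_smul _ _ _ _ _ _) }
    refine Module.Finite.of_injective m ((injective_iff_map_eq_zero m).2 fun f hf => ?_)
    have key : (f : F ⟶ F) = ∑ s, ∑ t, i s ≫ (r s ≫ f ≫ i t) ≫ r t := by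
      have : ∑ s, ∑ t, i s ≫ (r s ≫ f ≫ i t) ≫ r t =
          (∑ s, i s ≫ r s) ≫ f ≫ ∑ t, i t ≫ r t := by
        simp only [Preadditive.sum_comp, Preadditive.comp_sum, Category.assoc]
        exact Finset.sum_comm
      rw [this, h, Category.id_comp, Category.comp_id]
    have h0 : ∀ s t, r s ≫ f ≫ i t = 0 := fun s t => congrFun (congrFun hf s) t
    simp only [h0, zero_comp, comp_zero, Finset.sum_const_zero] at key
    exact key
  have hnt : Nontrivial (End F) := ⟨⟨1, 0, fun e => hF.1 ((IsZero.iff_id_eq_zero F).2 e)⟩⟩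
  have hloc : IsLocalRing (End F) :=
    isLocalRing_of_idempotents k fun e he => hF.trivialIdempotents e he
  let g : σ → End F := fun s => i s ≫ r s
  have hu : IsUnit (∑ s, g s) := by
    have : ∑ s, g s = 1 := h
    rw [this]
    exact isUnit_one
  obtain ⟨s, -, hs⟩ := IsLocalRing.exists_of_isUnit_sum hu
  obtain ⟨v, hv, -⟩ := isUnit_iff_exists.1 hs
  refine ⟨s, (hX s).iso_of_retract hF.1 (v ≫ i s) (r s) ?_⟩
  rw [Category.assoc]
  exact hv

variable [HasFiniteBiproducts D] [HasBinaryBiproducts D] [IsIdempotentComplete D]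

/-- Let `Z` be a finite family of non-zero objects with trivial idempotents, none of which is a
direct summand of a sum of copies of the other ones. Then `⨁ Z` is, up to isomorphism, the unique
basic additive generator of the additive closure of `Z`. -/
theorem isBasicAdditiveGenerator_iff {K : Type} [Finite K] (Z : K → D)
    (hZ : ∀ a, TrivialIdempotents (Z a)) (hZ0 : ∀ a, ¬ IsZero (Z a))
    (hfin : ∀ a b, Module.Finite k (Z a ⟶ Z b))
    (hret : ∀ (a : K) (S : Set K), addClosure (Z '' S) (Z a) → a ∈ S) :
    (∃ P, IsBasicAdditiveGenerator (addClosure (Set.range Z)) P) ∧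
    ∀ P, IsBasicAdditiveGenerator (addClosure (Set.range Z)) P → Nonempty (P ≅ ⨁ Z) := by
  have : Fintype K := Fintype.ofFinite K
  have hretract : ∀ {σ : Type} [Fintype σ] (F : σ → D) (s : σ), addClosure {⨁ F} (F s) :=
    fun F s => addClosure_of_retract (mem_addClosure rfl)
      ⟨biproduct.ι F s, biproduct.π F s, biproduct.ι_π_self F s⟩
  constructor
  · let e := (Fintype.equivFin K).symm
    refine ⟨⨁ (Z ∘ e), funext fun X => propext ⟨fun h => addClosure_trans ?_ h,
      fun h => addClosure_trans ?_ h⟩, Fintype.card K, Z ∘ e,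
      fun s => (hZ _).indecomposable (hZ0 _), fun s t ⟨i⟩ => ?_, ⟨Iso.refl _⟩⟩
    · rintro _ ⟨a, rfl⟩
      have := hretract (Z ∘ e) (e.symm a)
      simpa using this
    · rintro _ rfl
      exact addClosure_of_sum (Z ∘ e) (fun s => ⟨_, rfl⟩) (biproduct.π _) (biproduct.ι _)
        biproduct.total
    · refine e.injective (hret (e s) {e t} ?_)
      rw [Set.image_singleton]
      exact addClosure_of_retract (mem_addClosure rfl) (Retract.ofIso i)
  -- Each summand of `P` is isomorphic to some `Z a`. The resulting map of indices is injective
  -- because the summands are pairwise non-isomorphic, and surjective by `hret`.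
  · rintro P ⟨hP, m, F, hF, hFF, ⟨φ⟩⟩
    have h1 : ∀ s, ∃ a, Nonempty (F s ≅ Z a) := by
      intro s
      have : addClosure (Set.range Z) (F s) := by
        rw [hP]
        exact addClosure_trans (fun X hX => by
          rw [Set.mem_singleton_iff.1 hX]
          exact addClosure_of_retract (mem_addClosure rfl) (Retract.ofIso φ.symm)) (hretract F s)
      obtain ⟨m', G, i, r, hG, hs⟩ := exists_sum_of_addClosure this
      choose b hb using hG
      obtain rfl : Z ∘ b = G := funext hb
      obtain ⟨t, ht⟩ := exists_iso_of_indecomposable k (hF s) (Z ∘ b) (fun _ => hZ _)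
        (fun _ _ => hfin _ _) i r hs
      exact ⟨b t, ht⟩
    choose b hb using h1
    have hinj : Function.Injective b := fun s t hst =>
      hFF s t ⟨(hb s).some ≪≫ eqToIso (congrArg Z hst) ≪≫ (hb t).some.symm⟩
    have hsurj : Function.Surjective b := by
      intro a
      refine hret a (Set.range b) ?_
      have h2 : addClosure {P} (Z a) := by
        rw [← hP]
        exact mem_addClosure ⟨a, rfl⟩
      refine addClosure_trans (fun X hX => ?_) h2
      rw [Set.mem_singleton_iff.1 hX]
      refine addClosure_of_retract ?_ (Retract.ofIso φ)
      refine addClosure_of_sum (fun s => Z (b s)) (fun s => ⟨_, ⟨s, rfl⟩, rfl⟩)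
        (fun s => biproduct.π F s ≫ (hb s).some.hom) (fun s => (hb s).some.inv ≫ biproduct.ι F s) ?_
      simp [biproduct.total]
    exact ⟨φ ≪≫ biproduct.whiskerEquiv (Equiv.ofBijective b ⟨hinj, hsurj⟩)
      fun s => (hb s).some.symm⟩

end KrullSchmidt

/-! ### The grading of morphisms by `c` -/

section Composition
variable {k : Type u} [Field k] {n : ℕ} {ℓ : KupischSeries n} {d : ℕ} [NeZero d]
variable {x y z : OS ℓ.len (d + 1)}

theorem comp_eq_sum (φ : indecModule k x ⟶ indecModule k y) (ψ : indecModule k y ⟶ indecModule k z) :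
    φ ≫ ψ = ∑ c ∈ precFinset x y, ∑ e ∈ precFinset y z,
      (indecCoeff x y φ c * indecCoeff y z ψ e) • indecHom k x z (c + e) := by
  conv_lhs => rw [eq_sum_indecHom φ, eq_sum_indecHom ψ]
  simp only [Preadditive.sum_comp, Preadditive.comp_sum, Linear.smul_comp, Linear.comp_smul,
    Finset.smul_sum, smul_smul]
  rw [Finset.sum_comm]
  refine Finset.sum_congr rfl fun c hc => Finset.sum_congr rfl fun e he => ?_
  rw [indecHom_comp (mem_precFinset.1 hc) (mem_precFinset.1 he), mul_comm]

/-- `c` is a degree which adds under composition. -/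
theorem exists_of_indecCoeff_comp_ne_zero {φ : indecModule k x ⟶ indecModule k y}
    {ψ : indecModule k y ⟶ indecModule k z} {m : ℤ} (h : indecCoeff x z (φ ≫ ψ) m ≠ 0) :
    ∃ c e, c + e = m ∧ indecCoeff x y φ c ≠ 0 ∧ indecCoeff y z ψ e ≠ 0 := by
  classical
  by_contra! H
  refine h ?_
  rw [comp_eq_sum, map_sum, Finset.sum_apply]
  refine Finset.sum_eq_zero fun c _ => ?_
  rw [map_sum, Finset.sum_apply]
  refine Finset.sum_eq_zero fun e _ => ?_
  rw [map_smul, Pi.smul_apply, indecCoeff_indecHom, smul_eq_mul]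
  by_cases hm : c + e = m
  · by_cases hc : indecCoeff x y φ c = 0
    · rw [hc, zero_mul, zero_mul]
    · rw [H c e hm hc, mul_zero, zero_mul]
  · rw [if_neg fun h => hm h.1, mul_zero]

theorem prec_of_indecCoeff_ne_zero {φ : indecModule k x ⟶ indecModule k y} {c : ℤ}
    (h : indecCoeff x y φ c ≠ 0) : Prec x.1 (fun i => y.1 i - c * n) := by
  by_contra h'
  exact h (indecCoeff_eq_zero φ h')

theorem prec_self_zero (x : OS ℓ.len (d + 1)) : Prec x.1 (fun i => x.1 i - 0 * n) := by
  simp only [zero_mul, sub_zero]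
  exact ⟨fun i => le_rfl, fun i j h => x.2.1 (Fin.lt_def.2 (by lia))⟩

theorem nonpos_of_prec_self {c : ℤ} (h : Prec x.1 (fun i => x.1 i - c * n)) : c ≤ 0 := by
  have hn : (0 : ℤ) < n := by exact_mod_cast ℓ.pos
  have := h.1 0
  by_contra! hc
  have := mul_pos hc hn
  simp only at *
  lia

theorem indecCoeff_id_zero (x : OS ℓ.len (d + 1)) :
    indecCoeff x x (𝟙 (indecModule k x)) 0 = 1 := by
  rw [← indecHom_id, indecCoeff_indecHom, if_pos ⟨rfl, prec_self_zero x⟩]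

theorem not_isZero_indecModule (x : OS ℓ.len (d + 1)) : ¬ IsZero (indecModule k x) := fun h => by
  have := indecCoeff_id_zero (k := k) x
  rw [(IsZero.iff_id_eq_zero _).1 h, map_zero] at this
  exact zero_ne_one this

/-- Endomorphisms of `M(x)` live in degrees `c ≤ 0`, and two such degrees add up to zero only if
both are zero. -/
theorem indecCoeff_comp_zero (φ ψ : indecModule k x ⟶ indecModule k x) :
    indecCoeff x x (φ ≫ ψ) 0 = indecCoeff x x φ 0 * indecCoeff x x ψ 0 := by
  have h0 : (0 : ℤ) ∈ precFinset x x := mem_precFinset.2 (prec_self_zero x)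
  have hle : ∀ {c : ℤ}, c ∈ precFinset x x → c ≤ 0 := fun hc =>
    nonpos_of_prec_self (mem_precFinset.1 hc)
  rw [comp_eq_sum, map_sum, Finset.sum_apply, Finset.sum_eq_single 0, map_sum, Finset.sum_apply,
    Finset.sum_eq_single 0]
  · rw [map_smul, Pi.smul_apply, indecCoeff_indecHom, if_pos ⟨by simp, prec_self_zero x⟩,
      smul_eq_mul, mul_one]
  · intro e he hne
    rw [map_smul, Pi.smul_apply, indecCoeff_indecHom, if_neg (by simpa using fun h => absurd h hne),
      smul_zero]
  · exact fun h => absurd h0 h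
  · intro c hc hne
    rw [map_sum, Finset.sum_apply]
    refine Finset.sum_eq_zero fun e he => ?_
    rw [map_smul, Pi.smul_apply, indecCoeff_indecHom, if_neg, smul_zero]
    have h1 := hle hc
    have h2 := hle he
    exact fun h => hne (by lia)
  · exact fun h => absurd h0 h

/-- Without a part of degree zero, the top degree `m` of `φ ≠ 0` is negative, while `φ ≫ φ` has
degrees at most `2m < m` only. -/
theorem eq_zero_of_comp_self {φ : indecModule k x ⟶ indecModule k x} (h : φ ≫ φ = φ)
    (h0 : indecCoeff x x φ 0 = 0) : φ = 0 := by
  by_contra hφ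
  have hne : {c | indecCoeff x x φ c ≠ 0}.Nonempty := by
    by_contra hemp
    refine hφ (indecCoeff_injective x x (funext fun c => ?_))
    rw [map_zero]
    by_contra hc
    exact hemp ⟨c, hc⟩
  have hfin : {c | indecCoeff x x φ c ≠ 0}.Finite :=
    (finite_prec x x).subset fun c hc => prec_of_indecCoeff_ne_zero hc
  obtain ⟨m, hm, hmax⟩ := hfin.exists_maximal hne
  have hmneg : m < 0 := lt_of_le_of_ne (nonpos_of_prec_self (prec_of_indecCoeff_ne_zero hm))
    fun h => hm (h ▸ h0)
  have hm' := hm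
  rw [Set.mem_ofPred_eq, ← h] at hm'
  obtain ⟨c, e, hce, hc, he⟩ := exists_of_indecCoeff_comp_ne_zero hm'
  have hle : ∀ c, indecCoeff x x φ c ≠ 0 → c ≤ m := fun c hc => by
    rcases le_total m c with h' | h'
    · exact hmax hc h'
    · exact h'
  have h1 := hle c hc
  have h2 := hle e he
  lia

theorem trivialIdempotents_indecModule (x : OS ℓ.len (d + 1)) :
    TrivialIdempotents (indecModule k x) := by
  intro e he
  have h0 : indecCoeff x x e 0 * indecCoeff x x e 0 = indecCoeff x x e 0 := by
    rw [← indecCoeff_comp_zero, he]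
  rcases (IsIdempotentElem.iff_eq_zero_or_one (p := indecCoeff x x e 0)).1 h0 with h | h
  · exact Or.inl (eq_zero_of_comp_self he h)
  · right
    have := eq_zero_of_comp_self (φ := 𝟙 _ - e) (by simp [he]) (by
      rw [map_sub, Pi.sub_apply, indecCoeff_id_zero, h, sub_self])
    exact (sub_eq_zero.1 this).symm

/-- The identity has coefficient `1` in degree zero, so some composite `M(x) ⟶ M(y) ⟶ M(x)`
contributes there, in degrees `c` and `-c`. The two relations give opposite inequalities in every
coordinate. -/
theorem exists_shift_of_addClosure {K : Set (OS ℓ.len (d + 1))}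
    (h : addClosure (indecModule k '' K) (indecModule k x)) :
    ∃ y ∈ K, ∃ c : ℤ, ∀ i, x.1 i = y.1 i - c * n := by
  obtain ⟨m, F, i, r, hF, hs⟩ := exists_sum_of_addClosure h
  choose y hy hyF using hF
  obtain rfl : (fun s => indecModule k (y s)) = F := funext hyF
  have h1 := indecCoeff_id_zero (k := k) x
  rw [← hs, map_sum, Finset.sum_apply] at h1
  obtain ⟨s, -, hs'⟩ := Finset.exists_ne_zero_of_sum_ne_zero (h1.trans_ne one_ne_zero)
  obtain ⟨c, e, hce, hc, he⟩ := exists_of_indecCoeff_comp_ne_zero hs'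
  obtain rfl : e = -c := by lia
  refine ⟨y s, hy s, c, fun j => ?_⟩
  have h2 := (prec_of_indecCoeff_ne_zero hc).1 j
  have h3 := (prec_of_indecCoeff_ne_zero he).1 j
  simp only at h2 h3
  lia

instance (x y : OS ℓ.len (d + 1)) : Module.Finite k (indecModule k x ⟶ indecModule k y) := by
  refine Module.Finite.of_injective
    (LinearMap.funLeft k k (Subtype.val : precFinset x y → ℤ) ∘ₗ indecCoeff x y)
    fun φ ψ h => indecCoeff_injective x y (funext fun c => ?_)
  by_cases hc : Prec x.1 (fun i => y.1 i - c * n)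
  · exact congrFun h ⟨c, mem_precFinset.2 hc⟩
  · rw [indecCoeff_eq_zero φ hc, indecCoeff_eq_zero ψ hc]

open Classical in
theorem indecCoeff_sum (g : ℤ → k) (e : ℤ) :
    indecCoeff x y (∑ c ∈ precFinset x y, g c • indecHom k x y c) e =
      if Prec x.1 (fun i => y.1 i - e * n) then g e else 0 := by
  rw [map_sum, Finset.sum_apply]
  simp only [map_smul, Pi.smul_apply, indecCoeff_indecHom, smul_eq_mul]
  by_cases he : Prec x.1 (fun i => y.1 i - e * n)
  · rw [Finset.sum_eq_single e]
    · simp [he]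
    · intro c _ hc
      simp [hc]
    · exact fun h => absurd (mem_precFinset.2 he) h
  · simp [he]

end Composition

/-! ### The projective objects of `𝒲` -/

section Projective
variable {k : Type u} [Field k] {n : ℕ} {ℓ : KupischSeries n} {d : ℕ} [NeZero d]

theorem isProj_iff (x : OS ℓ.len (d + 1)) :
    x.1 ⊤ - x.1 0 + 1 = ℓ.len (x.1 ⊤) + d ↔ ℓ.f d (x.1 ⊤) = x.1 0 := by
  simp only [KupischSeries.f]
  lia

theorem update_top (x : Fin (d + 1) → ℤ) (a : ℤ) : Function.update x 0 a ⊤ = x ⊤ :=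
  Function.update_of_ne (by rw [top_eq_succ_top]; exact Fin.succ_ne_zero _) _ _

/-- `M(lower x)` is the projective cover of `M(x)`. -/
def lower (x : OS ℓ.len (d + 1)) : OS ℓ.len (d + 1) :=
  ⟨Function.update x.1 0 (ℓ.f d (x.1 ⊤)), by
    have hx := (isOS_iff_f x.1).1 x.2
    rw [isOS_iff_f, update_top, Function.update_self]
    refine ⟨fun i j hij => ?_, le_rfl⟩
    have hj : j ≠ 0 := (lt_of_le_of_lt (Fin.zero_le i) hij).ne'
    rw [Function.update_of_ne hj]
    by_cases hi : i = 0
    · subst hi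
      rw [Function.update_self]
      exact hx.2.trans_lt (hx.1 hij)
    · rw [Function.update_of_ne hi]
      exact hx.1 hij⟩

variable {x y : OS ℓ.len (d + 1)}

theorem lower_zero : (lower x).1 0 = ℓ.f d (x.1 ⊤) := by
  simp [lower]

theorem lower_of_ne {i : Fin (d + 1)} (h : i ≠ 0) : (lower x).1 i = x.1 i :=
  Function.update_of_ne h _ _

theorem lower_le (i : Fin (d + 1)) : (lower x).1 i ≤ x.1 i := by
  by_cases hi : i = 0
  · subst hi
    rw [lower_zero]
    exact ((isOS_iff_f x.1).1 x.2).2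
  · rw [lower_of_ne hi]

theorem f_lower (x : OS ℓ.len (d + 1)) : ℓ.f d ((lower x).1 ⊤) = (lower x).1 0 := by
  rw [lower_zero, show (lower x).1 ⊤ = x.1 ⊤ from update_top _ _]

theorem lower_prec (x : OS ℓ.len (d + 1)) : Prec (lower x).1 (fun i => x.1 i - 0 * n) := by
  have h := prec_self_zero x
  refine ⟨fun i => (lower_le i).trans (h.1 i), fun i j hij => ?_⟩
  rw [lower_of_ne (fun h => by subst h; simp at hij)]
  exact h.2 i j hij

/-- Only the first coordinate is affected, where `y₁ = f(y_{d+1}) ≤ f(x_{d+1} - c n)` by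
monotonicity of `f`. -/
theorem prec_lower (hy : ℓ.f d (y.1 ⊤) = y.1 0) {c : ℤ} (h : Prec y.1 (fun i => x.1 i - c * n)) :
    Prec y.1 (fun i => (lower x).1 i - c * n) := by
  refine ⟨fun i => ?_, fun i j hij => ?_⟩
  · change y.1 i ≤ (lower x).1 i - c * n
    by_cases hi : i = 0
    · subst hi
      have h1 := ℓ.f_mono d (h.1 ⊤)
      have h2 := ℓ.f_add_mul d (x.1 ⊤) (-c)
      rw [neg_mul, ← sub_eq_add_neg, ← sub_eq_add_neg] at h2
      rw [lower_zero, ← h2, ← hy]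
      exact h1
    · rw [lower_of_ne hi]
      exact h.1 i
  · have := h.2 i j hij
    have := lower_le (x := x) i
    simp only at *
    lia

/-- Lifting from a projective `M(y)`, checked on the basis: each `f^c_{xy}` factors through the
morphism of the same degree into `M(lower x)`. -/
theorem exists_factor (hy : ℓ.f d (y.1 ⊤) = y.1 0) (φ : indecModule k y ⟶ indecModule k x) :
    ∃ ψ, φ = ψ ≫ indecHom k (lower x) x 0 := by
  refine ⟨∑ c ∈ precFinset y x, indecCoeff y x φ c • indecHom k y (lower x) c, ?_⟩
  conv_lhs => rw [eq_sum_indecHom φ]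
  rw [Preadditive.sum_comp]
  refine Finset.sum_congr rfl fun c hc => ?_
  rw [Linear.smul_comp, indecHom_comp (prec_lower hy (mem_precFinset.1 hc)) (lower_prec x), add_zero]

variable (k ℓ d) in
-- The identity of `X` factors through modules `M(x)` with `x` over `I` and also through projective
-- ones. Composing and lifting along `M(lower x) ⟶ M(x)`, it factors through the `M(lower x)`, and
-- these are again over `I` because `f` maps `I` into itself.
theorem wide_inf_projectives : wide k ℓ d ⊓ projectives k ℓ d =
    addClosure (Set.range fun x : {x : OSI ℓ d // ℓ.f d (x.1.1 ⊤) = x.1.1 0} =>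
      indecModule k x.1.1) := by
  refine funext fun X => propext ⟨fun ⟨h, h'⟩ => ?_, fun h => ⟨addClosure_mono ?_ h,
    addClosure_mono ?_ h⟩⟩
  · obtain ⟨m, F, i, r, hF, hs⟩ := exists_sum_of_addClosure h
    obtain ⟨m', G, j, q, hG, ht⟩ := exists_sum_of_addClosure h'
    choose a ha using hF
    choose b hb hb' using hG
    obtain rfl : (fun s => indecModule k (a s).1) = F := funext ha
    obtain rfl : G = fun t => indecModule k (b t) := funext hb'
    choose ψ hψ using fun t s => exists_factor ((isProj_iff _).1 (hb t)) (q t ≫ i s)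
    refine addClosure_of_sum (fun s => indecModule k (lower (a s).1))
      (fun s => ⟨⟨⟨lower (a s).1, fun l => ?_⟩, f_lower _⟩, rfl⟩)
      (fun s => ∑ t, j t ≫ ψ t s) (fun s => indecHom k (lower (a s).1) (a s).1 0 ≫ r s) ?_
    · by_cases hl : l = 0
      · subst hl
        rw [lower_zero]
        exact ℓ.f_mem_cycleLift d ((a s).2 ⊤)
      · rw [lower_of_ne hl]
        exact (a s).2 l
    · calc ∑ s, (∑ t, j t ≫ ψ t s) ≫ indecHom k (lower (a s).1) (a s).1 0 ≫ r s
          = ∑ s, (∑ t, j t ≫ q t) ≫ (i s ≫ r s) := by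
            refine Finset.sum_congr rfl fun s _ => ?_
            simp only [Preadditive.sum_comp, Category.assoc]
            refine Finset.sum_congr rfl fun t _ => ?_
            rw [← Category.assoc (ψ t s), ← hψ, Category.assoc]
        _ = 𝟙 X := by simp only [ht, Category.id_comp, hs]
  · rintro _ ⟨x, rfl⟩
    exact ⟨x.1, rfl⟩
  · rintro _ ⟨x, rfl⟩
    exact ⟨x.1.1, (isProj_iff _).2 x.2, rfl⟩

end Projective

/-! ### Transport between different Kupisch series -/

section Transport
variable {k : Type u} [Field k] {n n' : ℕ} {ℓ : KupischSeries n} {ℓ' : KupischSeries n'} {d : ℕ}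
  [NeZero d]

section
variable {x y : OS ℓ.len (d + 1)} {x' y' : OS ℓ'.len (d + 1)}

variable (k x y x' y') in
/-- The linear map with `f^c_{yx} ↦ f^c_{y'x'}`. -/
def transportMap : (indecModule k x ⟶ indecModule k y) →ₗ[k] (indecModule k x' ⟶ indecModule k y') where
  toFun φ := ∑ c ∈ precFinset x' y', indecCoeff x y φ c • indecHom k x' y' c
  map_add' φ ψ := by simp only [map_add, Pi.add_apply, add_smul, Finset.sum_add_distrib]
  map_smul' r φ := by
    simp only [map_smul, Pi.smul_apply, smul_eq_mul, mul_smul, Finset.smul_sum, RingHom.id_apply]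

variable (h : ∀ c : ℤ, Prec x.1 (fun i => y.1 i - c * n) ↔ Prec x'.1 (fun i => y'.1 i - c * n'))
include h

/-- The hypothesis identifies the index sets of the two bases, so no coefficient is lost. -/
theorem indecCoeff_transportMap (φ : indecModule k x ⟶ indecModule k y) :
    indecCoeff x' y' (transportMap k x y x' y' φ) = indecCoeff x y φ := by
  classical
  funext c
  refine (indecCoeff_sum _ c).trans ?_
  split_ifs with hc
  · rfl
  · exact (indecCoeff_eq_zero φ fun h' => hc ((h c).1 h')).symm

theorem transportMap_indecHom (c : ℤ) :
    transportMap k x y x' y' (indecHom k x y c) = indecHom k x' y' c := by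
  classical
  refine indecCoeff_injective x' y' ?_
  rw [indecCoeff_transportMap h]
  funext e
  rw [indecCoeff_indecHom, indecCoeff_indecHom, h]

end

variable {J : Type*} (x : J → OS ℓ.len (d + 1)) (x' : J → OS ℓ'.len (d + 1))
  (h : ∀ a b (c : ℤ), Prec (x a).1 (fun i => (x b).1 i - c * n) ↔
    Prec (x' a).1 (fun i => (x' b).1 i - c * n'))

variable (k) in
/-- Two families of modules `M(x)` with corresponding bases of morphisms. -/
def indecTransport :
    HomTransport k (fun a => indecModule k (x a)) (fun a => indecModule k (x' a)) where
  e a b :=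
    { transportMap k (x a) (x b) (x' a) (x' b) with
      invFun := transportMap k (x' a) (x' b) (x a) (x b)
      left_inv := fun φ => indecCoeff_injective _ _ <| by
        rw [indecCoeff_transportMap fun c => (h a b c).symm]
        exact indecCoeff_transportMap (h a b) φ
      right_inv := fun φ => indecCoeff_injective _ _ <|
        (indecCoeff_transportMap (h a b) _).trans
          (indecCoeff_transportMap (fun c => (h a b c).symm) φ) }
  map_id a := by
    rw [← indecHom_id, ← indecHom_id]
    exact transportMap_indecHom (h a a) 0
  map_comp {a b c} φ ψ := by
    change transportMap k (x a) (x c) (x' a) (x' c) (φ ≫ ψ) =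
      transportMap k (x a) (x b) (x' a) (x' b) φ ≫ transportMap k (x b) (x c) (x' b) (x' c) ψ
    have hF : ∀ a b, precFinset (x a) (x b) = precFinset (x' a) (x' b) := fun a b => by
      ext c
      rw [mem_precFinset, mem_precFinset, h]
    rw [comp_eq_sum φ ψ, comp_eq_sum]
    simp only [map_sum, map_smul, transportMap_indecHom (h a c), indecCoeff_transportMap (h a b),
      indecCoeff_transportMap (h b c), hF]

theorem indecTransport_indecHom (a b : J) (c : ℤ) :
    (indecTransport k x x' h).e a b (indecHom k (x a) (x b) c) = indecHom k (x' a) (x' b) c :=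
  transportMap_indecHom (h a b) c

end Transport

/-- An isomorphism between members of the first family yields one between the corresponding members
of the second family. -/
def HomTransport.mapIso {k : Type u} [Field k] {D D' : Type*} [Category D] [Category D']
    [Preadditive D] [Preadditive D'] [Linear k D] [Linear k D'] {J : Type*} {X : J → D}
    {Y : J → D'} (T : HomTransport k X Y) {a b : J} (i : X a ≅ X b) : Y a ≅ Y b where
  hom := T.e a b i.hom
  inv := T.e b a i.inv
  hom_inv_id := by rw [← T.map_comp, i.hom_inv_id, T.map_id]
  inv_hom_id := by rw [← T.map_comp, i.inv_hom_id, T.map_id]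

/-! ### Self-injectivity from a non-degenerate form -/

section Frobenius
open MulOpposite

/-- A finite-dimensional algebra with a non-degenerate linear form is self-injective. -/
theorem isSelfInjective_of_linearForm (k : Type*) {R : Type u} [Field k] [Ring R] [Algebra k R]
    [Module.Finite k R] (t : R →ₗ[k] k) (ht : ∀ a, (∀ b, t (a * b) = 0) → a = 0) :
    IsSelfInjective R := by
  -- An injection of `R` into its dual, bijective by equality of dimensions.
  let β : R →ₗ[k] Module.Dual k R := (LinearMap.mul k R).compr₂ t
  have hβ : Function.Injective β :=
    (injective_iff_map_eq_zero β).2 fun a ha => ht a fun b => LinearMap.congr_fun ha b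
  have hβs : Function.Surjective β :=
    (LinearMap.injective_iff_surjective_of_finrank_eq_finrank Subspace.dual_finrank_eq.symm).1 hβ
  refine ⟨fun X Y _ _ _ _ f hf g => ?_⟩
  let _ : Module k X := Module.compHom X (algebraMap k Rᵐᵒᵖ)
  let _ : Module k Y := Module.compHom Y (algebraMap k Rᵐᵒᵖ)
  have : IsScalarTower k Rᵐᵒᵖ X := ⟨fun c r x => by
    rw [Algebra.smul_def, mul_smul]; rfl⟩
  have : IsScalarTower k Rᵐᵒᵖ Y := ⟨fun c r x => by
    rw [Algebra.smul_def, mul_smul]; rfl⟩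
  obtain ⟨L, hL⟩ := (f.restrictScalars k).exists_leftInverse_of_injective
    (LinearMap.ker_eq_bot.2 hf)
  have hL' : ∀ x, L (f x) = x := fun x => LinearMap.congr_fun hL x
  -- A linear form on `Y` extending `t ∘ g`. The functional `b ↦ Φ(y b)` equals `t(h(y) ·)` for a
  -- unique `h(y)`, and `h` is the required extension of `g`.
  let Φ : Y →ₗ[k] k := t ∘ₗ g.restrictScalars k ∘ₗ L
  have hΦ : ∀ x, Φ (f x) = t (g x) := fun x => congrArg (fun x => t (g x)) (hL' x)
  let γ : Y → Module.Dual k R := fun y =>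
    { toFun := fun b => Φ (op b • y)
      map_add' := fun b c => by rw [MulOpposite.op_add, add_smul, map_add]
      map_smul' := fun c b => by rw [MulOpposite.op_smul, smul_assoc, map_smul]; rfl }
  choose h hh using fun y => hβs (γ y)
  have key : ∀ y b, t (h y * b) = Φ (op b • y) := fun y b => LinearMap.congr_fun (hh y) b
  have hext : ∀ a a', (∀ b, t (a * b) = t (a' * b)) → a = a' := fun a a' H =>
    sub_eq_zero.1 (ht _ fun b => by rw [sub_mul, map_sub, H, sub_self])
  refine ⟨⟨⟨h, fun y y' => hext _ _ fun b => ?_⟩, fun r y => hext _ _ fun b => ?_⟩,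
    fun x => hext _ _ fun b => ?_⟩
  · rw [add_mul, map_add, key, key, key, smul_add, map_add]
  · change t (h (r • y) * b) = t (h y * unop r * b)
    rw [mul_assoc, key, key, MulOpposite.op_mul, MulOpposite.op_unop, mul_smul]
  · change t (h (f x) * b) = _
    rw [key, ← map_smul, hΦ, map_smul]
    rfl

end Frobenius

/-! ### Endomorphisms of sums of representable modules -/

section Corner
open Opposite
variable {k : Type u} [Field k] {C : Type} [Category.{u} C] [Preadditive C] [Linear k C]

/-- The linear Yoneda lemma for representable modules. -/
def yonedaHomEquiv (a b : C) :
    ((linearYoneda k C).obj a ⟶ (linearYoneda k C).obj b) ≃ₗ[k] (a ⟶ b) where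
  toFun φ := φ.app (op a) (𝟙 a)
  map_add' _ _ := rfl
  map_smul' _ _ := rfl
  invFun f := (linearYoneda k C).map f
  left_inv φ := by
    ext c g
    have := NatTrans.naturality_apply φ (Quiver.Hom.op g) (𝟙 a)
    refine this.symm.trans (congrArg (φ.app c) ?_)
    exact Category.comp_id g
  right_inv f := Category.id_comp f

theorem yonedaHomEquiv_comp {a b c : C} (φ : (linearYoneda k C).obj a ⟶ (linearYoneda k C).obj b)
    (ψ : (linearYoneda k C).obj b ⟶ (linearYoneda k C).obj c) :
    yonedaHomEquiv a c (φ ≫ ψ) = yonedaHomEquiv a b φ ≫ yonedaHomEquiv b c ψ := by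
  obtain ⟨f, rfl⟩ := (yonedaHomEquiv (k := k) a b).symm.surjective φ
  obtain ⟨g, rfl⟩ := (yonedaHomEquiv (k := k) b c).symm.surjective ψ
  rw [LinearEquiv.apply_symm_apply, LinearEquiv.apply_symm_apply]
  exact (LinearEquiv.eq_symm_apply _).1 ((linearYoneda k C).map_comp f g).symm

variable [Fintype C] {P : Cᵒᵖ ⥤ ModuleCat.{u} k} (S : Set C)
  (φ : P ≅ ⨁ fun s : S => (linearYoneda k C).obj s.1)

/-- The matrix entries of an endomorphism of a sum of representable modules. -/
def cornerEntry (s t : S) : End P →ₗ[k] (s.1 ⟶ t.1) where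
  toFun f := yonedaHomEquiv s.1 t.1
    ((biproduct.ι (fun s : S => (linearYoneda k C).obj s.1) s ≫ φ.inv) ≫ f ≫ φ.hom ≫ biproduct.π _ t)
  map_add' f g := by
    rw [← map_add, ← Preadditive.comp_add, ← Preadditive.add_comp]
  map_smul' r f := by
    rw [RingHom.id_apply, ← map_smul, ← Linear.comp_smul, ← Linear.smul_comp]

/-- Both in `End P` and in `CatAlgebra` the right factor is applied first, so no opposite algebra
appears. -/
theorem cornerEntry_mul (f g : End P) (s t : S) [Fintype S] :
    cornerEntry S φ s t (f * g) = ∑ u, cornerEntry S φ s u g ≫ cornerEntry S φ u t f := by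
  simp only [cornerEntry, LinearMap.coe_mk, AddHom.coe_mk, ← yonedaHomEquiv_comp]
  rw [← map_sum]
  congr 1
  have h : ∀ u : S, ((biproduct.ι (fun s : S => (linearYoneda k C).obj s.1) s ≫ φ.inv) ≫
      g ≫ φ.hom ≫ biproduct.π _ u) ≫
      (biproduct.ι (fun s : S => (linearYoneda k C).obj s.1) u ≫ φ.inv) ≫ f ≫ φ.hom ≫ biproduct.π _ t =
      (biproduct.ι (fun s : S => (linearYoneda k C).obj s.1) s ≫ φ.inv ≫ g ≫ φ.hom) ≫
      (biproduct.π _ u ≫ biproduct.ι (fun s : S => (linearYoneda k C).obj s.1) u) ≫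
      (φ.inv ≫ f ≫ φ.hom ≫ biproduct.π _ t) := fun u => by simp only [Category.assoc]
  simp only [h]
  rw [← Preadditive.comp_sum, ← Preadditive.sum_comp, biproduct.total]
  simp [End.mul_def]

theorem cornerEntry_injective {f : End P} (h : ∀ s t, cornerEntry S φ s t f = 0) : f = 0 := by
  have h1 : φ.inv ≫ f ≫ φ.hom = 0 := by
    refine biproduct.hom_ext' _ _ fun s => biproduct.hom_ext _ _ fun t => ?_
    have h0 : yonedaHomEquiv (k := k) s.1 t.1
      ((biproduct.ι (fun s : S => (linearYoneda k C).obj s.1) s ≫ φ.inv) ≫ f ≫ φ.hom ≫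
        biproduct.π _ t) = 0 := h s t
    simpa using (LinearEquiv.map_eq_zero_iff _).1 h0
  have h2 := congrArg (fun f => φ.hom ≫ f ≫ φ.inv) h1
  simpa using h2

theorem exists_cornerEntry_eq (g : ∀ s t : S, s.1 ⟶ t.1) :
    ∃ f : End P, ∀ s t, cornerEntry S φ s t f = g s t := by
  refine ⟨φ.hom ≫ biproduct.matrix (fun s t : S => (yonedaHomEquiv s.1 t.1).symm (g s t)) ≫ φ.inv,
    fun s t => ?_⟩
  simp [cornerEntry]

open Classical in
/-- The matrix of an endomorphism of a sum of representable modules, extended by zero. -/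
def cornerMatrix (f : End P) : CatAlgebra C := fun a b =>
  if h : a ∈ S ∧ b ∈ S then cornerEntry S φ ⟨a, h.1⟩ ⟨b, h.2⟩ f else 0

theorem cornerMatrix_of_mem (f : End P) {a b : C} (h : a ∈ S ∧ b ∈ S) :
    cornerMatrix S φ f a b = cornerEntry S φ ⟨a, h.1⟩ ⟨b, h.2⟩ f := dif_pos h

theorem cornerMatrix_of_not (f : End P) {a b : C} (h : ¬ (a ∈ S ∧ b ∈ S)) :
    cornerMatrix S φ f a b = 0 := dif_neg h

/-- The endomorphism algebra of a sum of representable modules, as a corner of the algebra of the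
category. -/
def cornerHom : End P →ₙₐ[k] CatAlgebra C where
  toFun f := cornerMatrix S φ f
  map_smul' r f := CatAlgebra.ext fun a b => by
    rw [CatAlgebra.smul_apply]
    by_cases h : a ∈ S ∧ b ∈ S
    · rw [cornerMatrix_of_mem S φ _ h, cornerMatrix_of_mem S φ _ h, map_smul]
      rfl
    · rw [cornerMatrix_of_not S φ _ h, cornerMatrix_of_not S φ _ h, smul_zero]
  map_zero' := CatAlgebra.ext fun a b => by
    rw [CatAlgebra.zero_apply]
    by_cases h : a ∈ S ∧ b ∈ S
    · rw [cornerMatrix_of_mem S φ _ h, map_zero]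
    · rw [cornerMatrix_of_not S φ _ h]
  map_add' f g := CatAlgebra.ext fun a b => by
    rw [CatAlgebra.add_apply]
    by_cases h : a ∈ S ∧ b ∈ S
    · simp only [cornerMatrix_of_mem S φ _ h, map_add]
    · simp only [cornerMatrix_of_not S φ _ h, add_zero]
  map_mul' f g := CatAlgebra.ext fun a b => by
    have : Fintype S := Fintype.ofFinite S
    rw [CatAlgebra.mul_apply]
    by_cases h : a ∈ S ∧ b ∈ S
    · rw [cornerMatrix_of_mem S φ _ h, cornerEntry_mul]
      refine Fintype.sum_of_injective Subtype.val Subtype.val_injective _ _ (fun c hc => ?_)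
        fun c => ?_
      · rw [cornerMatrix_of_not S φ g fun h' => hc ⟨⟨c, h'.2⟩, rfl⟩, zero_comp]
      · rw [cornerMatrix_of_mem S φ g ⟨h.1, c.2⟩, cornerMatrix_of_mem S φ f ⟨c.2, h.2⟩]
    · rw [cornerMatrix_of_not S φ _ h]
      refine (Finset.sum_eq_zero fun c _ => ?_).symm
      by_cases ha : a ∈ S
      · rw [cornerMatrix_of_not S φ f fun h' => h ⟨ha, h'.2⟩, comp_zero]
      · rw [cornerMatrix_of_not S φ g fun h' => ha h'.1, zero_comp]

theorem cornerHom_apply (f : End P) (s t : S) :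
    cornerHom S φ f s.1 t.1 = cornerEntry S φ s t f := cornerMatrix_of_mem S φ f ⟨s.2, t.2⟩

theorem cornerHom_of_not (f : End P) {a b : C} (h : ¬ (a ∈ S ∧ b ∈ S)) :
    cornerHom S φ f a b = 0 := cornerMatrix_of_not S φ f h

theorem cornerHom_injective : Function.Injective (cornerHom (k := k) S φ) :=
  (injective_iff_map_eq_zero _).2 fun f hf => cornerEntry_injective S φ fun s t => by
    rw [← cornerHom_apply, hf]
    rfl

theorem exists_cornerHom_eq (g : CatAlgebra C) (hg : ∀ a b, ¬ (a ∈ S ∧ b ∈ S) → g a b = 0) :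
    ∃ f : End P, cornerHom S φ f = g := by
  obtain ⟨f, hf⟩ := exists_cornerEntry_eq S φ fun s t => g s.1 t.1
  refine ⟨f, CatAlgebra.ext fun a b => ?_⟩
  by_cases h : a ∈ S ∧ b ∈ S
  · exact (cornerHom_apply S φ f ⟨a, h.1⟩ ⟨b, h.2⟩).trans (hf _ _)
  · rw [cornerHom_of_not S φ f h, hg a b h]

/-- The image consists of the matrices supported on `S × S`, which are cut out by the image of `1`.
-/
theorem range_cornerHom : Set.range (cornerHom (k := k) S φ) =
    {a | ∃ b, a = cornerHom S φ 1 * b * cornerHom S φ 1} := by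
  refine Set.Subset.antisymm ?_ ?_
  · rintro _ ⟨f, rfl⟩
    exact ⟨cornerHom S φ f, by rw [← map_mul, ← map_mul, one_mul, mul_one]⟩
  · rintro _ ⟨b, rfl⟩
    refine exists_cornerHom_eq S φ _ fun x y h => ?_
    rw [CatAlgebra.mul_apply]
    refine Finset.sum_eq_zero fun c _ => ?_
    by_cases hx : x ∈ S
    · rw [CatAlgebra.mul_apply, Finset.sum_eq_zero, comp_zero]
      intro e _
      rw [cornerHom_of_not (a := e) (b := y) S φ 1 fun h' => h ⟨hx, h'.2⟩, comp_zero]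
    · rw [cornerHom_of_not S φ 1 fun h' => hx h'.1, zero_comp]

/-- The endomorphism algebra of a sum of pairwise different representable modules is isomorphic to
an idempotent subalgebra of the algebra of the category. -/
theorem exists_corner {K : Type} [Finite K] (o : K → C) (ho : Function.Injective o)
    (φ : P ≅ ⨁ fun a => (linearYoneda k C).obj (o a)) :
    ∃ ε : CatAlgebra C, IsIdempotentElem ε ∧
      ∃ ψ : End P →ₙₐ[k] CatAlgebra C, Function.Injective ψ ∧
        Set.range ψ = {a | ∃ b, a = ε * b * ε} := by
  let φ' : P ≅ ⨁ fun s : Set.range o => (linearYoneda k C).obj s.1 :=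
    φ ≪≫ biproduct.whiskerEquiv (f := fun a => (linearYoneda k C).obj (o a))
      (g := fun s : Set.range o => (linearYoneda k C).obj s.1) (Equiv.ofInjective o ho)
      fun _ => Iso.refl _
  refine ⟨cornerHom _ φ' 1, ?_, cornerHom _ φ', cornerHom_injective _ φ', range_cornerHom _ φ'⟩
  rw [IsIdempotentElem, ← map_mul, one_mul]

/-- The endomorphism algebra of the sum of all representable modules. -/
theorem nonempty_end_algEquiv (φ : P ≅ ⨁ fun a => (linearYoneda k C).obj a) :
    Nonempty (End P ≃ₐ[k] CatAlgebra C) := by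
  let φ' : P ≅ ⨁ fun s : (Set.univ : Set C) => (linearYoneda k C).obj s.1 :=
    φ ≪≫ biproduct.whiskerEquiv (f := fun a => (linearYoneda k C).obj a)
      (g := fun s : (Set.univ : Set C) => (linearYoneda k C).obj s.1) (Equiv.Set.univ C).symm
      fun _ => Iso.refl _
  have hs : Function.Surjective (cornerHom _ φ') := fun g =>
    exists_cornerHom_eq _ φ' g fun a b h => absurd ⟨Set.mem_univ a, Set.mem_univ b⟩ h
  -- A multiplicative surjection preserves the unit.
  have h1 : cornerHom _ φ' 1 = 1 := by
    obtain ⟨f, hf⟩ := hs 1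
    calc cornerHom _ φ' 1 = cornerHom _ φ' 1 * cornerHom _ φ' f := by rw [hf, mul_one]
      _ = 1 := by rw [← map_mul, one_mul, hf]
  let ψ : End P →ₐ[k] CatAlgebra C := AlgHom.ofLinearMap
    (cornerHom _ φ' : End P →ₗ[k] CatAlgebra C) h1 (map_mul (cornerHom _ φ'))
  exact ⟨AlgEquiv.ofBijective ψ ⟨cornerHom_injective _ φ', hs⟩⟩

end Corner

/-! ### A projective `M(x)` for every object of the algebra -/

section Representable
variable {k : Type u} [Field k] {n : ℕ} {ℓ : KupischSeries n} {d : ℕ} [NeZero d]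
open IntAction Opposite

/-- A representative of an orbit. -/
def repFiber (a : Nak k ℓ d) : NakFiber a := ⟨a.orbit.out, Quotient.out_eq _⟩

/-- The sequence `x` such that `M(x)` is the representable module of an orbit. -/
def projOS (a : Nak k ℓ d) : OS ℓ.len (d + 1) :=
  ⟨projSeq ℓ (repFiber a).coord, projSeq_isOS (repFiber a).1.vertex.isOS⟩

theorem f_projOS (a : Nak k ℓ d) : ℓ.f d ((projOS a).1 ⊤) = (projOS a).1 0 := by
  simp [projOS]

theorem topObj_projOS (a : Nak k ℓ d) : topObj k (projOS a) = a := by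
  have h : topVertex (projOS a) = (repFiber a).1.vertex := Vertex.ext <| by
    funext i
    simp [topVertex, projOS]
  rw [topObj, h]
  exact congrArg OrbitCat.mk (repFiber a).2

/-- The representable module `Hom(-, a)` is isomorphic to `M(x)` with `x = projOS a`. -/
def yonedaProjIso (a : Nak k ℓ d) :
    (linearYoneda k (Nak k ℓ d)).obj a ≅ indecModule k (projOS a) :=
  eqToIso (congrArg _ (topObj_projOS a).symm) ≪≫ yonedaIso (f_projOS a)

/-- By Yoneda this is a space of morphisms between two modules `M(x)`. -/
instance (a b : Nak k ℓ d) : Module.Finite k (a ⟶ b) :=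
  Module.Finite.equiv ((Linear.homCongr k (yonedaProjIso a) (yonedaProjIso b)).symm.trans
    (yonedaHomEquiv a b))

instance : Module.Finite k (NakAlgebra k ℓ d) :=
  inferInstanceAs (Module.Finite k (∀ a b : Nak k ℓ d, a ⟶ b))

end Representable

/-! ### Socles and the non-degenerate form -/

section Selfinjective
variable {k : Type u} [Field k] {n : ℕ} {ℓ : KupischSeries n} {d : ℕ} [NeZero d]
open IntAction

/-- The smallest vertex `X` with a non-zero morphism `X ⟶ Z`. -/
def socleVertex (Z : Vertex ℓ d) : Vertex ℓ d :=
  ⟨fun i => projSeq ℓ Z.coord i.castSucc, InSupport.isOS (projSeq_isOS Z.isOS) (by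
    rw [inSupport_iff]
    intro i
    have := (projSeq_isOS (ℓ := ℓ) Z.isOS).1 (Fin.castSucc_lt_succ (i := i))
    constructor <;> lia)⟩

theorem inSupport_socleVertex (Z : Vertex ℓ d) :
    InSupport (projSeq ℓ Z.coord) (socleVertex Z).coord := by
  rw [inSupport_iff]
  intro i
  have := (projSeq_isOS (ℓ := ℓ) Z.isOS).1 (Fin.castSucc_lt_succ (i := i))
  simp only [socleVertex]
  constructor <;> lia

/-- Any non-zero morphism into `Z` can be prolonged down to the socle vertex without vanishing. -/
theorem linked_socle {X Z : NakCover k ℓ d} (h : Linked X Z) : Linked ⟨socleVertex Z.vertex⟩ X :=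
  linked_of_inSupport (projSeq_isOS Z.vertex.isOS) (inSupport_socleVertex _) h
    fun i => ((inSupport_iff _ _).1 h i).1

/-- The orbit of the smallest vertex with a non-zero morphism to a given one. -/
def socleObj (q : Nak k ℓ d) : Nak k ℓ d := ⟨Quotient.mk _ ⟨socleVertex (repFiber q).1.vertex⟩⟩

/-- The smallest vertex with a non-zero morphism to a given one. -/
def socleFiber (q : Nak k ℓ d) : NakFiber (socleObj q) :=
  ⟨⟨socleVertex (repFiber q).1.vertex⟩, rfl⟩

/-- The socle vertex of `z` is `(f(z_d + 1), z₁ + 1, …, z_{d-1} + 1)`, from which `z` can be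
recovered if `f` is injective. -/
theorem socleObj_injective (hf : Function.Injective (ℓ.f d)) :
    Function.Injective (socleObj : Nak k ℓ d → Nak k ℓ d) := by
  intro q q' h
  obtain ⟨c, hc⟩ := Quotient.exact (s := (nakAction k ℓ d).orbitSetoid)
    (congrArg OrbitCat.orbit h)
  have h1 : ∀ i : Fin d, projSeq ℓ ((repFiber q).coord + fun _ => c * n) i.castSucc =
      projSeq ℓ (repFiber q').coord i.castSucc := fun i => by
    rw [projSeq_translate]
    exact congrFun (congrArg (fun X : NakCover k ℓ d => X.vertex.coord) hc) i
  have h2 : (repFiber q).coord + (fun _ => c * n) = (repFiber q').coord := by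
    funext i
    by_cases hi : i = ⊤
    · subst hi
      have h0 := h1 0
      rw [← zero_eq_castSucc_zero, projSeq_zero, projSeq_zero] at h0
      have := hf h0
      lia
    · have hlt : (i : ℕ) + 1 < d := by
        obtain ⟨m, rfl⟩ := Nat.exists_eq_succ_of_ne_zero (NeZero.ne d)
        have h3 := i.2
        have h4 : (i : ℕ) ≠ m := fun h => hi (Fin.ext h)
        lia
      have := h1 ⟨i + 1, hlt⟩
      rw [show (⟨i + 1, hlt⟩ : Fin d).castSucc = i.succ from rfl, projSeq_succ, projSeq_succ] at this
      lia
  have h3 : Quotient.mk (nakAction k ℓ d).orbitSetoid (repFiber q).1 =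
      Quotient.mk (nakAction k ℓ d).orbitSetoid (repFiber q').1 :=
    Quotient.sound ⟨c, congrArg BoundQuiver.mk (Vertex.ext h2)⟩
  have h4 := (repFiber q).2.symm.trans (h3.trans (repFiber q').2)
  cases q
  cases q'
  exact congrArg OrbitCat.mk h4

variable (k ℓ d) in
/-- The sum of the coefficients at the socles of the representable modules. -/
def socleForm : NakAlgebra k ℓ d →ₗ[k] k where
  toFun a := ∑ q, homCoeff (socleFiber q).1 (repFiber q).1
    ((a (socleObj q) q).1 (socleFiber q) (repFiber q))
  map_add' a b := by
    rw [← Finset.sum_add_distrib]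
    exact Finset.sum_congr rfl fun q _ => map_add _ _ _
  map_smul' r a := by
    rw [RingHom.id_apply, Finset.smul_sum]
    exact Finset.sum_congr rfl fun q _ =>
      (homCoeff (socleFiber q).1 (repFiber q).1).map_smul r _

open Classical in
-- A non-zero entry of `a`, from `X` to the representative of `q`, is precomposed with the path from
-- the socle vertex to `X`. The product has a non-zero coefficient at the socle of `q`, and by
-- injectivity of `socleObj` no other term of the form contributes.
theorem socleForm_nondegenerate (hf : Function.Injective (ℓ.f d)) (a : NakAlgebra k ℓ d)
    (ha : ∀ b, socleForm k ℓ d (a * b) = 0) : a = 0 := by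
  by_contra hne
  obtain ⟨p, q, hpq⟩ : ∃ p q, a p q ≠ 0 := by
    by_contra! H
    exact hne (CatAlgebra.ext H)
  obtain ⟨X, hX⟩ : ∃ X, (a p q).1 X (repFiber q) ≠ 0 := by
    by_contra! H
    exact hpq (nak_hom_ext (repFiber q) H)
  have hl := linked_of_ne_zero hX
  let g : socleObj q ⟶ p := orbitHom (socleFiber q) X
  let b : NakAlgebra k ℓ d := Pi.single (socleObj q) (Pi.single p g)
  have hb : b (socleObj q) p = g := by
    change (Pi.single (socleObj q) (Pi.single p g) : ∀ a b : Nak k ℓ d, a ⟶ b) _ _ = g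
    rw [Pi.single_eq_same, Pi.single_eq_same]
  have hb1 : ∀ c, c ≠ p → b (socleObj q) c = 0 := fun c hc => by
    change (Pi.single (socleObj q) (Pi.single p g) : ∀ a b : Nak k ℓ d, a ⟶ b) _ _ = 0
    rw [Pi.single_eq_same, Pi.single_eq_of_ne hc]
  have hb2 : ∀ o c, o ≠ socleObj q → b o c = 0 := fun o c ho => by
    change (Pi.single (socleObj q) (Pi.single p g) : ∀ a b : Nak k ℓ d, a ⟶ b) _ _ = 0
    rw [Pi.single_eq_of_ne ho]
    rfl
  have h1 : (a * b) (socleObj q) q = g ≫ a p q := by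
    rw [CatAlgebra.mul_apply, Finset.sum_eq_single p, hb]
    · intro c _ hc
      rw [hb1 c hc, zero_comp]
    · simp
  have h2 : ∀ q', q' ≠ q → (a * b) (socleObj q') q' = 0 := fun q' hq' => by
    rw [CatAlgebra.mul_apply]
    refine Finset.sum_eq_zero fun c _ => ?_
    rw [hb2 _ c fun h => hq' (socleObj_injective hf h), zero_comp]
  have h3 : (g ≫ a p q).1 (socleFiber q) (repFiber q) =
      basisHom (socleFiber q).1 X.1 ≫ (a p q).1 X (repFiber q) := by
    refine (OrbitCat.compFamily_eq_left g (a p q) _ _ (s := {X}) fun Y hY => ?_).trans ?_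
    · rw [Finset.mem_singleton]
      by_contra hYX
      exact hY (orbitHom_self_left hYX)
    · rw [Finset.sum_singleton]
      exact congrArg (· ≫ _) (orbitHom_self _ _)
  have h5 : basisHom (socleFiber q).1 X.1 ≫ basisHom X.1 (repFiber q).1 =
      basisHom (socleFiber q).1 (repFiber q).1 := basisHom_comp (linked_socle hl) hl
  have h4 := ha b
  change ∑ q', homCoeff (socleFiber q').1 (repFiber q').1
    (((a * b) (socleObj q') q').1 (socleFiber q') (repFiber q')) = 0 at h4
  rw [Finset.sum_eq_single q, h1, h3, ← homCoeff_smul_basisHom ((a p q).1 X (repFiber q)),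
    Linear.comp_smul, h5, map_smul, homCoeff_basisHom_of_linked, smul_eq_mul, mul_one, homCoeff_eq_zero_iff] at h4
  · exact hX h4
  · exact inSupport_socleVertex _
  · intro q' _ hq'
    rw [h2 q' hq']
    exact map_zero _
  · simp

theorem isSelfInjective_of_algEquiv (hf : Function.Injective (ℓ.f d)) {R : Type u} [Ring R]
    [Algebra k R] (e : R ≃ₐ[k] NakAlgebra k ℓ d) : IsSelfInjective R := by
  have : Module.Finite k R := Module.Finite.equiv e.symm.toLinearEquiv
  refine isSelfInjective_of_linearForm k (socleForm k ℓ d ∘ₗ e.toLinearMap) fun a ha => ?_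
  refine (map_eq_zero_iff e e.injective).1 (socleForm_nondegenerate hf _ fun b => ?_)
  have := ha (e.symm b)
  simpa using this

end Selfinjective

section EndAlgebras
variable {k : Type u} [Field k] {D D' : Type*} [Category D] [Category D'] [Preadditive D]
  [Preadditive D'] [Linear k D] [Linear k D']

variable (k) in
/-- The endomorphism algebras of isomorphic objects. -/
def isoEndAlgEquiv {X Y : D} (φ : X ≅ Y) : End X ≃ₐ[k] End Y :=
  AlgEquiv.ofLinearEquiv (Linear.homCongr k φ φ) 
    (show (φ.inv ≫ 𝟙 X) ≫ φ.hom = 𝟙 Y by simp)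
    fun f g => show (φ.inv ≫ g ≫ f) ≫ φ.hom =
      ((φ.inv ≫ g) ≫ φ.hom) ≫ (φ.inv ≫ f) ≫ φ.hom by simp

/-- The endomorphism algebras of matched objects. -/
def Matched.endAlgEquiv {J : Type*} {X : J → D} {Y : J → D'} {T : HomTransport k X Y} {A : D}
    {B : D'} (M : Matched T A B) : End A ≃ₐ[k] End B :=
  AlgEquiv.ofLinearEquiv (M.mapEquiv M) M.map_id fun f g => M.map_comp M M g f

end EndAlgebras

/-! ### Assembly of the main theorem -/

section Main
variable {k : Type u} [Field k] {n : ℕ} {ℓ : KupischSeries n} {d : ℕ} [NeZero d]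

theorem topObj_eq_of_shift {x y : OS ℓ.len (d + 1)} {c : ℤ} (h : ∀ i, x.1 i = y.1 i - c * n) :
    topObj k x = topObj k y := by
  refine congrArg IntAction.OrbitCat.mk (Quotient.sound ⟨c, congrArg BoundQuiver.mk (Vertex.ext ?_)⟩)
  funext i
  have := h i.succ
  change x.1 i.succ - 1 + c * n = y.1 i.succ - 1
  lia

variable (ι : ℤ ≃o ℓ.cycleLift d) (h : 2 ≤ ℓ.newLen d ι 1)

variable (k) in
/-- The modules `M(x)` and `M(ι(x))` have corresponding bases of morphisms. -/
def osTransport : HomTransport k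
    (fun x : OS (ℓ.newSeries d ι h).len (d + 1) => indecModule k x)
    (fun x => indecModule k (osEquiv ι h x).1) :=
  indecTransport k (fun x => x) (fun x => (osEquiv ι h x).1) fun x y c =>
    (prec_osEquiv_iff ι h x y c).symm

variable (k) in
theorem wide_eq : wide k ℓ d = addClosure (Set.range fun x => indecModule k (osEquiv ι h x).1) :=
  congrArg addClosure ((osEquiv ι h).surjective.range_comp fun x : OSI ℓ d => indecModule k x.1).symm

variable (k) in
theorem wide_inf_projectives_eq_image : wide k ℓ d ⊓ projectives k ℓ d =
    addClosure ((fun x => indecModule k (osEquiv ι h x).1) ''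
      {x | (ℓ.newSeries d ι h).f d (x.1 ⊤) = x.1 0}) := by
  rw [wide_inf_projectives]
  congr 1
  ext X
  constructor
  · rintro ⟨⟨x, hx⟩, rfl⟩
    obtain ⟨x, rfl⟩ := (osEquiv ι h).surjective x
    exact ⟨x, (f_osEquiv_iff ι h x).1 hx, rfl⟩
  · rintro ⟨x, hx, rfl⟩
    exact ⟨⟨osEquiv ι h x, (f_osEquiv_iff ι h x).2 hx⟩, rfl⟩

theorem projectives_eq_image : projectives k ℓ d =
    addClosure (indecModule k '' {x | ℓ.f d (x.1 ⊤) = x.1 0}) := by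
  refine congrArg addClosure ?_
  ext X
  constructor
  · rintro ⟨x, hx, rfl⟩
    exact ⟨x, (isProj_iff x).1 hx, rfl⟩
  · rintro ⟨x, hx, rfl⟩
    exact ⟨x, (isProj_iff x).2 hx, rfl⟩

variable (k) in
/-- The indecomposable projective objects of `𝒲`. -/
def wideProj (a : Nak k (ℓ.newSeries d ι h) d) : (Nak k ℓ d)ᵒᵖ ⥤ ModuleCat.{u} k :=
  indecModule k (osEquiv ι h (projOS a)).1

/-- Over `A'`, a projective `M(x)` is representable by its top orbit `a`, hence isomorphic to
`M(projOS a)`. Transporting this isomorphism leaves one sequence for each of the finitely many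
objects `a`. -/
theorem wide_inf_projectives_eq_range :
    wide k ℓ d ⊓ projectives k ℓ d = addClosure (Set.range (wideProj k ι h)) := by
  rw [wide_inf_projectives_eq_image k ι h]
  refine funext fun X => propext ⟨addClosure_trans ?_, addClosure_mono ?_⟩
  · rintro _ ⟨x, hx, rfl⟩
    let i : indecModule k x ≅ indecModule k (projOS (topObj k x)) :=
      (yonedaIso hx).symm ≪≫ yonedaProjIso (topObj k x)
    exact addClosure_of_retract (mem_addClosure ⟨topObj k x, rfl⟩)
      (Retract.ofIso ((osTransport k ι h).mapIso i))
  · rintro _ ⟨a, rfl⟩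
    exact ⟨projOS a, f_projOS a, rfl⟩

/-- A summand relation forces equality up to translation by a multiple of `n`. Under `ι` this is
translation by a multiple of `n'`, so the orbits agree. -/
theorem mem_of_addClosure_wideProj (a : Nak k (ℓ.newSeries d ι h) d)
    (S : Set (Nak k (ℓ.newSeries d ι h) d))
    (hS : addClosure (wideProj k ι h '' S) (wideProj k ι h a)) : a ∈ S := by
  have h1 : wideProj k ι h '' S = indecModule k '' ((fun a => (osEquiv ι h (projOS a)).1) '' S) := by
    rw [Set.image_image]
    rfl
  rw [h1] at hS
  obtain ⟨_, ⟨b, hb, rfl⟩, c, hc⟩ := exists_shift_of_addClosure hS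
  have h2 : topObj k (projOS a) = topObj k (projOS b) := topObj_eq_of_shift (c := c) fun i => by
    have h3 := KupischSeries.coe_add_mul ι ((projOS b).1 i) (-c)
    have h4 := hc i
    rw [osEquiv_apply, osEquiv_apply, sub_eq_add_neg, ← neg_mul, ← h3, KupischSeries.coe_inj] at h4
    rw [h4, neg_mul, sub_eq_add_neg]
  rw [topObj_projOS, topObj_projOS] at h2
  exact h2 ▸ hb

/-- The indecomposable projective objects of `𝒲` are representable. -/
def wideProjIso (a : Nak k (ℓ.newSeries d ι h) d) :
    wideProj k ι h a ≅ (linearYoneda k (Nak k ℓ d)).obj (topObj k (osEquiv ι h (projOS a)).1) :=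
  (yonedaIso ((f_osEquiv_iff ι h _).2 (f_projOS a))).symm

/-- Equal orbits give isomorphic representable modules, to which `mem_of_addClosure_wideProj`
applies. -/
theorem topObj_osEquiv_injective : Function.Injective
    fun a : Nak k (ℓ.newSeries d ι h) d => topObj k (osEquiv ι h (projOS a)).1 := by
  intro a b hab
  refine mem_of_addClosure_wideProj ι h a {b} ?_
  rw [Set.image_singleton]
  exact addClosure_of_retract (mem_addClosure rfl) (Retract.ofIso
    (wideProjIso ι h a ≪≫ eqToIso (congrArg _ hab) ≪≫ (wideProjIso ι h b).symm))

/-- For a constant series `f` is a translation. -/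
theorem newSeries_f_injective : Function.Injective ((ℓ.newSeries d ι h).f d) := by
  intro i j hij
  simp only [KupischSeries.f, KupischSeries.newSeries, KupischSeries.const] at hij
  lia

theorem exists_iso_biproduct :
    (∃ P, IsBasicAdditiveGenerator (wide k ℓ d ⊓ projectives k ℓ d) P) ∧
      ∀ P, IsBasicAdditiveGenerator (wide k ℓ d ⊓ projectives k ℓ d) P →
        Nonempty (P ≅ ⨁ wideProj k ι h) := by
  rw [wide_inf_projectives_eq_range ι h]
  exact isBasicAdditiveGenerator_iff k (wideProj k ι h)
    (fun a => trivialIdempotents_indecModule _) (fun a => not_isZero_indecModule _)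
    (fun a b => inferInstanceAs (Module.Finite k (indecModule k _ ⟶ indecModule k _)))
    (mem_of_addClosure_wideProj ι h)

/-- Up to isomorphism `P` is matched with the sum of the `M(projOS a)`, which is the sum of all
representable `A'`-modules. -/
theorem nonempty_end_algEquiv_newSeries {P : (Nak k ℓ d)ᵒᵖ ⥤ ModuleCat.{u} k}
    (φ : P ≅ ⨁ wideProj k ι h) :
    Nonempty (End P ≃ₐ[k] NakAlgebra k (ℓ.newSeries d ι h) d) := by
  obtain ⟨e⟩ := nonempty_end_algEquiv (k := k)
    (biproduct.mapIso fun a : Nak k (ℓ.newSeries d ι h) d => (yonedaProjIso a).symm)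
  exact ⟨(isoEndAlgEquiv k φ).trans
    ((Matched.biproduct (osTransport k ι h) projOS).endAlgEquiv.symm.trans e)⟩

variable (k) in
-- `E` sends `M(x)` to a chosen partner, so `φ x` is the canonical isomorphism to the partner
-- `M(ι(x))`; its compatibility with the `f^c` is functoriality of `Matched.map`.
theorem exists_equivalence_wide :
    ∃ E : (clusterTilting k (ℓ.newSeries d ι h) d).FullSubcategory ≌ (wide k ℓ d).FullSubcategory,
      E.functor.Additive ∧ E.functor.Linear k ∧
      (∃ φ : ∀ x : OS (ℓ.newSeries d ι h).len (d + 1),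
          E.functor.obj (clusterTiltingObj k x) ≅ wideObj k (osEquiv ι h x),
        ∀ (x y : OS (ℓ.newSeries d ι h).len (d + 1)) (c : ℤ),
          E.functor.map (clusterTiltingHom k x y c) ≫ (φ y).hom =
            (φ x).hom ≫ wideHom k (osEquiv ι h x) (osEquiv ι h y) c) ∧
      ∀ X, projectives k (ℓ.newSeries d ι h) d X.obj ↔
        projectives k ℓ d (E.functor.obj X).obj := by
  obtain ⟨E, hE, hE', M, hM⟩ := (osTransport k ι h).exists_equivalence
    (clusterTilting k (ℓ.newSeries d ι h) d) (wide k ℓ d) rfl (wide_eq k ι h)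
  refine ⟨E, hE, hE', ⟨fun x => ObjectProperty.isoMk _
    ((M (clusterTiltingObj k x)).iso (Matched.single (osTransport k ι h) x)), fun x y c => ?_⟩,
    fun X => ⟨fun hX => ?_, fun hX => ?_⟩⟩
  · refine ObjectProperty.hom_ext _ ?_
    change (E.functor.map (clusterTiltingHom k x y c)).hom ≫
        (M (clusterTiltingObj k y)).map (Matched.single (osTransport k ι h) y) (𝟙 _) =
      (M (clusterTiltingObj k x)).map (Matched.single (osTransport k ι h) x) (𝟙 _) ≫
        indecHom k (osEquiv ι h x).1 (osEquiv ι h y).1 c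
    have h1 : indecHom k (osEquiv ι h x).1 (osEquiv ι h y).1 c =
        (Matched.single (osTransport k ι h) x).map (Matched.single (osTransport k ι h) y)
          (indecHom k x y c) :=
      ((Matched.single_map (T := osTransport k ι h) x y (indecHom k x y c)).trans
        (indecTransport_indecHom (fun x => x) (fun x => (osEquiv ι h x).1) _ x y c)).symm
    rw [hM, h1]
    refine ((M (clusterTiltingObj k x)).map_comp (M (clusterTiltingObj k y))
      (Matched.single (osTransport k ι h) y) _ _).symm.trans (Eq.trans ?_
        ((M (clusterTiltingObj k x)).map_comp (Matched.single (osTransport k ι h) x)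
          (Matched.single (osTransport k ι h) y) _ _))
    exact congrArg _ ((Category.comp_id _).trans (Category.id_comp _).symm)
  · rw [projectives_eq_image] at hX
    have h1 := (M X).addClosure_image hX
    rw [← wide_inf_projectives_eq_image k ι h] at h1
    exact h1.2
  -- The image lies in `𝒲`, so projectivity puts it into the closure of the projective `M(ι(x))`,
  -- and the reversed matching carries this back.
  · have h1 : (wide k ℓ d ⊓ projectives k ℓ d) (E.functor.obj X).obj :=
      ⟨(E.functor.obj X).property, hX⟩
    rw [wide_inf_projectives_eq_image k ι h] at h1
    rw [projectives_eq_image]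
    exact (M X).symm.addClosure_image h1

end Main

end HigherNakayama
end

open CategoryTheory HigherNakayama
theorem mainTheorem8 (k : Type*) [Field k] (d : ℕ) [NeZero d] (n : ℕ) (ℓ : KupischSeries n) :
    Nonempty (ℤ ≃o ℓ.cycleLift d) ∧
    ∀ ι : ℤ ≃o ℓ.cycleLift d,
      (∀ i j : ℤ, ℓ.newLen d ι i = ℓ.newLen d ι j) ∧
      ∀ hℓ' : 2 ≤ ℓ.newLen d ι 1,
        (∃ e : OS (ℓ.newSeries d ι hℓ').len (d + 1) ≃ OSI ℓ d,
          (∀ x i, (e x).1.1 i = ι (x.1 i)) ∧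
          (∀ x y, Prec x.1 y.1 ↔ Prec (e x).1.1 (e y).1.1) ∧
          ∃ E : (clusterTilting k (ℓ.newSeries d ι hℓ') d).FullSubcategory ≌ (wide k ℓ d).FullSubcategory,
            E.functor.Additive ∧ E.functor.Linear k ∧
            (∃ φ : ∀ x : OS (ℓ.newSeries d ι hℓ').len (d + 1),
                E.functor.obj (clusterTiltingObj k x) ≅ wideObj k (e x),
              ∀ (x y : OS (ℓ.newSeries d ι hℓ').len (d + 1)) (c : ℤ),
                E.functor.map (clusterTiltingHom k x y c) ≫ (φ y).hom =
                  (φ x).hom ≫ wideHom k (e x) (e y) c) ∧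
            ∀ X, projectives k (ℓ.newSeries d ι hℓ') d X.obj ↔ projectives k ℓ d (E.functor.obj X).obj) ∧
        (∃ P, IsBasicAdditiveGenerator (wide k ℓ d ⊓ projectives k ℓ d) P) ∧
        ∀ P, IsBasicAdditiveGenerator (wide k ℓ d ⊓ projectives k ℓ d) P →
          (∃ ε : NakAlgebra k ℓ d, IsIdempotentElem ε ∧
            ∃ ψ : End P →ₙₐ[k] NakAlgebra k ℓ d, Function.Injective ψ ∧
              Set.range ψ = {a | ∃ b, a = ε * b * ε}) ∧
          Nonempty (End P ≃ₐ[k] NakAlgebra k (ℓ.newSeries d ι hℓ') d) ∧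
          IsSelfInjective (End P) := by
  refine ⟨ℓ.nonempty_orderIso d, fun ι => ⟨KupischSeries.newLen_eq ι, fun h =>
    ⟨⟨osEquiv ι h, osEquiv_apply ι h, fun x y => ?_, exists_equivalence_wide k ι h⟩,
      (exists_iso_biproduct ι h).1, fun P hP => ?_⟩⟩⟩
  -- The untranslated relation is the case `c = 0`.
  · have := prec_osEquiv_iff ι h x y 0
    simp only [zero_mul, sub_zero] at this
    exact this.symm
  · obtain ⟨φ⟩ := (exists_iso_biproduct ι h).2 P hP
    obtain ⟨e⟩ := nonempty_end_algEquiv_newSeries ι h φ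
    exact ⟨exists_corner _ (topObj_osEquiv_injective ι h)
      (φ ≪≫ biproduct.mapIso (wideProjIso ι h)), ⟨e⟩,
      isSelfInjective_of_algEquiv (newSeries_f_injective ι h) e⟩
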